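/- **Setting.** For $k\in\mathbb N$ let $\mathcal P_{\sf D}(k)$ be the set of all probability distributions on $[k]=\{1,\dots,k\}$, and let $\mathsf{TV}(p,q)=\sup_A|p(A)-q(A)|$. *Two-sample complexity.* For $\epsilon>0$ and $\delta\in(0,1/2)$, $n_{\sf TS}(\epsilon,\delta,\mathcal P_{\sf D}(k))$ is the smallest number such that for every integer $n\ge n_{\sf TS}(\epsilon,\delta,\mathcal P_{\sf D}(k))$ there is a test $\psi:[k]^n\times[k]^n\to\{0,1\}$ with $$p^{\otimes n}\otimes p^{\otimes n}(\psi\ne 0)\le\delta \quad\text{for all } p\in\mathcal P_{\sf D}(k),\qquad p^{\otimes n}\otimes q^{\otimes n}(\psi\ne1)\le\delta\quad\text{for all } p,q\in\mathcal P_{\sf D}(k)\text{ with }\mathsf{TV}(p,q)\ge\epsilon .$$ *The separating set.* Given $p,q\in\mathcal P_{\sf D}(k)$ and $n\in\mathbb N$, draw independently $N_X,N_Y\sim\mathrm{Poi}(n)$, then $N_X$ iid samples from $p$ and $N_Y$ iid samples from $q$, and, independently, iid $C_1,\dots,C_k\sim\mathrm{Ber}(1/2)$. Let $nX_i$ and $nY_i$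 be the numbers of occurrences of the symbol $i$ in the first and in the second sample (so that $nX_i\sim\mathrm{Poi}(np_i)$ and $nY_i\sim\mathrm{Poi}(nq_i)$). Put $$\hat S_{1/2}=\{i\in[k]: X_i>Y_i,\ \text{or } X_i=Y_i \text{ and } C_i=1\},\qquad \mathrm{sep}(A)=p(A)-q(A)\quad (A\subseteq[k]).$$ **Proposition.** For every $\delta_0<1/2$ there is a constant $c>0$, depending only on $\delta_0$, such that for all $k$, all $\epsilon>0$, all $\delta\in(0,\delta_0]$, all $p,q\in\mathcal P_{\sf D}(k)$ with $\mathsf{TV}(p,q)\ge\epsilon$, and all $n\in\mathbb N$ with $n\ge\frac1c\,n_{\sf TS}(\epsilon,\delta,\mathcal P_{\sf D}(k))$, $$\mathbb P\left(\mathrm{sep}(\hat S_{1/2})\ge c\,\epsilon^2\left(\frac nk\wedge\sqrt{\frac nk}\wedge\frac1\epsilon\right)\right)\ge 1-\delta .$$ -/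

import Mathlib

open MeasureTheory ProbabilityTheory Set
open scoped ENNReal NNReal

noncomputable section

/-! ### Minimax two-sample testing -/

/-- Total variation distance `sup_A |P(A) - Q(A)|` of two probability measures. -/
def tvDist {𝒳 : Type*} [MeasurableSpace 𝒳] (P Q : ProbabilityMeasure 𝒳) : ℝ :=
  ⨆ A : {A : Set 𝒳 // MeasurableSet A},
    |(P : Measure 𝒳).real A.1 - (Q : Measure 𝒳).real A.1|

/-- `ψ` tests the hypotheses `H 0` and `H 1` (sets of probability measures) against each other with
error at most `δ`. -/
def TestsWithError {𝒮 : Type*} [MeasurableSpace 𝒮] (ψ : 𝒮 → Fin 2)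
    (H : Fin 2 → Set (Measure 𝒮)) (δ : ℝ) : Prop :=
  ∀ i, ∀ P ∈ H i, P.real {s | ψ s ≠ i} ≤ δ

/-- The law of two independent samples of sizes `n`, with iid entries from `P` and from `Q`. -/
def twoSampleLaw {𝒳 : Type*} [MeasurableSpace 𝒳] (n : ℕ) (P Q : ProbabilityMeasure 𝒳) :
    Measure ((Fin n → 𝒳) × (Fin n → 𝒳)) :=
  (Measure.pi fun _ : Fin n => (P : Measure 𝒳)).prod (Measure.pi fun _ : Fin n => (Q : Measure 𝒳))

/-- The hypotheses of two-sample testing over the class `Γ`: under `0` the two samples have the same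
distribution, under `1` their distributions are at total variation distance at least `ε`. -/
def twoSampleHyp {𝒳 : Type*} [MeasurableSpace 𝒳] (n : ℕ) (ε : ℝ)
    (Γ : Set (ProbabilityMeasure 𝒳)) : Fin 2 → Set (Measure ((Fin n → 𝒳) × (Fin n → 𝒳))) :=
  ![{R | ∃ P ∈ Γ, R = twoSampleLaw n P P},
    {R | ∃ P ∈ Γ, ∃ Q ∈ Γ, ε ≤ tvDist P Q ∧ R = twoSampleLaw n P Q}]

/-- The minimax sample complexity `n_TS(ε, δ, Γ)`: the smallest `N` such that for all `n ≥ N` some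
test based on samples of size `n` has error at most `δ` (it is `⊤` if there is no such `N`). -/
def nTS {𝒳 : Type*} [MeasurableSpace 𝒳] (ε δ : ℝ) (Γ : Set (ProbabilityMeasure 𝒳)) : ℕ∞ :=
  sInf {N : ℕ∞ | ∀ n : ℕ, N ≤ n →
    ∃ ψ : (Fin n → 𝒳) × (Fin n → 𝒳) → Fin 2,
      Measurable ψ ∧ TestsWithError ψ (twoSampleHyp n ε Γ) δ}

/-- The class of all distributions on an alphabet with `k` letters. -/
def classD (k : ℕ) : Set (ProbabilityMeasure (Fin k)) := Set.univ

/-! ### The separating set -/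

/-- The separation `p(A) - q(A)`. -/
def sep {k : ℕ} (p q : ProbabilityMeasure (Fin k)) (A : Set (Fin k)) : ℝ :=
  (p : Measure (Fin k)).real A - (q : Measure (Fin k)).real A

/-- Law of a Poissonized sample: a `Poi(n)` sample size `N` and, independently of it, an iid sequence
from `p`, of which the first `N` terms are observed. -/
def poissonizedLaw {k : ℕ} (n : ℕ) (p : ProbabilityMeasure (Fin k)) :
    Measure (ℕ × (ℕ → Fin k)) :=
  (poissonMeasure (n : ℝ≥0)).prod (Measure.infinitePi fun _ : ℕ => (p : Measure (Fin k)))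

/-- Empirical frequency of the letter `i` in a Poissonized sample `s`: the number of occurrences of
`i` among the observed terms, divided by the nominal sample size `n`. -/
def empFreq {k : ℕ} (n : ℕ) (s : ℕ × (ℕ → Fin k)) (i : Fin k) : ℝ :=
  (((Finset.range s.1).filter fun j => s.2 j = i).card : ℝ) / n

/-- Law of `k` iid fair coins. -/
def coinLaw (k : ℕ) : Measure (Fin k → Bool) :=
  Measure.pi fun _ : Fin k => bernoulliMeasure true false ⟨1 / 2, by norm_num, by norm_num⟩

/-- `{i : X i > Y i, or X i = Y i and C i = 1}`. -/
def sHalf {k : ℕ} (X Y : Fin k → ℝ) (C : Fin k → Bool) : Set (Fin k) :=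
  {i | X i > Y i ∨ (X i = Y i ∧ C i = true)}

/-- Joint law of the two Poissonized samples, from `p` and from `q`, and of the coins, all
independent. -/
def dataLaw {k : ℕ} (n : ℕ) (p q : ProbabilityMeasure (Fin k)) :
    Measure (((ℕ × (ℕ → Fin k)) × (ℕ × (ℕ → Fin k))) × (Fin k → Bool)) :=
  ((poissonizedLaw n p).prod (poissonizedLaw n q)).prod (coinLaw k)

/-- The random set built from the data `ω`. -/
def sHalfHat {k : ℕ} (n : ℕ)
    (ω : ((ℕ × (ℕ → Fin k)) × (ℕ × (ℕ → Fin k))) × (Fin k → Bool)) : Set (Fin k) :=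
  sHalf (empFreq n ω.1.1) (empFreq n ω.1.2) ω.2

end

/-!
The argument compares two sides: how well the separating set does with `n` samples, and how many
samples any two-sample test needs. Both are governed by the same three inequalities. Write `e` for
the total variation distance (as half the `ℓ¹` distance, `halfL1`), `L = log (1 / δ)`, and `R = e²
min(n / k, √(n / k), 1 / e)`.

*The separating set.* By Poisson splitting (`map_sampleCount_poissonizedLaw`) the letter counts are
independent Poisson variables, so twice the separation is a sum over the letters of `|p i - q i|`
with independent signs. A sign is positive with a bias of order at least `min(1, u / √(s + 1))`,
where `u` is the difference and `s` the sum of the two rates (`min_le_poisson_bias`), and it is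
negative with probability at most `exp(-u² / (4 s))` (`poisson_prod_le_exp`). The biases add up to a
drift of order `R` (`drift_lower_bound`). The two facts together also bound the moment generating
function of each sign, in such a way that the fluctuations only count the common mass `1 - e = ∑
min(p i, q i)` (`sign_mgf_le`, `lintegral_exp_sep_le`). Chernoff's bound then shows that the
separation is of order `R` with probability at least `1 - δ` as soon as, for a small absolute
constant `c`, `L ≤ c n e²`, `L ≤ c n² e⁴ / k` and `L (1 - e) ≤ c n³ e⁴ / k²`
(`one_sub_exp_le_dataLaw`).

*Testing.* A two-sample test with `m` samples forces the same three inequalities for `m`, with a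
large constant that depends on `δ₀` only (`exists_sample_size_lower_bounds`). Each comes from a
mixture of alternatives and the second moment `V` of its likelihood ratio: both errors being at most
`δ` implies `1 + g² / δ ≤ V` (`one_add_sq_div_le_of_errors`). Random perturbations of the uniform
distribution give the first two (`one_add_sq_div_le_pairMoment`, `pairMoment_le_exp_mul`). For the
third one, a few heavy letters of the same mass in both distributions are hidden among light letters
that appear in one of the two distributions only, and the null hypothesis gives each light letter
its average mass in both samples. Poissonization makes the letters independent (`mixWeight_eq`), so
that `V` factors (`one_add_sq_div_le_exp_of_heavy`).

If `n` is at least `1 / c` times the sample complexity, a test with `m = ⌊c n⌋` samples exists, and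
its three inequalities imply those for `n` when `c` is small. The test is used for the distance `e`
in place of `ε ≤ e`.
-/

/-! ### Letter counts of words and products of sums -/

/-- A product of sums over countable types expands into a sum of products. -/
theorem tsum_prod_pi {ι α : Type*} [Fintype ι] (g : ι → α → ℝ≥0∞) :
    ∑' c : ι → α, ∏ i, g i (c i) = ∏ i, ∑' a, g i a := by
  revert g
  refine Fintype.induction_empty_option (P := fun ι _ => ∀ g : ι → α → ℝ≥0∞,
    ∑' c : ι → α, ∏ i, g i (c i) = ∏ i, ∑' a, g i a) ?_ ?_ ?_ ι
  · intro β γ _ e ih g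
    let _ : Fintype β := Fintype.ofEquiv γ e.symm
    rw [← (e.arrowCongr (Equiv.refl α)).tsum_eq]
    have h := ih (fun b => g (e b))
    rw [Fintype.prod_equiv e (fun b => ∑' a, g (e b) a) (fun i => ∑' a, g i a) (fun _ => rfl)] at h
    rw [← h]
    refine tsum_congr fun c => ?_
    refine (Fintype.prod_equiv e _ _ fun b => ?_).symm
    simp
  · intro g
    simp
  · intro β _ ih g
    rw [← (Equiv.piOptionEquivProd (β := fun _ => α)).symm.tsum_eq, ENNReal.tsum_prod',
      Fintype.prod_option, ← ih, ← ENNReal.tsum_mul_right]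
    refine tsum_congr fun a => ?_
    rw [← ENNReal.tsum_mul_left]
    refine tsum_congr fun c => ?_
    simp [Fintype.prod_option, Equiv.piOptionEquivProd]

theorem lintegral_prod_pi {ι α : Type*} [Fintype ι] [Countable α] [MeasurableSpace α]
    [MeasurableSingletonClass α] (μ : ι → Measure α) [∀ i, SigmaFinite (μ i)]
    (g : ι → α → ℝ≥0∞) :
    ∫⁻ c, ∏ i, g i (c i) ∂Measure.pi μ = ∏ i, ∫⁻ a, g i a ∂μ i := by
  simp only [lintegral_countable', Measure.pi_singleton, ← Finset.prod_mul_distrib]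
  exact tsum_prod_pi fun i a => g i a * μ i {a}

/-- The number of occurrences of the letter `i` in the word `x`. -/
def letterCount {ι : Type*} [DecidableEq ι] {N : ℕ} (x : Fin N → ι) (i : ι) : ℕ :=
  (Finset.univ.filter fun j => x j = i).card

theorem letterCount_cons {ι : Type*} [DecidableEq ι] {N : ℕ} (a : ι) (x : Fin N → ι) :
    letterCount (Fin.cons a x : Fin (N + 1) → ι) = letterCount x + Pi.single a 1 := by
  funext i
  simp only [letterCount, Finset.card_filter, Fin.sum_univ_succ, Fin.cons_zero, Fin.cons_succ,
    Pi.add_apply, Pi.single_apply, eq_comm (a := i)]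
  ring

theorem sum_letterCount {ι : Type*} [DecidableEq ι] [Fintype ι] {N : ℕ} (x : Fin N → ι) :
    ∑ i, letterCount x i = N := by
  have := Finset.card_eq_sum_card_fiberwise (f := x) (s := Finset.univ) (t := Finset.univ)
    (fun _ _ => Finset.mem_coe.2 (Finset.mem_univ _))
  simpa [letterCount] using this.symm

theorem prod_pow_letterCount {ι M : Type*} [DecidableEq ι] [Fintype ι] [CommMonoid M] {N : ℕ}
    (x : Fin N → ι) (a : ι → M) : ∏ j, a (x j) = ∏ i, a i ^ letterCount x i := by
  rw [← Fintype.prod_fiberwise' x a]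
  simp [letterCount, Fintype.card_subtype]

/-- The multinomial count: there are `N! / ∏ (c i)!` words of length `N` with letter counts `c`. -/
theorem prod_factorial_mul_card_letterCount {ι : Type*} [DecidableEq ι] [Fintype ι] (N : ℕ)
    (c : ι → ℕ) (hc : ∑ i, c i = N) :
    (∏ i, (c i).factorial) * (Finset.univ.filter fun x : Fin N → ι => letterCount x = c).card
      = N.factorial := by
  induction N generalizing c with
  | zero =>
    have h0 : c = 0 := by
      funext i
      exact (Finset.sum_eq_zero_iff.1 hc) i (Finset.mem_univ i)
    subst h0
    have : ∀ x : Fin 0 → ι, letterCount x = 0 := fun x => by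
      funext i; simp [letterCount]
    simp [this]
  | succ N ih =>
    have hcard : (Finset.univ.filter fun x : Fin (N + 1) → ι => letterCount x = c).card
        = ∑ a, (Finset.univ.filter fun x : Fin N → ι =>
            letterCount x + Pi.single a 1 = c).card := by
      simp only [Finset.card_filter]
      rw [← (Fin.consEquiv fun _ => ι).sum_comp, Fintype.sum_prod_type]
      refine Finset.sum_congr rfl fun a _ => Finset.sum_congr rfl fun x _ => ?_
      have : (Fin.consEquiv fun _ : Fin (N + 1) => ι) (a, x) = (Fin.cons a x : Fin (N + 1) → ι) :=
        rfl
      rw [this, letterCount_cons]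
    rw [hcard, Finset.mul_sum]
    have hterm : ∀ a, (∏ i, (c i).factorial) *
        (Finset.univ.filter fun x : Fin N → ι => letterCount x + Pi.single a 1 = c).card
          = c a * N.factorial := by
      intro a
      rcases Nat.eq_zero_or_pos (c a) with h | h
      · have : (Finset.univ.filter fun x : Fin N → ι => letterCount x + Pi.single a 1 = c) = ∅ := by
          refine Finset.filter_eq_empty_iff.2 fun x _ hx => ?_
          have := congrFun hx a
          simp [h] at this
        simp [this, h]
      · have hle : Pi.single a 1 ≤ c := by
          intro i
          by_cases hi : i = a
          · subst hi; simpa using Nat.succ_le_of_lt h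
          · simp [hi]
        set c' := c - Pi.single a 1 with hc'
        have hcc : c = c' + Pi.single a 1 := (tsub_add_cancel_of_le hle).symm
        have hs : ∑ i, c' i = N := by
          rw [hcc] at hc
          simp only [Pi.add_apply, Finset.sum_add_distrib, Finset.sum_pi_single',
            Finset.mem_univ, if_true] at hc
          omega
        have hfil : (Finset.univ.filter fun x : Fin N → ι => letterCount x + Pi.single a 1 = c)
            = Finset.univ.filter fun x : Fin N → ι => letterCount x = c' := by
          ext x
          rw [hcc]
          simp
        have hfac : ∏ i, (c i).factorial = c a * ∏ i, (c' i).factorial := by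
          rw [← Finset.mul_prod_erase _ _ (Finset.mem_univ a),
            ← Finset.mul_prod_erase _ (fun i => (c' i).factorial) (Finset.mem_univ a), ← mul_assoc]
          congr 1
          · have : c a = c' a + 1 := by rw [hcc]; simp
            rw [this, Nat.factorial_succ]
          · refine Finset.prod_congr rfl fun i hi => ?_
            rw [hcc]
            simp [(Finset.mem_erase.1 hi).1]
        rw [hfil, hfac, mul_assoc, ih c' hs]
    rw [Finset.sum_congr rfl fun a _ => hterm a, ← Finset.sum_mul, hc, Nat.factorial_succ]

/-- Exponential generating form of the multinomial count: summing a function of the letter counts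
over all words of all lengths, with weight `1 / N!` on each word of length `N`, is the same as
summing it over all count vectors, with weight `1 / ∏ (c i)!`. -/
theorem tsum_sum_letterCount {ι : Type*} [DecidableEq ι] [Fintype ι] (F : (ι → ℕ) → ℝ≥0∞) :
    ∑' N : ℕ, ∑ x : Fin N → ι, (N.factorial : ℝ≥0∞)⁻¹ * F (letterCount x)
      = ∑' c : ι → ℕ, (∏ i, ((c i).factorial : ℝ≥0∞)⁻¹) * F c := by
  have h1 : ∀ N : ℕ, ∑ x : Fin N → ι, (N.factorial : ℝ≥0∞)⁻¹ * F (letterCount x)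
      = ∑' c : ι → ℕ, ∑' x : Fin N → ι,
          if c = letterCount x then (N.factorial : ℝ≥0∞)⁻¹ * F c else 0 := by
    intro N
    rw [ENNReal.tsum_comm, tsum_fintype]
    refine Finset.sum_congr rfl fun x _ => ?_
    rw [tsum_ite_eq]
  rw [tsum_congr h1, ENNReal.tsum_comm]
  refine tsum_congr fun c => ?_
  rw [tsum_eq_single (∑ i, c i)]
  · have hcard := prod_factorial_mul_card_letterCount (∑ i, c i) c rfl
    have hP : (∏ i, ((c i).factorial : ℝ≥0∞)⁻¹) = (((∏ i, (c i).factorial : ℕ)) : ℝ≥0∞)⁻¹ := by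
      rw [Nat.cast_prod, ENNReal.prod_inv_distrib]
      intro i _ j _ _
      exact Or.inl (by exact_mod_cast (c i).factorial_ne_zero)
    have hP0 : (((∏ i, (c i).factorial : ℕ)) : ℝ≥0∞) ≠ 0 := by
      exact_mod_cast Finset.prod_ne_zero_iff.2 fun i _ => (c i).factorial_ne_zero
    have hN0 : (((∑ i, c i).factorial : ℕ) : ℝ≥0∞) ≠ 0 := by
      exact_mod_cast (∑ i, c i).factorial_ne_zero
    rw [tsum_fintype, ← Finset.sum_filter, Finset.sum_const, nsmul_eq_mul, hP, ← mul_assoc]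
    congr 1
    simp only [eq_comm (a := c)]
    have hc0 : (((Finset.univ.filter fun x : Fin (∑ i, c i) → ι => letterCount x = c).card : ℕ)
        : ℝ≥0∞) ≠ 0 := by
      intro h
      rw [← hcard, Nat.cast_mul, h, mul_zero] at hN0
      exact hN0 rfl
    rw [← hcard, Nat.cast_mul, ENNReal.mul_inv (Or.inl hP0) (Or.inl (ENNReal.natCast_ne_top _)),
      mul_left_comm, ENNReal.mul_inv_cancel hc0 (ENNReal.natCast_ne_top _), mul_one]
  · intro N hN
    refine ENNReal.tsum_eq_zero.2 fun x => if_neg ?_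
    rintro rfl
    exact hN (sum_letterCount x).symm

/-! ### Poissonization -/

theorem poissonMeasure_singleton_eq (r : ℝ≥0) (n : ℕ) :
    poissonMeasure r {n}
      = ENNReal.ofReal (Real.exp (-r)) * ((r : ℝ≥0∞) ^ n * (n.factorial : ℝ≥0∞)⁻¹) := by
  rw [poissonMeasure_singleton, mul_div_assoc, ENNReal.ofReal_mul (Real.exp_pos _).le,
    ENNReal.ofReal_div_of_pos (by positivity), ENNReal.ofReal_pow r.coe_nonneg,
    ENNReal.ofReal_coe_nnreal, ENNReal.ofReal_natCast, ENNReal.div_eq_inv_mul, mul_comm (_⁻¹)]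

/-- The weight of the word `x` in a Poissonized sample with intensity `a i` of the letter `i`. The
intensities need not be normalized: their sum is the mean of the sample size. -/
noncomputable def wordWeight {ι : Type*} [Fintype ι] (a : ι → ℝ≥0) {N : ℕ} (x : Fin N → ι) :
    ℝ≥0∞ :=
  ENNReal.ofReal (Real.exp (-∑ i, (a i : ℝ))) * ((N.factorial : ℝ≥0∞)⁻¹ * ∏ j, (a (x j) : ℝ≥0∞))

theorem wordWeight_eq {ι : Type*} [DecidableEq ι] [Fintype ι] (a : ι → ℝ≥0) {N : ℕ}
    (x : Fin N → ι) :
    wordWeight a x = (N.factorial : ℝ≥0∞)⁻¹ *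
      ∏ i, (ENNReal.ofReal (Real.exp (-a i)) * (a i : ℝ≥0∞) ^ letterCount x i) := by
  rw [wordWeight, prod_pow_letterCount x fun i => (a i : ℝ≥0∞), ← Finset.sum_neg_distrib,
    Real.exp_sum, ENNReal.ofReal_prod_of_nonneg fun i _ => (Real.exp_pos _).le,
    Finset.prod_mul_distrib]
  ring

/-- Poisson splitting: in a Poissonized sample the letter counts are independent Poisson
variables. -/
theorem tsum_wordWeight_letterCount {ι : Type*} [DecidableEq ι] [Fintype ι] (a : ι → ℝ≥0)
    (F : (ι → ℕ) → ℝ≥0∞) :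
    ∑' N : ℕ, ∑ x : Fin N → ι, wordWeight a x * F (letterCount x)
      = ∫⁻ c, F c ∂Measure.pi fun i => poissonMeasure (a i) := by
  simp only [wordWeight_eq, mul_assoc]
  rw [tsum_sum_letterCount fun c => (∏ i, (ENNReal.ofReal (Real.exp (-a i)) * (a i : ℝ≥0∞) ^ c i))
    * F c, lintegral_countable']
  refine tsum_congr fun c => ?_
  rw [Measure.pi_singleton, ← mul_assoc, mul_comm, ← Finset.prod_mul_distrib]
  congr 1
  refine Finset.prod_congr rfl fun i _ => ?_
  rw [poissonMeasure_singleton_eq]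
  ring

/-- The first `N` terms of an iid sequence form an iid sample. -/
theorem infinitePi_map_fin {α : Type*} [MeasurableSpace α] (P : Measure α) [IsProbabilityMeasure P]
    (N : ℕ) : (Measure.infinitePi fun _ : ℕ => P).map (fun s (j : Fin N) => s j)
      = Measure.pi fun _ : Fin N => P := by
  refine (Measure.pi_eq fun s hs => ?_).symm
  rw [Measure.map_apply (by fun_prop) (MeasurableSet.univ_pi hs)]
  have : (fun (x : ℕ → α) (j : Fin N) => x j) ⁻¹' Set.univ.pi s
      = Set.pi (Finset.range N : Finset ℕ) fun j => if h : j < N then s ⟨j, h⟩ else Set.univ := by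
    ext x
    simp only [Set.mem_preimage, Set.mem_pi, Set.mem_univ, true_imp_iff, Finset.coe_range,
      Set.mem_Iio]
    constructor
    · intro h j hj
      rw [dif_pos hj]
      exact h ⟨j, hj⟩
    · intro h j
      have := h j j.2
      rwa [dif_pos j.2] at this
  rw [this, Measure.infinitePi_pi]
  · rw [Finset.prod_range]
    simp
  · intro j hj
    rw [dif_pos (Finset.mem_range.1 hj)]
    exact hs _

/-- The letter counts of a Poissonized sample, that is, `empFreq` without the division by the
nominal sample size. -/
def sampleCount {k : ℕ} (s : ℕ × (ℕ → Fin k)) (i : Fin k) : ℕ :=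
  ((Finset.range s.1).filter fun j => s.2 j = i).card

theorem measurable_sampleCount {k : ℕ} :
    Measurable (sampleCount : ℕ × (ℕ → Fin k) → Fin k → ℕ) := by
  refine measurable_from_prod_countable_right fun N => measurable_pi_lambda _ fun i => ?_
  simp only [sampleCount, Finset.card_filter]
  refine Finset.measurable_sum _ fun j _ => Measurable.ite ?_ measurable_const measurable_const
  exact (measurableSet_singleton i).preimage (measurable_pi_apply j)

theorem map_sampleCount_poissonizedLaw {k : ℕ} (n : ℕ) (p : ProbabilityMeasure (Fin k)) :
    (poissonizedLaw n p).map sampleCount = Measure.pi fun i => poissonMeasure (n * p {i}) := by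
  refine Measure.ext_of_lintegral _ fun F hF => ?_
  rw [lintegral_map hF measurable_sampleCount, poissonizedLaw,
    lintegral_prod (fun s : ℕ × (ℕ → Fin k) => F (sampleCount s))
      (hF.comp measurable_sampleCount).aemeasurable,
    ← tsum_wordWeight_letterCount, lintegral_countable']
  have hsum : ∑ i, ((n * p {i} : ℝ≥0) : ℝ) = n := by
    have : ∑ i, (p {i}) = 1 := by
      have h := measure_univ (μ := (p : Measure (Fin k)))
      rw [← Finset.coe_univ, ← sum_measure_singleton] at h
      have h2 : ∀ i, (p : Measure (Fin k)) {i} = ((p {i} : ℝ≥0) : ℝ≥0∞) := fun i => by simp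
      simp only [h2] at h
      exact_mod_cast h
    rw [← NNReal.coe_sum, ← Finset.mul_sum, this]
    simp
  refine tsum_congr fun N => ?_
  have h1 : ∀ s : ℕ → Fin k, sampleCount (N, s) = letterCount fun j : Fin N => s j := by
    intro s
    funext i
    simp only [sampleCount, letterCount, Finset.card_filter, Finset.sum_range]
  simp only [h1]
  rw [← lintegral_map (μ := Measure.infinitePi fun _ : ℕ => (p : Measure (Fin k)))
    (f := fun x : Fin N → Fin k => F (letterCount x)) (measurable_of_countable _) (by fun_prop),
    infinitePi_map_fin, lintegral_fintype, Finset.sum_mul]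
  refine Finset.sum_congr rfl fun x _ => ?_
  rw [Measure.pi_singleton, poissonMeasure_singleton_eq, wordWeight, hsum]
  simp only [ENNReal.coe_mul, Finset.prod_mul_distrib, Finset.prod_const, Finset.card_univ,
    Fintype.card_fin]
  simp
  ring

/-! ### Tails of the Poisson distribution -/

theorem lintegral_poissonMeasure (r : ℝ≥0) (f : ℕ → ℝ≥0∞) :
    ∫⁻ x, f x ∂poissonMeasure r
      = ENNReal.ofReal (Real.exp (-r)) *
        ∑' n : ℕ, (n.factorial : ℝ≥0∞)⁻¹ * ((r : ℝ≥0∞) ^ n * f n) := by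
  rw [lintegral_countable', ← ENNReal.tsum_mul_left]
  refine tsum_congr fun n => ?_
  rw [poissonMeasure_singleton_eq]
  ring

theorem tsum_inv_factorial_mul_pow (z : ℝ≥0) :
    ∑' n : ℕ, (n.factorial : ℝ≥0∞)⁻¹ * (z : ℝ≥0∞) ^ n = ENNReal.ofReal (Real.exp z) := by
  have h := lintegral_poissonMeasure z fun _ => 1
  simp only [lintegral_const, measure_univ, mul_one] at h
  have h2 : ENNReal.ofReal (Real.exp z) * ENNReal.ofReal (Real.exp (-z)) = 1 := by
    rw [← ENNReal.ofReal_mul (Real.exp_pos _).le, ← Real.exp_add]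
    simp
  calc _ = (ENNReal.ofReal (Real.exp z) * ENNReal.ofReal (Real.exp (-z))) *
        ∑' n : ℕ, (n.factorial : ℝ≥0∞)⁻¹ * (z : ℝ≥0∞) ^ n := by rw [h2, one_mul]
    _ = _ := by rw [mul_assoc, ← h, mul_one]

/-- The probability generating function of the Poisson distribution. -/
theorem lintegral_pow_poissonMeasure (r z : ℝ≥0) :
    ∫⁻ x, (z : ℝ≥0∞) ^ x ∂poissonMeasure r = ENNReal.ofReal (Real.exp (r * (z - 1))) := by
  rw [lintegral_poissonMeasure]
  have : ∀ n : ℕ, (n.factorial : ℝ≥0∞)⁻¹ * ((r : ℝ≥0∞) ^ n * (z : ℝ≥0∞) ^ n)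
      = (n.factorial : ℝ≥0∞)⁻¹ * ((r * z : ℝ≥0) : ℝ≥0∞) ^ n := fun n => by
    rw [ENNReal.coe_mul, mul_pow]
  rw [tsum_congr this, tsum_inv_factorial_mul_pow, ← ENNReal.ofReal_mul (Real.exp_pos _).le,
    ← Real.exp_add]
  congr 2
  push_cast
  ring

/-- Chernoff's bound for the probability that the Poisson variable with the larger rate does not
exceed the other one. -/
theorem poisson_prod_le_exp (a b : ℝ≥0) (hab : b ≤ a) :
    ((poissonMeasure a).prod (poissonMeasure b)).real {z | z.1 ≤ z.2}
      ≤ Real.exp (-((a - b : ℝ) ^ 2 / (4 * (a + b)))) := by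
  have hab' : (b : ℝ) ≤ a := hab
  have hb0 : (0 : ℝ) ≤ b := b.2
  rcases eq_or_lt_of_le (show (0 : ℝ) ≤ a + b by positivity) with h0 | h0
  · rw [← h0]
    simp
  set s : ℝ := (a - b) / (a + b) with hs
  have hs0 : 0 ≤ s := div_nonneg (by linarith) h0.le
  have hs1 : s ≤ 1 := (div_le_one h0).2 (by linarith)
  have hsu : s * (a + b) = a - b := div_mul_cancel₀ _ h0.ne'
  set z : ℝ≥0 := ⟨1 + s, by positivity⟩ with hz
  have hz1 : (z : ℝ) = 1 + s := rfl
  have hz0 : z ≠ 0 := by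
    intro h
    have := congrArg NNReal.toReal h
    rw [hz1] at this
    simp at this
    linarith
  have hge : 1 ≤ z := by
    rw [← NNReal.coe_le_coe, hz1]
    simpa using hs0
  have key : ((poissonMeasure a).prod (poissonMeasure b)) {z | z.1 ≤ z.2}
      ≤ ENNReal.ofReal (Real.exp (-((a - b : ℝ) ^ 2 / (4 * (a + b))))) := by
    calc _ = ∫⁻ w, ({z | z.1 ≤ z.2} : Set (ℕ × ℕ)).indicator 1 w
            ∂((poissonMeasure a).prod (poissonMeasure b)) := by
          rw [lintegral_indicator_one (Set.to_countable _).measurableSet]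
      _ ≤ ∫⁻ w, ((z⁻¹ : ℝ≥0) : ℝ≥0∞) ^ w.1 * (z : ℝ≥0∞) ^ w.2
            ∂((poissonMeasure a).prod (poissonMeasure b)) := by
          refine lintegral_mono fun w => ?_
          by_cases hw : w.1 ≤ w.2
          · rw [Set.indicator_of_mem (by exact hw)]
            simp only [Pi.one_apply]
            have : (1 : ℝ≥0) ≤ z⁻¹ ^ w.1 * z ^ w.2 := by
              rw [← Nat.sub_add_cancel hw, pow_add, inv_pow, mul_comm, mul_assoc,
                mul_inv_cancel₀ (pow_ne_zero _ hz0), mul_one]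
              exact one_le_pow₀ hge
            exact_mod_cast this
          · rw [Set.indicator_of_notMem (by exact hw)]
            exact zero_le
      _ = ENNReal.ofReal (Real.exp (a * ((1 + s)⁻¹ - 1)) * Real.exp (b * s)) := by
          rw [lintegral_prod_mul (measurable_of_countable _).aemeasurable
            (measurable_of_countable _).aemeasurable, lintegral_pow_poissonMeasure,
            lintegral_pow_poissonMeasure, ← ENNReal.ofReal_mul (Real.exp_pos _).le]
          simp [hz1]
      _ ≤ _ := by
          rw [← Real.exp_add]
          refine ENNReal.ofReal_le_ofReal (Real.exp_le_exp.2 ?_)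
          have h1 : (a : ℝ) * ((1 + s)⁻¹ - 1) + b * s = - (s * (a - b * (1 + s)) / (1 + s)) := by
            field_simp
            ring
          have h2 : (a - b : ℝ) ^ 2 / (4 * (a + b)) = s * (a - b) / 4 := by
            rw [hs]
            field_simp
          rw [h1, h2, neg_le_neg_iff, div_le_div_iff₀ (by norm_num) (by positivity)]
          -- `b s ≤ (a - b) / 2`, because `b ≤ (a + b) / 2`
          have h3 : b * s ≤ (a - b) / 2 := by
            rw [← hsu]
            nlinarith
          have h4 : s * (a - b) * (1 + s) ≤ s * (a - b) * 2 :=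
            mul_le_mul_of_nonneg_left (by linarith) (mul_nonneg hs0 (by linarith))
          have h5 : s * ((a - b) / 2) ≤ s * (a - b * (1 + s)) :=
            mul_le_mul_of_nonneg_left (by linarith) hs0
          linarith
  rw [Measure.real]
  exact ENNReal.toReal_le_of_le_ofReal (Real.exp_pos _).le key

/-- Chernoff's bound for the lower tail, with the tilt `2 ^ (-x)`. -/
theorem poissonMeasure_le_two_pow (r : ℝ≥0) (m : ℕ) :
    poissonMeasure r {x | x ≤ m} ≤ ENNReal.ofReal (2 ^ m * Real.exp (-(r / 2 : ℝ))) := by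
  calc poissonMeasure r {x | x ≤ m}
      = ∫⁻ x, ({x | x ≤ m} : Set ℕ).indicator 1 x ∂poissonMeasure r := by
        rw [lintegral_indicator_one (Set.to_countable _).measurableSet]
    _ ≤ ∫⁻ x, (2 : ℝ≥0∞) ^ m * ((2⁻¹ : ℝ≥0) : ℝ≥0∞) ^ x ∂poissonMeasure r := by
        refine lintegral_mono fun x => ?_
        by_cases hx : x ≤ m
        · rw [Set.indicator_of_mem (by exact hx)]
          have : (1 : ℝ≥0) ≤ 2 ^ m * 2⁻¹ ^ x := by
            rw [← Nat.sub_add_cancel hx, pow_add, inv_pow, mul_assoc,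
              mul_inv_cancel₀ (pow_ne_zero _ two_ne_zero), mul_one]
            exact one_le_pow₀ one_le_two
          simp only [Pi.one_apply]
          exact_mod_cast this
        · rw [Set.indicator_of_notMem (by exact hx)]
          exact zero_le
    _ = _ := by
        rw [lintegral_const_mul _ (measurable_of_countable _), lintegral_pow_poissonMeasure,
          ENNReal.ofReal_mul (by positivity), ENNReal.ofReal_pow (by norm_num)]
        simp
        congr 3
        ring

/-- A Poisson variable has at least half of its mass in a window of length of order `√(r + 1)`. -/
theorem half_le_poissonMeasure_real_window (r : ℝ≥0) :
    1 / 2 ≤ (poissonMeasure r).real {x | |(x : ℝ) - r| ≤ 3 * √(r + 1)} := by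
  set σ := √((r : ℝ) + 1) with hσ
  have hr0 : (0 : ℝ) ≤ r := r.2
  have hσ1 : 1 ≤ σ := Real.one_le_sqrt.2 (by linarith)
  have hσ2 : σ ^ 2 = r + 1 := Real.sq_sqrt (by positivity)
  set s := 1 / σ with hs
  have hs0 : 0 < s := by positivity
  have hs1 : s ≤ 1 := (div_le_one (by positivity)).2 hσ1
  have hrs : r * s ^ 2 ≤ 1 := by
    rw [hs, div_pow, hσ2, one_pow, mul_one_div]
    exact (div_le_one (by positivity)).2 (by linarith)
  have hsσ : s * σ = 1 := by rw [hs]; field_simp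
  -- exponential Markov inequality with the tilts `± s`
  have tail : ∀ t : ℝ, |t| = s →
      (poissonMeasure r) {x | 3 ≤ t * ((x : ℝ) - r)} ≤ ENNReal.ofReal (Real.exp (-2)) := by
    intro t ht
    have hexp : Real.exp t - 1 - t ≤ t ^ 2 := by
      have := Real.abs_exp_sub_one_sub_id_le (x := t) (by rw [ht]; exact hs1)
      exact (abs_le.1 this).2
    have ht2 : t ^ 2 = s ^ 2 := by rw [← sq_abs, ht]
    calc (poissonMeasure r) {x | 3 ≤ t * ((x : ℝ) - r)}
        = ∫⁻ x, ({x | 3 ≤ t * ((x : ℝ) - r)} : Set ℕ).indicator 1 x ∂poissonMeasure r := by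
          rw [lintegral_indicator_one (Set.to_countable _).measurableSet]
      _ ≤ ∫⁻ x, ENNReal.ofReal (Real.exp (-3 - t * r)) *
            ((Real.exp t).toNNReal : ℝ≥0∞) ^ x ∂poissonMeasure r := by
          refine lintegral_mono fun x => ?_
          by_cases hx : 3 ≤ t * ((x : ℝ) - r)
          · rw [Set.indicator_of_mem (by exact hx)]
            change 1 ≤ ENNReal.ofReal _ * (ENNReal.ofReal (Real.exp t)) ^ x
            rw [← ENNReal.ofReal_pow (Real.exp_pos _).le, ← Real.exp_nat_mul,
              ← ENNReal.ofReal_mul (Real.exp_pos _).le, ← Real.exp_add, ENNReal.one_le_ofReal,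
              Real.one_le_exp_iff]
            nlinarith
          · rw [Set.indicator_of_notMem (by exact hx)]
            exact zero_le
      _ = ENNReal.ofReal (Real.exp (-3 - t * r) * Real.exp (r * (Real.exp t - 1))) := by
          rw [lintegral_const_mul _ (measurable_of_countable _), lintegral_pow_poissonMeasure,
            ← ENNReal.ofReal_mul (Real.exp_pos _).le, Real.coe_toNNReal _ (Real.exp_pos _).le]
      _ ≤ _ := by
          rw [← Real.exp_add]
          refine ENNReal.ofReal_le_ofReal (Real.exp_le_exp.2 ?_)
          nlinarith [mul_le_mul_of_nonneg_left hexp hr0]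
  have hcompl : {x : ℕ | |(x : ℝ) - r| ≤ 3 * σ}ᶜ
      ⊆ {x | 3 ≤ s * ((x : ℝ) - r)} ∪ {x | 3 ≤ -s * ((x : ℝ) - r)} := by
    intro x hx
    simp only [Set.mem_compl_iff, Set.mem_ofPred_eq, not_le, lt_abs] at hx
    rcases hx with hx | hx
    · left
      have := mul_le_mul_of_nonneg_left hx.le hs0.le
      simp only [Set.mem_ofPred_eq]
      nlinarith
    · right
      have := mul_le_mul_of_nonneg_left hx.le hs0.le
      simp only [Set.mem_ofPred_eq]
      nlinarith
  have hexp2 : Real.exp (-2) ≤ 1 / 4 := by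
    rw [Real.exp_neg, show (2 : ℝ) = 1 + 1 by norm_num, Real.exp_add]
    have := Real.exp_one_gt_d9
    rw [inv_le_comm₀ (by positivity) (by norm_num)]
    nlinarith
  have h1 : ∀ t : ℝ, |t| = s → (poissonMeasure r).real {x | 3 ≤ t * ((x : ℝ) - r)} ≤ 1 / 4 :=
    fun t ht => (ENNReal.toReal_le_of_le_ofReal (Real.exp_pos _).le (tail t ht)).trans hexp2
  have h2 := (measureReal_mono hcompl (μ := poissonMeasure r)).trans (measureReal_union_le _ _)
  have h3 := h1 s (abs_of_pos hs0)
  have h4 := h1 (-s) (by rw [abs_neg, abs_of_pos hs0])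
  rw [probReal_compl_eq_one_sub (Set.to_countable _).measurableSet] at h2
  linarith

/-! ### The bias of the comparison of two Poisson variables -/

/-- Two independent copies of an integer variable agree up to an error less than `z` with
probability at least the squared mass of a window, divided by the number of cells of length `z`
needed to cover it (Cauchy–Schwarz over the cells). -/
theorem sq_div_le_prod_abs_sub_lt (P : Measure ℕ) [IsProbabilityMeasure P] (lo hi z : ℕ)
    (hlh : lo ≤ hi) (hz : 0 < z) :
    (P.real (Set.Icc lo hi)) ^ 2 / (((hi : ℝ) - lo) / z + 2)
      ≤ (P.prod P).real {w | |(w.1 : ℤ) - w.2| < z} := by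
  set J := Finset.Icc (lo / z) (hi / z) with hJ
  have hmeas : ∀ s : Set ℕ, MeasurableSet s := fun s => (Set.to_countable s).measurableSet
  have hmeas2 : ∀ s : Set (ℕ × ℕ), MeasurableSet s := fun s => (Set.to_countable s).measurableSet
  have hz' : (0 : ℝ) < z := by exact_mod_cast hz
  have h1 : P.real (Set.Icc lo hi) ≤ ∑ a ∈ J, P.real {x | x / z = a} := by
    refine le_trans (measureReal_mono ?_ (measure_ne_top _ _)) (measureReal_biUnion_finset_le J _)
    intro x hx
    simp only [Set.mem_iUnion]
    exact ⟨x / z, Finset.mem_Icc.2 ⟨Nat.div_le_div_right hx.1, Nat.div_le_div_right hx.2⟩, rfl⟩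
  have h2 : ∑ a ∈ J, (P.real {x | x / z = a}) ^ 2
      ≤ (P.prod P).real {w | |(w.1 : ℤ) - w.2| < z} := by
    have : ∀ a, (P.real {x | x / z = a}) ^ 2
        = (P.prod P).real ({x | x / z = a} ×ˢ {x | x / z = a}) := fun a => by
      rw [measureReal_prod_prod, sq]
    simp only [this]
    rw [← measureReal_biUnion_finset]
    · refine measureReal_mono ?_
      intro w hw
      simp only [Set.mem_iUnion, Set.mem_prod, Set.mem_ofPred_eq] at hw
      obtain ⟨a, -, ha1, ha2⟩ := hw
      have e1 := Nat.div_add_mod w.1 z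
      have e2 := Nat.div_add_mod w.2 z
      have m1 := Nat.mod_lt w.1 hz
      have m2 := Nat.mod_lt w.2 hz
      rw [ha1] at e1
      rw [ha2] at e2
      simp only [Set.mem_ofPred_eq, abs_lt]
      omega
    · intro a _ b _ hab
      refine Set.disjoint_left.2 fun w hw hw' => hab ?_
      exact hw.1.symm.trans hw'.1
    · exact fun a _ => hmeas2 _
  have hcard : (J.card : ℝ) ≤ ((hi : ℝ) - lo) / z + 2 := by
    have hle : lo / z ≤ hi / z := Nat.div_le_div_right hlh
    rw [hJ, Nat.card_Icc, Nat.cast_sub (by omega), Nat.cast_add, Nat.cast_one, sub_div]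
    have a1 : ((hi / z : ℕ) : ℝ) ≤ hi / z := Nat.cast_div_le
    have a2 : (lo : ℝ) / z ≤ ((lo / z : ℕ) : ℝ) + 1 := by
      rw [div_le_iff₀ hz']
      have := Nat.lt_div_mul_add hz (a := lo)
      have : lo ≤ (lo / z + 1) * z := by nlinarith
      exact_mod_cast this
    linarith
  have h3 : (∑ a ∈ J, P.real {x | x / z = a}) ^ 2
      ≤ J.card * ∑ a ∈ J, (P.real {x | x / z = a}) ^ 2 := sq_sum_le_card_mul_sum_sq
  have hden : 0 < ((hi : ℝ) - lo) / z + 2 := by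
    have : (lo : ℝ) ≤ hi := by exact_mod_cast hlh
    have : 0 ≤ ((hi : ℝ) - lo) / z := div_nonneg (by linarith) hz'.le
    linarith
  rw [div_le_iff₀ hden]
  calc (P.real (Set.Icc lo hi)) ^ 2 ≤ (∑ a ∈ J, P.real {x | x / z = a}) ^ 2 :=
        pow_le_pow_left₀ measureReal_nonneg h1 2
    _ ≤ J.card * ∑ a ∈ J, (P.real {x | x / z = a}) ^ 2 := h3
    _ ≤ (((hi : ℝ) - lo) / z + 2) * (P.prod P).real {w | |(w.1 : ℤ) - w.2| < z} :=
        mul_le_mul hcard h2 (Finset.sum_nonneg fun _ _ => sq_nonneg _) hden.le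
    _ = _ := mul_comm _ _

/-- Two independent Poisson variables with the same rate `r` are closer than `z` with probability of
order at least `z / √(r + 1)`: cut the window that holds half of the mass into cells of length `z`.
-/
theorem min_le_poisson_prod_abs_sub_lt (r : ℝ≥0) (z : ℕ) :
    min 1 (z / √(r + 1)) / 32
      ≤ ((poissonMeasure r).prod (poissonMeasure r)).real {w | |(w.1 : ℤ) - w.2| < z} := by
  rcases Nat.eq_zero_or_pos z with rfl | hz
  · simp
  set σ := √((r : ℝ) + 1) with hσ
  have hr0 : (0 : ℝ) ≤ r := r.2
  have hσ1 : 1 ≤ σ := Real.one_le_sqrt.2 (by linarith)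
  have hz' : (0 : ℝ) < z := by exact_mod_cast hz
  set lo := ⌈(r : ℝ) - 3 * σ⌉₊
  set hi := ⌊(r : ℝ) + 3 * σ⌋₊
  have hsub : {x : ℕ | |(x : ℝ) - r| ≤ 3 * σ} ⊆ Set.Icc lo hi := by
    intro x hx
    have := abs_le.1 (show |(x : ℝ) - r| ≤ 3 * σ from hx)
    exact ⟨Nat.ceil_le.2 (by linarith), Nat.le_floor (by linarith)⟩
  have hW : 1 / 2 ≤ (poissonMeasure r).real (Set.Icc lo hi) :=
    (half_le_poissonMeasure_real_window r).trans (measureReal_mono hsub)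
  have hlh : lo ≤ hi := by
    by_contra h
    rw [Set.Icc_eq_empty h, measureReal_empty] at hW
    norm_num at hW
  have hlo : (r : ℝ) - 3 * σ ≤ lo := Nat.le_ceil _
  have hhi : (hi : ℝ) ≤ r + 3 * σ := Nat.floor_le (by positivity)
  have hdiv : ((hi : ℝ) - lo) / z ≤ 6 * σ / z := by
    gcongr
    linarith
  have hlh' : (lo : ℝ) ≤ hi := by exact_mod_cast hlh
  have hnn : 0 ≤ ((hi : ℝ) - lo) / z := div_nonneg (by linarith) hz'.le
  refine le_trans ?_ (sq_div_le_prod_abs_sub_lt _ lo hi z hlh hz)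
  rw [div_le_div_iff₀ (by norm_num) (by linarith)]
  have hmin0 : 0 ≤ min 1 (z / σ) := by positivity
  have h1 : min 1 (z / σ) * (((hi : ℝ) - lo) / z + 2) ≤ 8 := by
    calc _ ≤ min 1 (z / σ) * (6 * σ / z + 2) := by gcongr
      _ = min 1 (z / σ) * (6 * σ / z) + min 1 (z / σ) * 2 := by ring
      _ ≤ (z / σ) * (6 * σ / z) + 1 * 2 := by
          gcongr
          · exact min_le_right _ _
          · exact min_le_left _ _
      _ = 8 := by
          field_simp
          norm_num
  nlinarith

/-- The mean of `min 1 (z / σ)` over a Poisson variable `z` is at least of the order of the value at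
the mean of `z`. -/
theorem min_le_integral_min_poisson (u : ℝ≥0) (σ : ℝ) (hσ : 1 ≤ σ) :
    min 1 (u / σ) / 16 ≤ ∫ z, min 1 ((z : ℝ) / σ) ∂poissonMeasure u := by
  have hσ0 : 0 < σ := by linarith
  have hu0 : (0 : ℝ) ≤ u := u.2
  have hmeas : ∀ s : Set ℕ, MeasurableSet s := fun s => (Set.to_countable s).measurableSet
  have hint : Integrable (fun z : ℕ => min 1 ((z : ℝ) / σ)) (poissonMeasure u) := by
    refine Integrable.of_bound (measurable_of_countable _).aestronglyMeasurable 1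
      (Filter.Eventually.of_forall fun z => ?_)
    rw [Real.norm_of_nonneg (by positivity)]
    exact min_le_left _ _
  -- Markov's inequality at a threshold `t`
  have markov : ∀ t : ℝ, 0 ≤ t → ∀ s : Set ℕ, (∀ z ∈ s, t ≤ (z : ℝ)) →
      min 1 (t / σ) * (poissonMeasure u).real s ≤ ∫ z, min 1 ((z : ℝ) / σ) ∂poissonMeasure u := by
    intro t ht s hs
    rw [mul_comm, ← smul_eq_mul, ← setIntegral_const]
    refine le_trans (setIntegral_mono_on (integrable_const _).integrableOn hint.integrableOn
      (hmeas _) fun z hz => ?_) (setIntegral_le_integral hint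
        (Filter.Eventually.of_forall fun z => by positivity))
    have := hs z hz
    gcongr
  rcases le_total (u : ℝ) 1 with hu | hu
  · -- small rate: the variable is positive with probability at least `u / 2`
    have h0 : (poissonMeasure u).real {0}ᶜ = 1 - Real.exp (-u) := by
      rw [probReal_compl_eq_one_sub (hmeas _), poissonMeasure_real_singleton]
      simp
    have hexp : Real.exp (-u) ≤ 1 - u / 2 := by
      have h1 := Real.add_one_le_exp (u : ℝ)
      rw [Real.exp_neg, inv_le_comm₀ (Real.exp_pos _) (by linarith)]
      refine le_trans ?_ h1
      rw [inv_le_iff_one_le_mul₀ (by linarith)]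
      nlinarith
    have := markov 1 zero_le_one {0}ᶜ fun z hz => by
      exact_mod_cast Nat.one_le_iff_ne_zero.2 hz
    rw [h0] at this
    refine le_trans ?_ this
    rw [min_eq_right ((div_le_one hσ0).2 hσ)]
    have h3 : min 1 ((u : ℝ) / σ) ≤ u * (1 / σ) := by
      rw [mul_one_div]; exact min_le_right _ _
    have h4 : 1 / σ * (u / 2) ≤ 1 / σ * (1 - Real.exp (-u)) :=
      mul_le_mul_of_nonneg_left (by linarith) (by positivity)
    have h5 : 0 ≤ u * (1 / σ) := by positivity
    linarith
  · have h1 : (poissonMeasure u).real {x | x ≤ ⌊(u : ℝ) / 4⌋₊} ≤ 3 / 4 := by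
      refine (ENNReal.toReal_le_of_le_ofReal (by positivity)
        (poissonMeasure_le_two_pow u ⌊(u : ℝ) / 4⌋₊)).trans ?_
      have hfl : ((⌊(u : ℝ) / 4⌋₊ : ℕ) : ℝ) ≤ u / 4 := Nat.floor_le (by positivity)
      rw [← Real.rpow_natCast, Real.rpow_def_of_pos two_pos, ← Real.exp_add]
      have h2 : Real.log 2 * (⌊(u : ℝ) / 4⌋₊ : ℕ) + -((u : ℝ) / 2) ≤ - (3 / 10) := by
        have := Real.log_two_lt_d9
        nlinarith [Real.log_pos one_lt_two]
      refine (Real.exp_le_exp.2 h2).trans ?_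
      rw [Real.exp_neg, inv_le_comm₀ (Real.exp_pos _) (by norm_num)]
      have := Real.quadratic_le_exp_of_nonneg (x := 3 / 10) (by norm_num)
      norm_num at this ⊢
      linarith
    have h2 : 1 / 4 ≤ (poissonMeasure u).real {x | x ≤ ⌊(u : ℝ) / 4⌋₊}ᶜ := by
      rw [probReal_compl_eq_one_sub (hmeas _)]
      linarith
    have h3 := markov (u / 4) (by positivity) {x | x ≤ ⌊(u : ℝ) / 4⌋₊}ᶜ fun z hz => by
      simp only [Set.mem_compl_iff, Set.mem_ofPred_eq, not_le] at hz
      exact (Nat.lt_of_floor_lt hz).le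
    refine le_trans ?_ h3
    have h4 : min 1 ((u : ℝ) / σ) / 4 ≤ min 1 (u / 4 / σ) := by
      rw [le_min_iff]
      constructor
      · have := min_le_left 1 ((u : ℝ) / σ)
        linarith
      · have := min_le_right 1 ((u : ℝ) / σ)
        rw [div_right_comm]
        linarith
    have h5 : 0 ≤ min 1 ((u : ℝ) / σ) := by positivity
    nlinarith

/-- If `b ≤ a`, then independent `X ~ Poi(a)` and `Y ~ Poi(b)` satisfy
`P(X > Y) - P(X < Y) ≥ c * min(1, (a - b) / √(a + b + 1))`: write `X = X' + Z` with `X'` an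
independent copy of `Y` and `Z ~ Poi(a - b)`, and use the symmetry of `X' - Y`. -/
theorem min_le_poisson_bias (a b : ℝ≥0) (hab : b ≤ a) :
    min 1 ((a - b : ℝ) / √(a + b + 1)) / 512
      ≤ ((poissonMeasure a).prod (poissonMeasure b)).real {w | w.2 < w.1}
        - ((poissonMeasure a).prod (poissonMeasure b)).real {w | w.1 < w.2} := by
  obtain ⟨u, rfl⟩ : ∃ u, a = b + u := ⟨a - b, (add_tsub_cancel_of_le hab).symm⟩
  have hmeas2 : ∀ s : Set (ℕ × ℕ), MeasurableSet s := fun s => (Set.to_countable s).measurableSet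
  have hb0 : (0 : ℝ) ≤ b := b.2
  have hu0 : (0 : ℝ) ≤ u := u.2
  set σ := √((b : ℝ) + 1) with hσ
  have hσ1 : 1 ≤ σ := Real.one_le_sqrt.2 (by linarith)
  have hsign : ∀ m : ℤ, |(Int.sign m : ℝ)| ≤ 1 := fun m => by
    rcases lt_trichotomy m 0 with h | h | h
    · simp [Int.sign_eq_neg_one_of_neg h]
    · simp [h]
    · simp [Int.sign_eq_one_of_pos h]
  have hint : ∀ {α : Type} [MeasurableSpace α] [Countable α] [MeasurableSingletonClass α]
      (P : Measure α) [IsProbabilityMeasure P] (g : α → ℤ),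
      Integrable (fun w => (Int.sign (g w) : ℝ)) P := fun P _ g =>
    Integrable.of_bound (measurable_of_countable _).aestronglyMeasurable 1
      (Filter.Eventually.of_forall fun w => hsign _)
  -- the bias is the mean of the sign of the difference
  have h1 : ((poissonMeasure (b + u)).prod (poissonMeasure b)).real {w | w.2 < w.1}
        - ((poissonMeasure (b + u)).prod (poissonMeasure b)).real {w | w.1 < w.2}
      = ∫ w, (Int.sign ((w.1 : ℤ) - w.2) : ℝ)
          ∂((poissonMeasure (b + u)).prod (poissonMeasure b)) := by
    rw [← integral_indicator_one (hmeas2 _), ← integral_indicator_one (hmeas2 _),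
      ← integral_sub]
    · refine integral_congr_ae (Filter.Eventually.of_forall fun w => ?_)
      rcases lt_trichotomy w.1 w.2 with h | h | h
      · simp [Set.indicator, h, h.not_gt,
          Int.sign_eq_neg_one_of_neg (a := (w.1 : ℤ) - w.2) (by omega)]
      · simp [Set.indicator, h]
      · simp [Set.indicator, h, h.not_gt,
          Int.sign_eq_one_of_pos (a := (w.1 : ℤ) - w.2) (by omega)]
    · exact (integrable_const (1 : ℝ)).indicator (hmeas2 _)
    · exact (integrable_const (1 : ℝ)).indicator (hmeas2 _)
  have h2 : ∫ w, (Int.sign ((w.1 : ℤ) - w.2) : ℝ)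
          ∂((poissonMeasure (b + u)).prod (poissonMeasure b))
      = ∫ z, ∫ w, (Int.sign ((w.1 : ℤ) + z - w.2) : ℝ)
          ∂((poissonMeasure b).prod (poissonMeasure b)) ∂poissonMeasure u := by
    rw [integral_prod _ (hint _ _), ← poissonMeasure_conv_poissonMeasure, Measure.conv,
      integral_map (measurable_of_countable _).aemeasurable
        (measurable_of_countable _).aestronglyMeasurable, integral_prod_symm]
    · refine integral_congr_ae (Filter.Eventually.of_forall fun z => ?_)
      simp only
      rw [integral_prod _ (hint _ _)]
      simp
    · refine Integrable.of_bound (measurable_of_countable _).aestronglyMeasurable 1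
        (Filter.Eventually.of_forall fun w => ?_)
      refine (norm_integral_le_of_norm_le_const (C := 1)
        (Filter.Eventually.of_forall fun y => hsign _)).trans ?_
      simp
  have h3 : ∀ z : ℕ, min 1 (z / σ) / 32 ≤ ∫ w, (Int.sign ((w.1 : ℤ) + z - w.2) : ℝ)
          ∂((poissonMeasure b).prod (poissonMeasure b)) := by
    intro z
    refine (min_le_poisson_prod_abs_sub_lt b z).trans ?_
    have hswap : ∫ w, (Int.sign ((w.1 : ℤ) + z - w.2) : ℝ)
          ∂((poissonMeasure b).prod (poissonMeasure b))
        = ∫ w, (Int.sign ((w.2 : ℤ) + z - w.1) : ℝ)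
          ∂((poissonMeasure b).prod (poissonMeasure b)) :=
      (integral_prod_swap (fun w : ℕ × ℕ => (Int.sign ((w.1 : ℤ) + z - w.2) : ℝ))).symm
    have hsum : 2 * ((poissonMeasure b).prod (poissonMeasure b)).real
          {w | |(w.1 : ℤ) - w.2| < z}
        ≤ ∫ w, (Int.sign ((w.1 : ℤ) + z - w.2) : ℝ) + (Int.sign ((w.2 : ℤ) + z - w.1) : ℝ)
          ∂((poissonMeasure b).prod (poissonMeasure b)) := by
      rw [← integral_indicator_one (hmeas2 _), ← integral_const_mul]
      refine integral_mono (((integrable_const (1 : ℝ)).indicator (hmeas2 _)).const_mul 2)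
        ((hint _ _).add (hint _ _)) fun w => ?_
      simp only [Set.indicator, Set.mem_ofPred_eq, abs_lt, Pi.one_apply]
      split_ifs with h
      · rw [Int.sign_eq_one_of_pos (a := (w.1 : ℤ) + z - w.2) (by omega),
          Int.sign_eq_one_of_pos (a := (w.2 : ℤ) + z - w.1) (by omega)]
        norm_num
      · rw [mul_zero]
        rcases le_or_gt (w.1 : ℤ) w.2 with h' | h'
        · have e := abs_le.1 (hsign ((w.1 : ℤ) + z - w.2))
          rcases eq_or_lt_of_le (show (0 : ℤ) ≤ (w.2 : ℤ) + z - w.1 by omega) with h0 | h0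
          · rw [show (w.1 : ℤ) + z - w.2 = 0 by omega, ← h0]
            simp
          · rw [Int.sign_eq_one_of_pos h0]
            norm_num
            linarith
        · have e := abs_le.1 (hsign ((w.2 : ℤ) + z - w.1))
          rw [Int.sign_eq_one_of_pos (a := (w.1 : ℤ) + z - w.2) (by omega)]
          norm_num
          linarith
    rw [integral_add (hint _ _) (hint _ _), ← hswap] at hsum
    linarith
  rw [h1, h2]
  have h4 : ∫ z, min 1 ((z : ℝ) / σ) / 32 ∂poissonMeasure u
      ≤ ∫ z, ∫ w, (Int.sign ((w.1 : ℤ) + z - w.2) : ℝ)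
          ∂((poissonMeasure b).prod (poissonMeasure b)) ∂poissonMeasure u := by
    refine integral_mono_of_nonneg (Filter.Eventually.of_forall fun z => by positivity) ?_
      (Filter.Eventually.of_forall h3)
    refine Integrable.of_bound (measurable_of_countable _).aestronglyMeasurable 1
      (Filter.Eventually.of_forall fun z => ?_)
    refine (norm_integral_le_of_norm_le_const (C := 1)
      (Filter.Eventually.of_forall fun y => hsign _)).trans ?_
    simp
  refine le_trans ?_ h4
  rw [integral_div]
  have h5 := min_le_integral_min_poisson u σ hσ1
  have h6 : min 1 (((b + u : ℝ≥0) - b : ℝ) / √((b + u : ℝ≥0) + b + 1)) ≤ min 1 (u / σ) := by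
    push_cast
    rw [add_sub_cancel_left]
    have : σ ≤ √((b : ℝ) + u + b + 1) := Real.sqrt_le_sqrt (by linarith)
    gcongr
  linarith

/-! ### The moment generating function of one comparison -/

set_option maxHeartbeats 800000 in
/-- Let a sign be wrong with probability `π`. If the two intensities have difference `u` and minimum
`w`, and `π` obeys both the bias bound and the Chernoff bound for comparing Poisson variables, then
the moment generating function of the sign, scaled by `u`, is that of a variable with drift
of order `u * min(1, u / √(u + 2 w + 1))`, up to a factor `exp (C θ² w)`. -/
theorem sign_mgf_le (u w π θ : ℝ) (hu : 0 ≤ u) (hw : 0 ≤ w) (hπ : 0 ≤ π)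
    (hbias : min 1 (u / √(u + 2 * w + 1)) / 512 ≤ 1 - 2 * π)
    (hπexp : π ≤ Real.exp (-(u ^ 2 / (4 * (u + 2 * w)))))
    (hθ : 0 ≤ θ) (hθ1 : θ ≤ 1 / 2 ^ 26) :
    (1 - π) * Real.exp (-(θ * u)) + π * Real.exp (θ * u)
      ≤ Real.exp (-(min 1 (u / √(u + 2 * w + 1)) / 2048 * (θ * u)) + 2 ^ 26 * θ ^ 2 * w) := by
  set b := min 1 (u / √(u + 2 * w + 1)) / 512 with hb
  set v := u + 2 * w with hv
  have hv0 : 0 ≤ v := by positivity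
  set x := θ * u with hx
  have hx0 : 0 ≤ x := mul_nonneg hθ hu
  have hb0 : 0 ≤ b := by positivity
  have hb1 : b ≤ 1 / 512 := by
    have := min_le_left 1 (u / √(v + 1))
    rw [hb]
    linarith
  have hb4 : min 1 (u / √(v + 1)) / 2048 = b / 4 := by rw [hb]; ring
  rw [hb4]
  have hπ1 : π ≤ 1 / 2 := by linarith
  have hw2 : 0 ≤ 2 ^ 26 * θ ^ 2 * w := by positivity
  -- `2 θ u ≤ u² / (4 v) + 4 θ² v`
  have hamgm : π * Real.exp x ≤ Real.exp (-x + 4 * (θ ^ 2 * v)) := by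
    calc π * Real.exp x ≤ Real.exp (-(u ^ 2 / (4 * v))) * Real.exp x := by gcongr
      _ = Real.exp (-(u ^ 2 / (4 * v)) + x) := by rw [Real.exp_add]
      _ ≤ _ := by
        refine Real.exp_le_exp.2 ?_
        rcases eq_or_lt_of_le hv0 with h0 | h0
        · have : u = 0 := by linarith
          rw [← h0, hx, this]
          simp
        · have : u ^ 2 / (4 * v) + 4 * (θ ^ 2 * v) - 2 * x = (u - 4 * θ * v) ^ 2 / (4 * v) := by
            rw [hx]
            field_simp
            ring
          have h2 : 0 ≤ (u - 4 * θ * v) ^ 2 / (4 * v) := by positivity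
          linarith
  have hfirst : (1 - π) * Real.exp (-x) ≤ Real.exp (-x) := by
    have := Real.exp_pos (-x)
    nlinarith
  by_cases hcase : θ ^ 2 * v ≤ 1 / 2 ^ 24
  · -- the drift dominates: here `w` is not needed
    have hsmall : ∀ m : ℝ, b ≤ m → π = (1 - m) / 2 → x ≤ 0.93 →
        x * (0.75 * x) ≤ x * (m - b / 4) →
        (1 - π) * Real.exp (-x) + π * Real.exp x ≤ Real.exp (-(b / 4 * x)) := by
      intro m hm hπm hx1 hkey
      have hcosh : Real.cosh x ≤ 1 + 0.75 * x ^ 2 := by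
        refine (Real.cosh_le_exp_half_sq x).trans ?_
        have hy : |x ^ 2 / 2| ≤ 1 := by
          rw [abs_of_nonneg (by positivity)]
          nlinarith
        have h1 := (abs_le.1 (Real.abs_exp_sub_one_sub_id_le hy)).2
        have h2 : x ^ 2 ≤ 1 := by nlinarith
        have h3 : x ^ 2 * x ^ 2 ≤ x ^ 2 * 1 := mul_le_mul_of_nonneg_left h2 (sq_nonneg x)
        norm_num
        linarith
      have hsinh : x ≤ Real.sinh x := Real.self_le_sinh_iff.2 hx0
      have hm0 : 0 ≤ m := hb0.trans hm
      have : (1 - π) * Real.exp (-x) + π * Real.exp x = Real.cosh x - m * Real.sinh x := by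
        rw [hπm, Real.cosh_eq, Real.sinh_eq]
        ring
      rw [this]
      have h1 := Real.add_one_le_exp (-(b / 4 * x))
      nlinarith
    have hgoal : (1 - π) * Real.exp (-x) + π * Real.exp x ≤ Real.exp (-(b / 4 * x)) := by
      by_cases hxc : x ≤ 1 / 512
      · -- here the bias bound gives `x ≤ 1 - 2 π`
        have hxb : x ≤ b := by
          rw [hb, le_div_iff₀ (by norm_num), le_min_iff]
          refine ⟨by linarith, ?_⟩
          rw [le_div_iff₀ (by positivity), hx]
          have hsq : θ * 512 * √(v + 1) ≤ 1 := by
            have h1 : (θ * 512 * √(v + 1)) ^ 2 ≤ 1 := by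
              rw [mul_pow, Real.sq_sqrt (by positivity)]
              have : θ ^ 2 ≤ (1 / 2 ^ 26) ^ 2 := pow_le_pow_left₀ hθ hθ1 2
              norm_num at this hcase ⊢
              nlinarith
            have h2 := abs_le_of_sq_le_sq (a := θ * 512 * √(v + 1)) (b := 1) (by simpa using h1)
              zero_le_one
            exact (le_abs_self _).trans (by simpa using h2)
          nlinarith
        refine hsmall (1 - 2 * π) hbias (by ring) (by linarith) ?_
        exact mul_le_mul_of_nonneg_left (by linarith) hx0
      · push Not at hxc
        have hv' : v ≤ u ^ 2 / 64 := by
          have h1 : (1 / 512) ^ 2 ≤ x ^ 2 := pow_le_pow_left₀ (by norm_num) hxc.le 2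
          have hθ0 : 0 < θ ^ 2 := by
            rcases eq_or_lt_of_le hθ with h | h
            · rw [hx, ← h] at hxc
              norm_num at hxc
            · positivity
          refine le_of_mul_le_mul_left ?_ hθ0
          rw [hx] at h1
          norm_num at h1 hcase
          linarith
        have hu' : 0 < u := by
          rcases eq_or_lt_of_le hu with h | h
          · rw [hx, ← h] at hxc
            norm_num at hxc
          · exact h
        have hv'' : 0 < v := by linarith
        have hπ16 : π ≤ 1 / 81 := by
          refine hπexp.trans ?_
          have h1 : (16 : ℝ) ≤ u ^ 2 / (4 * v) := by
            rw [le_div_iff₀ (by positivity)]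
            linarith
          calc Real.exp (-(u ^ 2 / (4 * v))) ≤ Real.exp (-(8 + 8)) :=
                Real.exp_le_exp.2 (by linarith)
            _ ≤ 1 / 81 := by
                rw [Real.exp_neg, Real.exp_add, inv_le_comm₀ (by positivity) (by norm_num)]
                have := Real.add_one_le_exp (8 : ℝ)
                nlinarith
        by_cases hx1 : x ≤ 0.93
        · refine hsmall (1 - 2 * π) hbias (by ring) hx1 (mul_le_mul_of_nonneg_left ?_ hx0)
          norm_num at hx1 ⊢
          linarith
        · push Not at hx1
          have hy : Real.exp (4 * (θ ^ 2 * v)) ≤ 1.1 := by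
            have hθv : 0 ≤ θ ^ 2 * v := by positivity
            norm_num at hcase
            have := (abs_le.1 (Real.abs_exp_sub_one_sub_id_le (x := 4 * (θ ^ 2 * v))
              (by rw [abs_of_nonneg (by positivity)]; linarith))).2
            norm_num
            nlinarith
          have hexp : 2.1 ≤ Real.exp (x - b / 4 * x) := by
            have h1 : 0.92 ≤ x - b / 4 * x := by
              norm_num at hx1 ⊢
              nlinarith
            refine le_trans ?_ (Real.exp_le_exp.2 h1)
            have := Real.quadratic_le_exp_of_nonneg (x := 0.92) (by norm_num)
            norm_num at this ⊢
            linarith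
          calc (1 - π) * Real.exp (-x) + π * Real.exp x
              ≤ Real.exp (-x) + Real.exp (-x + 4 * (θ ^ 2 * v)) := add_le_add hfirst hamgm
            _ = Real.exp (-x) * (1 + Real.exp (4 * (θ ^ 2 * v))) := by rw [Real.exp_add]; ring
            _ ≤ Real.exp (-x) * Real.exp (x - b / 4 * x) := by
                gcongr
                norm_num at hy hexp ⊢
                linarith
            _ = Real.exp (-(b / 4 * x)) := by
                rw [← Real.exp_add]
                congr 1
                ring
    refine hgoal.trans (Real.exp_le_exp.2 (by linarith))
  · push Not at hcase
    have hθ2v : 1 ≤ 2 ^ 24 * (θ ^ 2 * v) := by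
      have := hcase.le
      norm_num at this ⊢
      linarith
    calc (1 - π) * Real.exp (-x) + π * Real.exp x
        ≤ Real.exp (-x) + Real.exp (-x + 4 * (θ ^ 2 * v)) := add_le_add hfirst hamgm
      _ = Real.exp (-x) * (1 + Real.exp (4 * (θ ^ 2 * v))) := by rw [Real.exp_add]; ring
      _ ≤ Real.exp (-x) * Real.exp (1 + 4 * (θ ^ 2 * v)) := by
          gcongr
          rw [Real.exp_add]
          have h1 := Real.add_one_le_exp (1 : ℝ)
          have h2 : 1 ≤ Real.exp (4 * (θ ^ 2 * v)) := Real.one_le_exp (by positivity)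
          nlinarith
      _ = Real.exp (-x + (1 + 4 * (θ ^ 2 * v))) := (Real.exp_add _ _).symm
      _ ≤ _ := by
          refine Real.exp_le_exp.2 ?_
          have h1 : 1 + 4 * (θ ^ 2 * v) ≤ 2 ^ 25 * (θ ^ 2 * v) := by norm_num at hθ2v ⊢; linarith
          have h2 : 2 ^ 25 * (θ ^ 2 * v) = 2 ^ 25 * θ * x + 2 ^ 26 * θ ^ 2 * w := by
            rw [hx, hv]; ring
          have h3 : 2 ^ 25 * θ * x ≤ 1 / 2 * x := by
            gcongr
            norm_num at hθ1 ⊢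
            linarith
          have h4 : b / 4 * x ≤ 1 / 2 * x := by
            gcongr ?_ * x
            linarith
          linarith

/-! ### The moment generating function of the separation -/

/-- The mean over a fair coin, used for ties, of `exp (∓ t)` with the sign of `x - y`. -/
noncomputable def signExp (t : ℝ) (x y : ℕ) : ℝ :=
  if y < x then Real.exp (-t) else if x < y then Real.exp t else (Real.exp (-t) + Real.exp t) / 2

theorem signExp_swap (t : ℝ) (x y : ℕ) : signExp t x y = signExp (-t) y x := by
  unfold signExp
  rcases lt_trichotomy x y with h | h | h
  · simp [h, h.not_gt]
  · simp [h, add_comm]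
  · simp [h, h.not_gt]

/-- The mean of `signExp` when the first rate is the larger one: the bias and Chernoff bounds for
the comparison feed `sign_mgf_le`, where a tie counts as an error with probability `1 / 2`. -/
theorem lintegral_signExp_le_of_le (a b : ℝ≥0) (hab : b ≤ a) (θ : ℝ) (hθ : 0 ≤ θ)
    (hθ1 : θ ≤ 1 / 2 ^ 26) :
    ∫⁻ w, ENNReal.ofReal (signExp (θ * (a - b)) w.1 w.2)
        ∂(poissonMeasure a).prod (poissonMeasure b)
      ≤ ENNReal.ofReal (Real.exp (-(min 1 ((a - b : ℝ) / √(a + b + 1)) / 2048 * (θ * (a - b)))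
          + 2 ^ 26 * θ ^ 2 * b)) := by
  have hab' : (b : ℝ) ≤ a := hab
  have hb0 : (0 : ℝ) ≤ b := b.2
  set M := (poissonMeasure a).prod (poissonMeasure b) with hM
  set t := θ * ((a : ℝ) - b) with ht
  have hmeas : ∀ s : Set (ℕ × ℕ), MeasurableSet s := fun s => (Set.to_countable s).measurableSet
  set G : Set (ℕ × ℕ) := {w | w.2 < w.1} with hG
  set B : Set (ℕ × ℕ) := {w | w.1 < w.2} with hB
  set E : Set (ℕ × ℕ) := {w | w.1 = w.2} with hE
  have hint : ∫⁻ w, ENNReal.ofReal (signExp t w.1 w.2) ∂M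
      = ENNReal.ofReal (Real.exp (-t) * M.real G + Real.exp t * M.real B
        + (Real.exp (-t) + Real.exp t) / 2 * M.real E) := by
    have h1 : ∀ w : ℕ × ℕ, ENNReal.ofReal (signExp t w.1 w.2)
        = G.indicator (fun _ => ENNReal.ofReal (Real.exp (-t))) w
          + B.indicator (fun _ => ENNReal.ofReal (Real.exp t)) w
          + E.indicator (fun _ => ENNReal.ofReal ((Real.exp (-t) + Real.exp t) / 2)) w := by
      intro w
      rcases lt_trichotomy w.1 w.2 with h | h | h
      · simp [hG, hB, hE, Set.indicator, signExp, h, h.not_gt, h.ne]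
      · simp [hG, hB, hE, Set.indicator, signExp, h]
      · simp [hG, hB, hE, Set.indicator, signExp, h, h.not_gt, h.ne']
    simp only [h1]
    rw [lintegral_add_left (measurable_of_countable _),
      lintegral_add_left (measurable_of_countable _),
      lintegral_indicator_const (hmeas _), lintegral_indicator_const (hmeas _),
      lintegral_indicator_const (hmeas _), ENNReal.ofReal_add (by positivity) (by positivity),
      ENNReal.ofReal_add (by positivity) (by positivity), ENNReal.ofReal_mul (by positivity),
      ENNReal.ofReal_mul (by positivity), ENNReal.ofReal_mul (by positivity)]
    rw [ofReal_measureReal, ofReal_measureReal, ofReal_measureReal]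
  have hGE : M.real G + M.real B + M.real E = 1 := by
    rw [← measureReal_union _ (hmeas _), ← measureReal_union _ (hmeas _)]
    · convert probReal_univ (μ := M)
      ext w
      simp only [hG, hB, hE, Set.mem_union, Set.mem_ofPred_eq, Set.mem_univ, iff_true]
      omega
    · refine Set.disjoint_left.2 fun w hw hw' => ?_
      simp only [hG, hB, hE, Set.mem_union, Set.mem_ofPred_eq] at hw hw'
      omega
    · refine Set.disjoint_left.2 fun w hw hw' => ?_
      simp only [hG, hB, Set.mem_ofPred_eq] at hw hw'
      omega
  have hle : M.real {w | w.1 ≤ w.2} = M.real B + M.real E := by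
    rw [← measureReal_union _ (hmeas _)]
    · congr 1
      ext w
      simp only [hB, hE, Set.mem_union, Set.mem_ofPred_eq]
      omega
    · refine Set.disjoint_left.2 fun w hw hw' => ?_
      simp only [hB, hE, Set.mem_ofPred_eq] at hw hw'
      omega
  have hch := poisson_prod_le_exp a b hab
  have hbias := min_le_poisson_bias a b hab
  rw [← hM, hle] at hch
  rw [← hM] at hbias
  have hE0 : 0 ≤ M.real E := measureReal_nonneg
  have hB0 : 0 ≤ M.real B := measureReal_nonneg
  have hs : ((a : ℝ) - b) + 2 * b = a + b := by ring
  have := sign_mgf_le (a - b) b (M.real B + M.real E / 2) θ (by linarith) hb0 (by positivity)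
    (by rw [hs]; linarith) (by rw [hs]; linarith) hθ hθ1
  rw [hs] at this
  rw [hint]
  refine ENNReal.ofReal_le_ofReal (le_trans (le_of_eq ?_) this)
  have h2 : M.real G = 1 - M.real B - M.real E := by linarith
  rw [h2, ← ht]
  ring

theorem lintegral_signExp_le (a b : ℝ≥0) (θ : ℝ) (hθ : 0 ≤ θ) (hθ1 : θ ≤ 1 / 2 ^ 26) :
    ∫⁻ x, ∫⁻ y, ENNReal.ofReal (signExp (θ * (a - b)) x y) ∂poissonMeasure b ∂poissonMeasure a
      ≤ ENNReal.ofReal (Real.exp (-(min 1 (|(a - b : ℝ)| / √(a + b + 1)) / 2048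
          * (θ * |(a - b : ℝ)|)) + 2 ^ 26 * θ ^ 2 * min (a : ℝ) b)) := by
  rw [← lintegral_prod (fun w : ℕ × ℕ => ENNReal.ofReal (signExp (θ * (a - b)) w.1 w.2))
    (measurable_of_countable _).aemeasurable]
  rcases le_total b a with h | h
  · have h' : (b : ℝ) ≤ a := h
    rw [abs_of_nonneg (by linarith), min_eq_right h']
    exact lintegral_signExp_le_of_le a b h θ hθ hθ1
  · have h' : (a : ℝ) ≤ b := h
    rw [abs_of_nonpos (by linarith), min_eq_left h', neg_sub, add_comm (a : ℝ) b]
    refine le_trans (le_of_eq ?_) (lintegral_signExp_le_of_le b a h θ hθ hθ1)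
    rw [← lintegral_prod_swap (fun w : ℕ × ℕ => ENNReal.ofReal (signExp (θ * (b - a)) w.1 w.2))]
    refine lintegral_congr fun w => ?_
    simp only [Prod.fst_swap, Prod.snd_swap]
    rw [signExp_swap, ← mul_neg, neg_sub]

theorem lintegral_coin_eq_signExp (t : ℝ) (x y : ℕ) :
    ∫⁻ c, ENNReal.ofReal (Real.exp (-(t * if y < x ∨ x = y ∧ c = true then 1 else -1)))
        ∂bernoulliMeasure true false ⟨1 / 2, by norm_num, by norm_num⟩
      = ENNReal.ofReal (signExp t x y) := by
  have h1 : (bernoulliMeasure true false ⟨1 / 2, by norm_num, by norm_num⟩) {true}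
      = ENNReal.ofReal (1 / 2) := by
    rw [← ofReal_measureReal, bernoulliMeasure_real_apply _ (measurableSet_singleton _)]
    simp
  have h2 : (bernoulliMeasure true false ⟨1 / 2, by norm_num, by norm_num⟩) {false}
      = ENNReal.ofReal (1 / 2) := by
    rw [← ofReal_measureReal, bernoulliMeasure_real_apply _ (measurableSet_singleton _)]
    simp
    rw [show (1 : ℝ) - 2⁻¹ = 2⁻¹ by norm_num, ENNReal.ofReal_inv_of_pos two_pos]
    simp
  rw [lintegral_fintype, Fintype.sum_bool, h1, h2, ← ENNReal.ofReal_mul (by positivity),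
    ← ENNReal.ofReal_mul (by positivity), ← ENNReal.ofReal_add (by positivity) (by positivity)]
  congr 1
  unfold signExp
  rcases lt_trichotomy x y with h | h | h
  · simp [h.not_gt, h, h.ne]
    ring
  · simp [h]
    ring
  · simp [h]
    ring

/-- The separating set depends on the data only through letter counts and coins, and all of these
are independent, with Poisson counts. -/
theorem map_sampleCount_dataLaw {k : ℕ} (n : ℕ) (p q : ProbabilityMeasure (Fin k)) :
    (dataLaw n p q).map (Prod.map (Prod.map sampleCount sampleCount) id)
      = ((Measure.pi fun i => poissonMeasure (n * p {i})).prod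
          (Measure.pi fun i => poissonMeasure (n * q {i}))).prod (coinLaw k) := by
  have hc : Measurable (sampleCount : ℕ × (ℕ → Fin k) → Fin k → ℕ) := measurable_sampleCount
  have : ∀ r : ProbabilityMeasure (Fin k), IsProbabilityMeasure (poissonizedLaw n r) := fun r => by
    unfold poissonizedLaw; infer_instance
  have : IsProbabilityMeasure (coinLaw k) := by unfold coinLaw; infer_instance
  rw [dataLaw, ← Measure.map_prod_map _ _ (hc.prodMap hc) measurable_id,
    ← Measure.map_prod_map _ _ hc hc, Measure.map_id, map_sampleCount_poissonizedLaw,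
    map_sampleCount_poissonizedLaw]

theorem measureReal_eq_sum_ite {α : Type*} [Fintype α] [MeasurableSpace α]
    [MeasurableSingletonClass α] (P : Measure α) [IsFiniteMeasure P] (s : Set α)
    [DecidablePred (· ∈ s)] : P.real s = ∑ i, if i ∈ s then P.real {i} else 0 := by
  rw [← Finset.sum_filter, sum_measureReal_singleton]
  congr
  ext
  simp

theorem sum_real_singleton {k : ℕ} (p : ProbabilityMeasure (Fin k)) :
    ∑ i, (p : Measure (Fin k)).real {i} = 1 := by
  rw [sum_measureReal_singleton]
  simp

open Classical in
/-- Since `p` and `q` have the same total mass, twice the separation is a sum with a sign for each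
letter. -/
theorem two_mul_sep {k : ℕ} (p q : ProbabilityMeasure (Fin k)) (s : Set (Fin k)) :
    2 * sep p q s = ∑ i, ((p : Measure (Fin k)).real {i} - (q : Measure (Fin k)).real {i})
      * (if i ∈ s then 1 else -1) := by
  have h0 : ∑ i, ((p : Measure (Fin k)).real {i} - (q : Measure (Fin k)).real {i}) = 0 := by
    rw [Finset.sum_sub_distrib, sum_real_singleton, sum_real_singleton, sub_self]
  have h1 : sep p q s = ∑ i, if i ∈ s then
      ((p : Measure (Fin k)).real {i} - (q : Measure (Fin k)).real {i}) else 0 := by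
    rw [sep, measureReal_eq_sum_ite, measureReal_eq_sum_ite, ← Finset.sum_sub_distrib]
    refine Finset.sum_congr rfl fun i _ => ?_
    split_ifs <;> simp
  have h2 : ∑ i, ((p : Measure (Fin k)).real {i} - (q : Measure (Fin k)).real {i})
        * (if i ∈ s then 1 else -1)
      = 2 * (∑ i, if i ∈ s then
          ((p : Measure (Fin k)).real {i} - (q : Measure (Fin k)).real {i}) else 0)
        - ∑ i, ((p : Measure (Fin k)).real {i} - (q : Measure (Fin k)).real {i}) := by
    rw [Finset.mul_sum, ← Finset.sum_sub_distrib]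
    refine Finset.sum_congr rfl fun i _ => ?_
    split_ifs <;> ring
  rw [h1, h2, h0, sub_zero]

theorem mem_sHalfHat_iff {k n : ℕ} (hn : 0 < n)
    (ω : ((ℕ × (ℕ → Fin k)) × (ℕ × (ℕ → Fin k))) × (Fin k → Bool)) (i : Fin k) :
    i ∈ sHalfHat n ω ↔ sampleCount ω.1.2 i < sampleCount ω.1.1 i ∨
      sampleCount ω.1.1 i = sampleCount ω.1.2 i ∧ ω.2 i = true := by
  have hn' : (0 : ℝ) < n := by exact_mod_cast hn
  simp only [sHalfHat, sHalf, empFreq, Set.mem_ofPred_eq, gt_iff_lt,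
    div_lt_div_iff_of_pos_right hn',
    div_left_inj' hn'.ne', Nat.cast_lt, Nat.cast_inj, sampleCount]

/-- The exponential moment of the separation factors over the letters, because the events
`i ∈ sHalfHat n ω` are independent; each factor is bounded by `lintegral_signExp_le`. -/
theorem lintegral_exp_sep_le {k n : ℕ} (hn : 0 < n) (p q : ProbabilityMeasure (Fin k)) (θ : ℝ)
    (hθ : 0 ≤ θ) (hθ1 : θ ≤ 1 / 2 ^ 26) :
    ∫⁻ ω, ENNReal.ofReal (Real.exp (-(θ * n * (2 * sep p q (sHalfHat n ω))))) ∂dataLaw n p q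
      ≤ ENNReal.ofReal (Real.exp (∑ i, (-(min 1 (n * |(p {i} : ℝ) - q {i}| /
          √(n * p {i} + n * q {i} + 1)) / 2048 * (θ * (n * |(p {i} : ℝ) - q {i}|)))
          + 2 ^ 26 * θ ^ 2 * (n * min (p {i} : ℝ) (q {i}))))) := by
  classical
  set d : Fin k → ℝ := fun i => ((n * p {i} : ℝ≥0) : ℝ) - (n * q {i} : ℝ≥0) with hd
  set H : ((Fin k → ℕ) × (Fin k → ℕ)) × (Fin k → Bool) → ℝ≥0∞ := fun z =>
    ∏ i, ENNReal.ofReal (Real.exp (-(θ * d i *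
      if z.1.2 i < z.1.1 i ∨ z.1.1 i = z.1.2 i ∧ z.2 i = true then 1 else -1))) with hH
  have h1 : ∀ ω, ENNReal.ofReal (Real.exp (-(θ * n * (2 * sep p q (sHalfHat n ω)))))
      = H (Prod.map (Prod.map sampleCount sampleCount) id ω) := by
    intro ω
    simp only [hH]
    rw [← ENNReal.ofReal_prod_of_nonneg fun i _ => (Real.exp_pos _).le, ← Real.exp_sum,
      two_mul_sep, Finset.sum_neg_distrib, Finset.mul_sum]
    congr 3
    refine Finset.sum_congr rfl fun i _ => ?_
    simp only [mem_sHalfHat_iff hn, Prod.map_fst, Prod.map_snd, id, hd]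
    simp only [NNReal.coe_mul, NNReal.coe_natCast]
    rw [← mul_assoc]
    congr 1
    change θ * n * ((p {i} : ℝ) - q {i}) = _
    ring
  have hc : Measurable (sampleCount : ℕ × (ℕ → Fin k) → Fin k → ℕ) := measurable_sampleCount
  have : IsProbabilityMeasure (coinLaw k) := by unfold coinLaw; infer_instance
  simp only [h1]
  rw [← lintegral_map (measurable_of_countable H) ((hc.prodMap hc).prodMap measurable_id),
    map_sampleCount_dataLaw, lintegral_prod H (measurable_of_countable H).aemeasurable]
  have h2 : ∀ w : (Fin k → ℕ) × (Fin k → ℕ), ∫⁻ c, H (w, c) ∂coinLaw k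
      = ∏ i, ENNReal.ofReal (signExp (θ * d i) (w.1 i) (w.2 i)) := by
    intro w
    rw [hH, coinLaw]
    simp only
    rw [lintegral_prod_pi (fun _ => bernoulliMeasure true false ⟨1 / 2, by norm_num, by norm_num⟩)
      fun i c => ENNReal.ofReal (Real.exp (-(θ * d i *
        if w.2 i < w.1 i ∨ w.1 i = w.2 i ∧ c = true then 1 else -1)))]
    exact Finset.prod_congr rfl fun i _ => lintegral_coin_eq_signExp _ _ _
  simp only [h2]
  rw [lintegral_prod _ (measurable_of_countable _).aemeasurable]
  simp only
  have h3 : ∀ x : Fin k → ℕ, ∫⁻ y, ∏ i, ENNReal.ofReal (signExp (θ * d i) (x i) (y i))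
        ∂Measure.pi (fun i => poissonMeasure (n * q {i}))
      = ∏ i, ∫⁻ y, ENNReal.ofReal (signExp (θ * d i) (x i) y) ∂poissonMeasure (n * q {i}) :=
    fun x => lintegral_prod_pi _ fun i y => ENNReal.ofReal (signExp (θ * d i) (x i) y)
  simp only [h3]
  rw [lintegral_prod_pi _ fun i x =>
    ∫⁻ y, ENNReal.ofReal (signExp (θ * d i) x y) ∂poissonMeasure (n * q {i}), Real.exp_sum,
    ENNReal.ofReal_prod_of_nonneg fun i _ => (Real.exp_pos _).le]
  refine Finset.prod_le_prod' fun i _ => ?_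
  refine (lintegral_signExp_le (n * p {i}) (n * q {i}) θ hθ hθ1).trans (le_of_eq ?_)
  have hn' : (0 : ℝ) ≤ n := n.cast_nonneg
  simp only [NNReal.coe_mul, NNReal.coe_natCast, ← mul_sub, abs_mul, abs_of_nonneg hn',
    ← mul_min_of_nonneg _ _ hn']

/-! ### Concentration of the separation -/

theorem measurable_sep_sHalfHat {k n : ℕ} (hn : 0 < n) (p q : ProbabilityMeasure (Fin k)) :
    Measurable fun ω => sep p q (sHalfHat n ω) := by
  have hc : Measurable (sampleCount : ℕ × (ℕ → Fin k) → Fin k → ℕ) := measurable_sampleCount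
  have h : (fun ω => sep p q (sHalfHat n ω))
      = (fun z : ((Fin k → ℕ) × (Fin k → ℕ)) × (Fin k → Bool) =>
          sep p q {i | z.1.2 i < z.1.1 i ∨ z.1.1 i = z.1.2 i ∧ z.2 i = true})
        ∘ Prod.map (Prod.map sampleCount sampleCount) id := by
    funext ω
    simp only [Function.comp_apply, Prod.map_fst, Prod.map_snd, id]
    congr 1
    ext i
    exact mem_sHalfHat_iff hn ω i
  rw [h]
  exact (measurable_of_countable _).comp ((hc.prodMap hc).prodMap measurable_id)

/-- Half the `ℓ¹` distance of two distributions on a finite alphabet. -/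
noncomputable def halfL1 {k : ℕ} (p q : ProbabilityMeasure (Fin k)) : ℝ :=
  (∑ i, |(p {i} : ℝ) - q {i}|) / 2

theorem sum_coe_singleton {k : ℕ} (p : ProbabilityMeasure (Fin k)) : ∑ i, (p {i} : ℝ) = 1 :=
  sum_real_singleton p

theorem sum_min_eq {k : ℕ} (p q : ProbabilityMeasure (Fin k)) :
    ∑ i, min (p {i} : ℝ) (q {i}) = 1 - halfL1 p q := by
  have h : ∀ i, min (p {i} : ℝ) (q {i}) = ((p {i} : ℝ) + q {i} - |(p {i} : ℝ) - q {i}|) / 2 :=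
    fun i => by
    rcases le_total (p {i} : ℝ) (q {i}) with h | h
    · rw [min_eq_left h, abs_of_nonpos (by linarith)]; ring
    · rw [min_eq_right h, abs_of_nonneg (by linarith)]; ring
  rw [Finset.sum_congr rfl fun i _ => h i, ← Finset.sum_div, Finset.sum_sub_distrib,
    Finset.sum_add_distrib, sum_coe_singleton, sum_coe_singleton, halfL1]
  ring

theorem halfL1_le_one {k : ℕ} (p q : ProbabilityMeasure (Fin k)) : halfL1 p q ≤ 1 := by
  have := sum_min_eq p q
  have h : 0 ≤ ∑ i, min (p {i} : ℝ) (q {i}) :=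
    Finset.sum_nonneg fun i _ => le_min (p {i}).2 (q {i}).2
  linarith

theorem tvDist_le_halfL1 {k : ℕ} (p q : ProbabilityMeasure (Fin k)) :
    tvDist p q ≤ halfL1 p q := by
  classical
  have : Nonempty {A : Set (Fin k) // MeasurableSet A} := ⟨⟨∅, MeasurableSet.empty⟩⟩
  refine ciSup_le fun A => ?_
  change |sep p q A| ≤ _
  have h := two_mul_sep p q A
  have h2 : |2 * sep p q A| ≤ ∑ i, |(p {i} : ℝ) - q {i}| := by
    rw [h]
    refine (Finset.abs_sum_le_sum_abs _ _).trans (Finset.sum_le_sum fun i _ => ?_)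
    rw [abs_mul]
    refine (mul_le_of_le_one_right (abs_nonneg _) ?_).trans le_rfl
    split_ifs <;> simp
  rw [abs_mul, abs_two] at h2
  rw [halfL1]
  linarith

/-- The separation is large in the mean. By `min 1 x ≥ x / (1 + x)` and the Cauchy–Schwarz
inequality, the three terms of the minimum come from the three terms of
`√(n s + 1) + n d ≤ √(n s) + 1 + n d`. -/
theorem drift_lower_bound {k n : ℕ} (hn : 0 < n) (p q : ProbabilityMeasure (Fin k))
    (he : 0 < halfL1 p q) :
    4 / 5 * (halfL1 p q ^ 2 *
        min ((n : ℝ) / k) (min (Real.sqrt ((n : ℝ) / k)) (1 / halfL1 p q)))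
      ≤ ∑ i, |(p {i} : ℝ) - q {i}| *
        min 1 (n * |(p {i} : ℝ) - q {i}| / √(n * p {i} + n * q {i} + 1)) := by
  set e := halfL1 p q with hedef
  set d : Fin k → ℝ := fun i => |(p {i} : ℝ) - q {i}| with hd
  set r : Fin k → ℝ := fun i => √(n * p {i} + n * q {i} + 1) with hr
  set a : ℝ := (n : ℝ) / k with ha
  set ρ := min a (min (√a) (1 / e)) with hρ
  have hn' : (0 : ℝ) < n := by exact_mod_cast hn
  have hk : 0 < k := by
    rcases Nat.eq_zero_or_pos k with h | h
    · subst h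
      simp [hedef, halfL1] at he
    · exact h
  have hk' : (0 : ℝ) < k := by exact_mod_cast hk
  have ha0 : 0 < a := by positivity
  have hd0 : ∀ i, 0 ≤ d i := fun i => abs_nonneg _
  have hr1 : ∀ i, 1 ≤ r i := fun i => Real.one_le_sqrt.2 (by
    have : (0 : ℝ) ≤ p {i} := (p {i}).2
    have : (0 : ℝ) ≤ q {i} := (q {i}).2
    have : (0 : ℝ) ≤ n * p {i} + n * q {i} := by positivity
    linarith)
  have hsumd : ∑ i, d i = 2 * e := by
    rw [hedef, halfL1]
    ring
  -- termwise bound `min 1 x ≥ x / (1 + x)`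
  have h1 : ∑ i, (d i) ^ 2 / ((r i + n * d i) / n) ≤ ∑ i, d i * min 1 (n * d i / r i) := by
    refine Finset.sum_le_sum fun i _ => ?_
    have hri : 0 < r i := by linarith [hr1 i]
    have hdi := hd0 i
    have : (d i) ^ 2 / ((r i + n * d i) / n) = d i * (n * d i / (r i + n * d i)) := by
      field_simp
    rw [this]
    refine mul_le_mul_of_nonneg_left (le_min ?_ ?_) hdi
    · rw [div_le_one (by positivity)]
      linarith
    · gcongr
      have : 0 ≤ n * d i := by positivity
      linarith
  have h2 : (∑ i, d i) ^ 2 / ∑ i, ((r i + n * d i) / n)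
      ≤ ∑ i, (d i) ^ 2 / ((r i + n * d i) / n) :=
    Finset.sq_sum_div_le_sum_sq_div _ d fun i _ => by
      have := hr1 i
      have := hd0 i
      positivity
  -- `∑ √(n s + 1) ≤ √(k (2 n + k)) ≤ √(2 n k) + k`
  have h3 : ∑ i, r i ≤ √(k * (2 * n + k)) := by
    refine Real.le_sqrt_of_sq_le ?_
    refine (sq_sum_le_card_mul_sum_sq (s := Finset.univ) (f := r)).trans (le_of_eq ?_)
    have : ∀ i, r i ^ 2 = n * p {i} + n * q {i} + 1 := fun i => Real.sq_sqrt (by positivity)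
    rw [Finset.sum_congr rfl fun i _ => this i, Finset.sum_add_distrib, Finset.sum_add_distrib,
      ← Finset.mul_sum, ← Finset.mul_sum, sum_coe_singleton, sum_coe_singleton, Finset.sum_const,
      Finset.card_univ, Fintype.card_fin, nsmul_eq_mul]
    ring
  have hρ0 : 0 < ρ := by positivity
  have hsq : (√a) ^ 2 = a := Real.sq_sqrt ha0.le
  have hρa : ρ ≤ a := min_le_left _ _
  have hρs : ρ ≤ √a := (min_le_right _ _).trans (min_le_left _ _)
  have hρe : ρ * e ≤ 1 := by
    have : ρ ≤ 1 / e := (min_le_right _ _).trans (min_le_right _ _)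
    rwa [le_div_iff₀ he] at this
  have h4 : √(k * (2 * n + k)) ≤ 3 * n / ρ := by
    refine Real.sqrt_le_iff.2 ⟨by positivity, ?_⟩
    rw [div_pow, le_div_iff₀ (by positivity)]
    have hka : k * a = n := by rw [ha]; field_simp
    have e1 : ρ ^ 2 ≤ a := hsq ▸ pow_le_pow_left₀ hρ0.le hρs 2
    have e2 : ρ ^ 2 ≤ a ^ 2 := pow_le_pow_left₀ hρ0.le hρa 2
    calc k * (2 * n + k) * ρ ^ 2 = 2 * n * k * ρ ^ 2 + k ^ 2 * ρ ^ 2 := by ring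
      _ ≤ 2 * n * k * a + k ^ 2 * a ^ 2 := by gcongr
      _ = 3 * n ^ 2 := by rw [← hka]; ring
      _ ≤ (3 * n) ^ 2 := by nlinarith
  have h5 : ∑ i, ((r i + n * d i) / n) ≤ 5 / ρ := by
    rw [← Finset.sum_div, Finset.sum_add_distrib, ← Finset.mul_sum, hsumd, div_le_iff₀ hn']
    have h6 : e ≤ 1 / ρ := by rwa [le_div_iff₀ hρ0, mul_comm]
    calc ∑ i, r i + n * (2 * e) ≤ 3 * n / ρ + n * (2 * (1 / ρ)) := by
          gcongr
          exact h3.trans h4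
      _ = 5 / ρ * n := by ring
  refine le_trans ?_ (h2.trans h1)
  have h7 : 0 < ∑ i, ((r i + n * d i) / n) := by
    have : Nonempty (Fin k) := ⟨⟨0, hk⟩⟩
    refine Finset.sum_pos (fun i _ => ?_) Finset.univ_nonempty
    have := hr1 i
    have := hd0 i
    positivity
  rw [hsumd, le_div_iff₀ h7]
  calc 4 / 5 * (e ^ 2 * ρ) * ∑ i, ((r i + n * d i) / n) ≤ 4 / 5 * (e ^ 2 * ρ) * (5 / ρ) := by
        gcongr
    _ = (2 * e) ^ 2 := by
        field_simp
        ring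

/-- The three conditions on the sample size in the form in which they enter the Chernoff bound,
whose exponent is of order `n * R ^ 2 / max R η` with `R = e ^ 2 * min a (min (√a) (1 / e))`. -/
theorem sample_size_condition {L n e a η : ℝ} (hL : 0 ≤ L) (hn : 0 < n) (he : 0 < e) (he1 : e ≤ 1)
    (ha : 0 < a) (hη1 : η ≤ 1)
    (c : ℝ) (hc : 0 ≤ c)
    (h1 : L ≤ c * (n * e ^ 2)) (h2 : L ≤ c * (n * e ^ 4 * a))
    (h3 : L * η ≤ c * (n * e ^ 4 * a ^ 2)) :
    L * max (e ^ 2 * min a (min (√a) (1 / e))) η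
      ≤ c * n * (e ^ 2 * min a (min (√a) (1 / e))) ^ 2 := by
  set ρ := min a (min (√a) (1 / e)) with hρ
  have hs : (√a) ^ 2 = a := Real.sq_sqrt ha.le
  have hs0 : 0 < √a := Real.sqrt_pos.2 ha
  have hρ0 : 0 < ρ := by positivity
  have hLη : L * η ≤ L := mul_le_of_le_one_right hL hη1
  have he2 : e ^ 2 ≤ e := by nlinarith
  have he4 : e ^ 4 ≤ e ^ 2 := pow_le_pow_of_le_one he.le he1 (by norm_num)
  have key : L ≤ c * n * (e ^ 2 * ρ) ∧ L * η ≤ c * n * (e ^ 2 * ρ) ^ 2 := by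
    have hcases : ρ = a ∨ ρ = √a ∨ ρ = 1 / e := by
      rcases min_choice a (min (√a) (1 / e)) with h | h
      · exact Or.inl h
      · rcases min_choice (√a) (1 / e) with h' | h'
        · exact Or.inr (Or.inl (h.trans h'))
        · exact Or.inr (Or.inr (h.trans h'))
    rcases hcases with h | h | h
    · rw [h]
      refine ⟨h2.trans ?_, h3.trans (le_of_eq (by ring))⟩
      calc c * (n * e ^ 4 * a) ≤ c * (n * e ^ 2 * a) := by gcongr
        _ = _ := by ring
    · rw [h]
      refine ⟨?_, (hLη.trans h2).trans (le_of_eq (by rw [← hs, Real.sqrt_sq hs0.le]; ring))⟩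
      -- geometric mean of the first two conditions
      have h4 : L ^ 2 ≤ (c * n * (e ^ 2 * √a)) ^ 2 := by
        calc L ^ 2 = L * L := sq L
          _ ≤ c * (n * e ^ 2) * (c * (n * e ^ 4 * a)) := by gcongr
          _ = c ^ 2 * n ^ 2 * a * (e ^ 2 * e ^ 4) := by ring
          _ ≤ c ^ 2 * n ^ 2 * a * (e ^ 2 * e ^ 2) := by gcongr
          _ = (c * n * (e ^ 2 * √a)) ^ 2 := by
            rw [mul_pow, mul_pow, mul_pow, hs]
            ring
      exact (abs_le_of_sq_le_sq' h4 (by positivity)).2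
    · rw [h]
      have h5 : e ^ 2 * (1 / e) = e := by field_simp
      rw [h5]
      refine ⟨h1.trans ?_, (hLη.trans h1).trans (le_of_eq (by ring))⟩
      calc c * (n * e ^ 2) ≤ c * (n * e) := by gcongr
        _ = _ := by ring
  rw [mul_max_of_nonneg _ _ hL]
  refine max_le ?_ key.2
  calc L * (e ^ 2 * ρ) ≤ c * n * (e ^ 2 * ρ) * (e ^ 2 * ρ) := by
        gcongr
        exact key.1
    _ = _ := by ring

/-- If `n` is large enough in terms of `L`, then the separation has the desired size up to an
exceptional event of probability at most `exp (-L)`. -/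
theorem one_sub_exp_le_dataLaw {k n : ℕ} (hn : 0 < n) (p q : ProbabilityMeasure (Fin k))
    (he : 0 < halfL1 p q) (L : ℝ) (hL : 0 ≤ L)
    (h1 : L ≤ 1 / 2 ^ 60 * (n * halfL1 p q ^ 2))
    (h2 : L ≤ 1 / 2 ^ 60 * (n * halfL1 p q ^ 4 * (n / k)))
    (h3 : L * (1 - halfL1 p q) ≤ 1 / 2 ^ 60 * (n * halfL1 p q ^ 4 * (n / k) ^ 2)) :
    1 - Real.exp (-L) ≤ (dataLaw n p q).real
      {ω | 1 / 2 ^ 13 * (halfL1 p q ^ 2 *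
        min ((n : ℝ) / k) (min (Real.sqrt ((n : ℝ) / k)) (1 / halfL1 p q)))
          ≤ sep p q (sHalfHat n ω)} := by
  have hdrift := drift_lower_bound hn p q he
  have hmin := sum_min_eq p q
  have he1 := halfL1_le_one p q
  set e := halfL1 p q with hedef
  have hn' : (0 : ℝ) < n := by exact_mod_cast hn
  have hk' : (0 : ℝ) < k := by
    rcases Nat.eq_zero_or_pos k with h | h
    · subst h
      simp [hedef, halfL1] at he
    · exact_mod_cast h
  have ha0 : 0 < (n : ℝ) / k := by positivity
  have hcond := sample_size_condition hL hn' he he1 ha0 (by linarith) (1 / 2 ^ 60) (by positivity)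
    h1 h2 h3 (η := 1 - e)
  set R := e ^ 2 * min ((n : ℝ) / k) (min (Real.sqrt ((n : ℝ) / k)) (1 / e)) with hR
  have hR0 : 0 < R := by positivity
  have hRe : R ≤ 1 := by
    have : min ((n : ℝ) / k) (min (Real.sqrt ((n : ℝ) / k)) (1 / e)) ≤ 1 / e :=
      (min_le_right _ _).trans (min_le_right _ _)
    calc R ≤ e ^ 2 * (1 / e) := by rw [hR]; gcongr
      _ = e := by field_simp
      _ ≤ 1 := he1
  set K := max R (1 - e) with hK
  have hK0 : 0 < K := lt_of_lt_of_le hR0 (le_max_left _ _)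
  -- the tilt, of order `min 1 (R / η)`
  set θ := 1 / 2 ^ 41 * (R / K) with hθ
  have hRK : R / K ≤ 1 := (div_le_one hK0).2 (le_max_left _ _)
  have hθ0 : 0 < θ := by positivity
  have hθ1 : θ ≤ 1 / 2 ^ 26 := by
    rw [hθ]
    norm_num at *
    linarith
  have hθη : θ * (1 - e) ≤ 1 / 2 ^ 41 * R := by
    have : R / K * (1 - e) ≤ R / K * K := by
      gcongr
      exact le_max_right _ _
    rw [div_mul_cancel₀ _ hK0.ne'] at this
    rw [hθ, mul_assoc]
    gcongr
  have hLθ : L ≤ 1 / 2 ^ 19 * (θ * n * R) := by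
    have : L ≤ 1 / 2 ^ 60 * n * R ^ 2 / K := by rwa [le_div_iff₀ hK0]
    refine this.trans (le_of_eq ?_)
    rw [hθ]
    ring
  have hmgf := lintegral_exp_sep_le hn p q θ hθ0.le hθ1
  have hprob : IsProbabilityMeasure (dataLaw n p q) := by
    unfold dataLaw poissonizedLaw coinLaw
    infer_instance
  set E := ∑ i, (-(min 1 (n * |(p {i} : ℝ) - q {i}| /
          √(n * p {i} + n * q {i} + 1)) / 2048 * (θ * (n * |(p {i} : ℝ) - q {i}|)))
          + 2 ^ 26 * θ ^ 2 * (n * min (p {i} : ℝ) (q {i}))) with hE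
  have hEle : E ≤ -(θ * n * (4 / 5 * R)) / 2048 + 2 ^ 26 * θ ^ 2 * n * (1 - e) := by
    have : E = -(θ * n * ∑ i, |(p {i} : ℝ) - q {i}| *
        min 1 (n * |(p {i} : ℝ) - q {i}| / √(n * p {i} + n * q {i} + 1))) / 2048
        + 2 ^ 26 * θ ^ 2 * n * ∑ i, min (p {i} : ℝ) (q {i}) := by
      rw [hE, Finset.sum_add_distrib, Finset.mul_sum, Finset.mul_sum, ← Finset.sum_neg_distrib,
        Finset.sum_div]
      congr 1
      · exact Finset.sum_congr rfl fun i _ => by ring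
      · exact Finset.sum_congr rfl fun i _ => by ring
    rw [this, hmin]
    gcongr
  set G := {ω | 1 / 2 ^ 13 * R ≤ sep p q (sHalfHat n ω)} with hG
  have hGm : MeasurableSet G := measurableSet_le measurable_const (measurable_sep_sHalfHat hn p q)
  have hbad : (dataLaw n p q).real Gᶜ ≤ Real.exp (-L) := by
    refine ENNReal.toReal_le_of_le_ofReal (Real.exp_pos _).le ?_
    calc (dataLaw n p q) Gᶜ = ∫⁻ ω, Gᶜ.indicator 1 ω ∂dataLaw n p q :=
          (lintegral_indicator_one hGm.compl).symm
      _ ≤ ∫⁻ ω, ENNReal.ofReal (Real.exp (θ * n * (2 * (1 / 2 ^ 13 * R)))) *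
            ENNReal.ofReal (Real.exp (-(θ * n * (2 * sep p q (sHalfHat n ω))))) ∂dataLaw n p q := by
          refine lintegral_mono fun ω => ?_
          by_cases hω : ω ∈ Gᶜ
          · rw [Set.indicator_of_mem hω, ← ENNReal.ofReal_mul (Real.exp_pos _).le, ← Real.exp_add]
            simp only [Pi.one_apply, ENNReal.one_le_ofReal, Real.one_le_exp_iff]
            have hlt : sep p q (sHalfHat n ω) < 1 / 2 ^ 13 * R := not_le.1 hω
            have : 0 < θ * n := by positivity
            nlinarith
          · rw [Set.indicator_of_notMem hω]
            exact zero_le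
      _ ≤ ENNReal.ofReal (Real.exp (θ * n * (2 * (1 / 2 ^ 13 * R)))) *
            ENNReal.ofReal (Real.exp E) := by
          rw [lintegral_const_mul' _ _ ENNReal.ofReal_ne_top]
          gcongr
      _ = ENNReal.ofReal (Real.exp (θ * n * (2 * (1 / 2 ^ 13 * R)) + E)) := by
          rw [← ENNReal.ofReal_mul (Real.exp_pos _).le, ← Real.exp_add]
      _ ≤ ENNReal.ofReal (Real.exp (-L)) := by
          refine ENNReal.ofReal_le_ofReal (Real.exp_le_exp.2 ?_)
          have h5 : 2 ^ 26 * θ ^ 2 * n * (1 - e) ≤ 1 / 2 ^ 15 * (θ * n * R) := by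
            calc 2 ^ 26 * θ ^ 2 * n * (1 - e) = 2 ^ 26 * (θ * n) * (θ * (1 - e)) := by ring
              _ ≤ 2 ^ 26 * (θ * n) * (1 / 2 ^ 41 * R) := by gcongr
              _ = _ := by ring
          have h6 : 0 < θ * n * R := by positivity
          norm_num at h5 hLθ hEle ⊢
          linarith
  rw [probReal_compl_eq_one_sub hGm] at hbad
  linarith

/-! ### Testing and second moments -/

theorem ENNReal.two_mul_le_add_of_sq_le {f r s : ℝ≥0∞} (h : f ^ 2 ≤ r * s) : 2 * f ≤ r + s := by
  rcases eq_or_ne r ∞ with rfl | hr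
  · simp
  rcases eq_or_ne s ∞ with rfl | hs
  · simp
  lift r to ℝ≥0 using hr
  lift s to ℝ≥0 using hs
  have hf : f ≠ ∞ := by
    rintro rfl
    rw [ENNReal.top_pow two_ne_zero, top_le_iff] at h
    exact ENNReal.mul_ne_top ENNReal.coe_ne_top ENNReal.coe_ne_top h
  lift f to ℝ≥0 using hf
  norm_cast at h ⊢
  have h' : (f : ℝ) ^ 2 ≤ r * s := by exact_mod_cast h
  have hr := r.2
  have hs := s.2
  have h2 : (2 * (f : ℝ)) ^ 2 ≤ (r + s) ^ 2 := by nlinarith [sq_nonneg ((r : ℝ) - s)]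
  have h3 := (abs_le_of_sq_le_sq' h2 (add_nonneg hr hs)).2
  exact_mod_cast h3

/-- The second moment method in testing: if a randomized test `φ` accepts with probability at most
`δ` under `f₀`, and with probability larger by `g` under `f₁`, then the second moment `∑ f₁² / f₀`
of the likelihood ratio is at least `1 + g² / δ`. Division is avoided: `ρ` bounds `f₁² / f₀`. -/
theorem one_add_sq_div_le_of_test {Ω : Type*} (f₀ f₁ ρ φ φ' : Ω → ℝ≥0∞)
    (hφ : ∀ ω, φ ω + φ' ω = 1) (h₀ : ∑' ω, f₀ ω ≤ 1) (h₁ : ∑' ω, f₁ ω = 1)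
    (hρ : ∀ ω, f₁ ω ^ 2 ≤ ρ ω * f₀ ω) (V g δ : ℝ) (hV : 0 ≤ V) (hδ : 0 < δ) (hg : 0 ≤ g)
    (hV' : ∑' ω, ρ ω ≤ ENNReal.ofReal V) (hx : ∑' ω, φ ω * f₀ ω ≤ ENNReal.ofReal δ)
    (hy : ∑' ω, φ ω * f₀ ω + ENNReal.ofReal g ≤ ∑' ω, φ ω * f₁ ω) :
    1 + g ^ 2 / δ ≤ V := by
  set a : ℝ := 1 + g / δ with ha
  have ha0 : 0 ≤ a := by positivity
  -- the tangent inequality `2 a f₁ ≤ f₁² / f₀ + a² f₀`, with slope `a` where the test accepts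
  -- and slope `1` where it rejects
  have tangent : ∀ b : ℝ, 0 ≤ b → ∀ ω,
      2 * (ENNReal.ofReal b * f₁ ω) ≤ ρ ω + ENNReal.ofReal b ^ 2 * f₀ ω := by
    intro b _ ω
    refine ENNReal.two_mul_le_add_of_sq_le ?_
    calc (ENNReal.ofReal b * f₁ ω) ^ 2 = ENNReal.ofReal b ^ 2 * f₁ ω ^ 2 := mul_pow _ _ _
      _ ≤ ENNReal.ofReal b ^ 2 * (ρ ω * f₀ ω) := by gcongr; exact hρ ω
      _ = _ := by ring
  have hsplit : ∀ F : Ω → ℝ≥0∞, ∑' ω, φ ω * F ω + ∑' ω, φ' ω * F ω = ∑' ω, F ω := by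
    intro F
    rw [← ENNReal.tsum_add]
    exact tsum_congr fun ω => by rw [← add_mul, hφ, one_mul]
  set x := ∑' ω, φ ω * f₀ ω with hxdef
  set x' := ∑' ω, φ' ω * f₀ ω with hx'def
  set y := ∑' ω, φ ω * f₁ ω with hydef
  set y' := ∑' ω, φ' ω * f₁ ω with hy'def
  have hxx : x + x' ≤ 1 := (hsplit f₀).trans_le h₀
  have hyy : y + y' = 1 := (hsplit f₁).trans h₁
  have key : 2 * (ENNReal.ofReal a * y) + 2 * y'
      ≤ ENNReal.ofReal V + (ENNReal.ofReal a ^ 2 * x + x') := by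
    calc 2 * (ENNReal.ofReal a * y) + 2 * y'
        = ∑' ω, (φ ω * (2 * (ENNReal.ofReal a * f₁ ω))
            + φ' ω * (2 * (ENNReal.ofReal 1 * f₁ ω))) := by
          rw [ENNReal.tsum_add, hydef, hy'def, ← ENNReal.tsum_mul_left, ← ENNReal.tsum_mul_left,
            ← ENNReal.tsum_mul_left]
          congr 1
          · exact tsum_congr fun ω => by ring
          · exact tsum_congr fun ω => by rw [ENNReal.ofReal_one]; ring
      _ ≤ ∑' ω, (φ ω * (ρ ω + ENNReal.ofReal a ^ 2 * f₀ ω)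
            + φ' ω * (ρ ω + ENNReal.ofReal 1 ^ 2 * f₀ ω)) := by
          refine ENNReal.tsum_le_tsum fun ω => ?_
          gcongr
          · exact tangent a ha0 ω
          · exact tangent 1 zero_le_one ω
      _ = ∑' ω, ρ ω + (ENNReal.ofReal a ^ 2 * x + x') := by
          rw [← hsplit ρ, hxdef, hx'def, ← ENNReal.tsum_mul_left, ← ENNReal.tsum_add,
            ← ENNReal.tsum_add, ← ENNReal.tsum_add]
          exact tsum_congr fun ω => by rw [ENNReal.ofReal_one]; ring
      _ ≤ _ := by gcongr
  have fin : ∀ {s t : ℝ≥0∞}, s + t ≤ 1 → s ≠ ∞ ∧ t ≠ ∞ := fun {s t} h =>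
    ⟨ne_top_of_le_ne_top ENNReal.one_ne_top (le_self_add.trans h),
      ne_top_of_le_ne_top ENNReal.one_ne_top (le_add_self.trans h)⟩
  obtain ⟨fx, fx'⟩ := fin hxx
  obtain ⟨fy, fy'⟩ := fin hyy.le
  clear_value x x' y y'
  lift x to ℝ≥0 using fx
  lift x' to ℝ≥0 using fx'
  lift y to ℝ≥0 using fy
  lift y' to ℝ≥0 using fy'
  have e1 : (x : ℝ) + x' ≤ 1 := by exact_mod_cast hxx
  have e2 : (y : ℝ) + y' = 1 := by exact_mod_cast hyy
  have e3 : (x : ℝ) ≤ δ := by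
    rw [ENNReal.ofReal, ENNReal.coe_le_coe, ← NNReal.coe_le_coe, Real.coe_toNNReal _ hδ.le] at hx
    exact hx
  have e4 : (x : ℝ) + g ≤ y := by
    rw [ENNReal.ofReal, ← ENNReal.coe_add, ENNReal.coe_le_coe, ← NNReal.coe_le_coe,
      NNReal.coe_add, Real.coe_toNNReal _ hg] at hy
    exact hy
  have e5 : 2 * (a * y) + 2 * y' ≤ V + (a ^ 2 * x + x') := by
    have : ((2 * (a.toNNReal * y) + 2 * y' : ℝ≥0) : ℝ≥0∞)
        ≤ ((V.toNNReal + (a.toNNReal ^ 2 * x + x') : ℝ≥0) : ℝ≥0∞) := by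
      push_cast
      exact key
    rw [ENNReal.coe_le_coe, ← NNReal.coe_le_coe] at this
    push_cast at this
    rwa [Real.coe_toNNReal _ ha0, Real.coe_toNNReal _ hV] at this
  have hgδ : g / δ * x ≤ g := by
    calc g / δ * x ≤ g / δ * δ := by gcongr
      _ = g := div_mul_cancel₀ _ hδ.ne'
  have hgδ0 : 0 ≤ g / δ := by positivity
  have e6 : g / δ * (2 * g - g) ≤ g / δ * (2 * (y - x) - g / δ * x) := by
    gcongr
    · linarith
  have e7 : g ^ 2 / δ = g / δ * (2 * g - g) := by ring
  rw [e7]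
  rw [ha] at e5
  nlinarith

/-- The second moment method in terms of the two errors of a randomized test. -/
theorem one_add_sq_div_le_of_errors {Ω : Type*} (f₀ f₁ ρ φ φ' : Ω → ℝ≥0∞)
    (hφ : ∀ ω, φ ω + φ' ω = 1) (h₀ : ∑' ω, f₀ ω ≤ 1) (h₁ : ∑' ω, f₁ ω = 1)
    (hρ : ∀ ω, f₁ ω ^ 2 ≤ ρ ω * f₀ ω) (V g δ δ' : ℝ) (hV : 0 ≤ V) (hδ : 0 < δ) (hδ' : 0 ≤ δ')
    (hg : 0 ≤ g) (hsum : δ + δ' + g ≤ 1)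
    (hV' : ∑' ω, ρ ω ≤ ENNReal.ofReal V) (hx : ∑' ω, φ ω * f₀ ω ≤ ENNReal.ofReal δ)
    (hy : ∑' ω, φ' ω * f₁ ω ≤ ENNReal.ofReal δ') :
    1 + g ^ 2 / δ ≤ V := by
  refine one_add_sq_div_le_of_test f₀ f₁ ρ φ φ' hφ h₀ h₁ hρ V g δ hV hδ hg hV' hx ?_
  have h1 : ∑' ω, φ ω * f₁ ω + ∑' ω, φ' ω * f₁ ω = 1 := by
    rw [← h₁, ← ENNReal.tsum_add]
    exact tsum_congr fun ω => by rw [← add_mul, hφ, one_mul]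
  have h2 : ENNReal.ofReal δ + ENNReal.ofReal g + ENNReal.ofReal δ' ≤ 1 := by
    rw [← ENNReal.ofReal_add hδ.le hg, ← ENNReal.ofReal_add (by linarith) hδ', ← ENNReal.ofReal_one]
    exact ENNReal.ofReal_le_ofReal (by linarith)
  refine ENNReal.le_of_add_le_add_right (a := ∑' ω, φ' ω * f₁ ω)
    (ne_top_of_le_ne_top ENNReal.ofReal_ne_top hy) ?_
  rw [h1]
  refine le_trans ?_ h2
  gcongr

theorem TestsWithError.null_error {k m : ℕ} {ε δ : ℝ}
    {ψ : (Fin m → Fin k) × (Fin m → Fin k) → Fin 2}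
    (hψ : TestsWithError ψ (twoSampleHyp m ε (classD k)) δ) (P : ProbabilityMeasure (Fin k)) :
    (twoSampleLaw m P P).real {s | ψ s ≠ 0} ≤ δ := by
  have h : twoSampleLaw m P P ∈ twoSampleHyp m ε (classD k) 0 := by
    change twoSampleLaw m P P ∈ {R | ∃ P ∈ classD k, R = twoSampleLaw m P P}
    exact ⟨P, Set.mem_univ _, rfl⟩
  exact hψ 0 _ h

theorem TestsWithError.alternative_error {k m : ℕ} {ε δ : ℝ}
    {ψ : (Fin m → Fin k) × (Fin m → Fin k) → Fin 2}
    (hψ : TestsWithError ψ (twoSampleHyp m ε (classD k)) δ) (P Q : ProbabilityMeasure (Fin k))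
    (hPQ : ε ≤ tvDist P Q) : (twoSampleLaw m P Q).real {s | ψ s ≠ 1} ≤ δ := by
  have h : twoSampleLaw m P Q ∈ twoSampleHyp m ε (classD k) 1 := by
    change twoSampleLaw m P Q ∈
      {R | ∃ P ∈ classD k, ∃ Q ∈ classD k, ε ≤ tvDist P Q ∧ R = twoSampleLaw m P Q}
    exact ⟨P, Set.mem_univ _, Q, Set.mem_univ _, hPQ, rfl⟩
  exact hψ 1 _ h

/-- A two-sample test over an alphabet with `k` letters can be used for distributions on any type
`ι` that embeds into this alphabet. -/
theorem exists_test_of_embedding {k m : ℕ} {ε δ : ℝ}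
    (h : ∃ ψ : (Fin m → Fin k) × (Fin m → Fin k) → Fin 2,
      Measurable ψ ∧ TestsWithError ψ (twoSampleHyp m ε (classD k)) δ)
    {ι : Type*} [Fintype ι] [DecidableEq ι] (e : ι ↪ Fin k) :
    ∃ φ φ' : (Fin m → ι) → (Fin m → ι) → ℝ≥0∞, (∀ x y, φ x y + φ' x y = 1) ∧
      (∀ p : ι → ℝ≥0, ∑ i, p i = 1 →
        ∑ x, ∑ y, φ x y * ((∏ j, (p (x j) : ℝ≥0∞)) * ∏ j, (p (y j) : ℝ≥0∞))
          ≤ ENNReal.ofReal δ) ∧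
      (∀ p q : ι → ℝ≥0, ∑ i, p i = 1 → ∑ i, q i = 1 →
        (∃ B : Finset ι, ε ≤ ∑ i ∈ B, (p i : ℝ) - ∑ i ∈ B, (q i : ℝ)) →
        ∑ x, ∑ y, φ' x y * ((∏ j, (p (x j) : ℝ≥0∞)) * ∏ j, (q (y j) : ℝ≥0∞))
          ≤ ENNReal.ofReal δ) := by
  classical
  obtain ⟨ψ, -, hψ⟩ := h
  let _ : MeasurableSpace ι := ⊤
  have _ : DiscreteMeasurableSpace ι := ⟨fun _ => trivial⟩
  have he : Measurable e := measurable_of_finite _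
  -- the measure on `ι` with weights `p`
  let ν : (ι → ℝ≥0) → Measure ι := fun p => ∑ i, (p i : ℝ≥0∞) • Measure.dirac i
  have hν : ∀ p (s : Set ι), ν p s = ∑ i, if i ∈ s then (p i : ℝ≥0∞) else 0 := by
    intro p s
    simp only [ν, Measure.coe_finsetSum, Finset.sum_apply, Measure.smul_apply, smul_eq_mul,
      Measure.dirac_apply' _ (MeasurableSet.of_discrete (s := s)), Set.indicator]
    exact Finset.sum_congr rfl fun i _ => by split_ifs <;> simp
  have hν1 : ∀ p : ι → ℝ≥0, ∑ i, p i = 1 → IsProbabilityMeasure (ν p) := fun p hp =>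
    ⟨by rw [hν]; simp only [Set.mem_univ, if_true]; exact_mod_cast hp⟩
  let P : ∀ p : ι → ℝ≥0, ∑ i, p i = 1 → ProbabilityMeasure (Fin k) := fun p hp =>
    ⟨(ν p).map e, by have := hν1 p hp; exact Measure.isProbabilityMeasure_map he.aemeasurable⟩
  have hlaw : ∀ (p q : ι → ℝ≥0) (hp : ∑ i, p i = 1) (hq : ∑ i, q i = 1)
      (S : Set ((Fin m → Fin k) × (Fin m → Fin k))),
      twoSampleLaw m (P p hp) (P q hq) S = ∑ x : Fin m → ι, ∑ y : Fin m → ι,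
        S.indicator 1 ((fun j => e (x j)), (fun j => e (y j))) *
          ((∏ j, (p (x j) : ℝ≥0∞)) * ∏ j, (q (y j) : ℝ≥0∞)) := by
    intro p q hp hq S
    have h1 := hν1 p hp
    have h2 := hν1 q hq
    have hpi : ∀ (p : ι → ℝ≥0) (hp : ∑ i, p i = 1),
        (Measure.pi fun _ : Fin m => ((P p hp : Measure (Fin k))))
        = (Measure.pi fun _ : Fin m => ν p).map fun x j => e (x j) := by
      intro p hp
      have := hν1 p hp
      exact (Measure.pi_map_pi (μ := fun _ : Fin m => ν p) fun _ => he.aemeasurable).symm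
    have hsing : ∀ p i, ν p {i} = p i := by
      intro p i
      rw [hν]
      simp
    rw [twoSampleLaw, hpi p hp, hpi q hq, Measure.map_prod_map _ _ (measurable_of_finite _)
      (measurable_of_finite _),
      Measure.map_apply (measurable_of_finite _) (Set.to_countable _).measurableSet,
      ← lintegral_indicator_one (Set.to_countable _).measurableSet, lintegral_fintype,
      Fintype.sum_prod_type]
    refine Finset.sum_congr rfl fun x _ => Finset.sum_congr rfl fun y _ => ?_
    rw [← Set.singleton_prod_singleton, Measure.prod_prod, Measure.pi_singleton,
      Measure.pi_singleton]
    simp only [hsing]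
    rfl
  have hreal : ∀ (p q : ι → ℝ≥0) (hp : ∑ i, p i = 1) (hq : ∑ i, q i = 1)
      (S : Set ((Fin m → Fin k) × (Fin m → Fin k))),
      (twoSampleLaw m (P p hp) (P q hq)).real S ≤ δ →
      twoSampleLaw m (P p hp) (P q hq) S ≤ ENNReal.ofReal δ := by
    intro p q hp hq S hS
    have : IsFiniteMeasure (twoSampleLaw m (P p hp) (P q hq)) := by
      unfold twoSampleLaw; infer_instance
    rw [← ofReal_measureReal]
    exact ENNReal.ofReal_le_ofReal hS
  refine ⟨fun x y => {s | ψ s ≠ 0}.indicator 1 ((fun j => e (x j)), (fun j => e (y j))),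
    fun x y => {s | ψ s ≠ 1}.indicator 1 ((fun j => e (x j)), (fun j => e (y j))),
    fun x y => ?_, fun p hp => ?_, fun p q hp hq hB => ?_⟩
  · simp only [Set.indicator, Set.mem_ofPred_eq, Pi.one_apply]
    have hfin : ∀ b : Fin 2, b = 0 ∨ b = 1 := by decide
    rcases hfin (ψ ((fun j => e (x j)), (fun j => e (y j)))) with h | h
    · simp [h]
    · simp [h]
  · exact le_of_eq_of_le (hlaw p p hp hp {s | ψ s ≠ 0}).symm
      (hreal p p hp hp _ (hψ.null_error (P p hp)))
  · refine le_of_eq_of_le (hlaw p q hp hq {s | ψ s ≠ 1}).symm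
      (hreal p q hp hq _ (hψ.alternative_error (P p hp) (P q hq) ?_))
    obtain ⟨B, hB⟩ := hB
    have hPB : ∀ (p : ι → ℝ≥0) (hp : ∑ i, p i = 1),
        ((P p hp : Measure (Fin k))).real (e '' B) = ∑ i ∈ B, (p i : ℝ) := by
      intro p hp
      change ((ν p).map e).real (e '' B) = _
      rw [Measure.real, Measure.map_apply he (Set.to_countable _).measurableSet,
        Set.preimage_image_eq _ e.injective, hν]
      simp only [Finset.mem_coe]
      rw [Finset.sum_ite_mem, Finset.univ_inter, ENNReal.toReal_sum fun _ _ => ENNReal.coe_ne_top]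
      rfl
    have hbdd : BddAbove (Set.range fun A : {A : Set (Fin k) // MeasurableSet A} =>
        |((P p hp : Measure (Fin k))).real A.1 - ((P q hq : Measure (Fin k))).real A.1|) := by
      refine ⟨1, ?_⟩
      rintro _ ⟨A, rfl⟩
      have a1 : ((P p hp : Measure (Fin k))).real A.1 ≤ 1 := measureReal_le_one
      have a2 : ((P q hq : Measure (Fin k))).real A.1 ≤ 1 := measureReal_le_one
      have a3 : 0 ≤ ((P p hp : Measure (Fin k))).real A.1 := measureReal_nonneg
      have a4 : 0 ≤ ((P q hq : Measure (Fin k))).real A.1 := measureReal_nonneg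
      exact abs_le.2 ⟨by linarith, by linarith⟩
    have := le_ciSup hbdd ⟨e '' B, (Set.to_countable _).measurableSet⟩
    simp only [hPB] at this
    exact hB.trans ((le_abs_self _).trans this)

/-! ### Perturbations of the uniform distribution -/

/-- The sign attached to a Boolean. -/
def boolSign (b : Bool) : ℝ := if b then 1 else -1

theorem boolSign_mul_self (b : Bool) : boolSign b * boolSign b = 1 := by
  cases b <;> simp [boolSign]

theorem abs_boolSign (b : Bool) : |boolSign b| = 1 := by
  cases b <;> simp [boolSign]

theorem sum_boolSign_mul (f : ℝ → ℝ) : ∑ b, f (boolSign b) = f 1 + f (-1) := by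
  simp [boolSign]

/-- Weight of the letter `(j, b)` under the perturbation, with signs `z` and size `ε`, of the
uniform distribution on `r` pairs of letters. Each pair keeps its total weight. -/
noncomputable def pairWeight {r : ℕ} (ε : ℝ) (z : Fin r → Bool) (a : Fin r × Bool) : ℝ :=
  (1 + ε * (boolSign a.2 * boolSign (z a.1))) / (2 * r)

theorem pairWeight_nonneg {r : ℕ} {ε : ℝ} (hε : |ε| ≤ 1) (z : Fin r → Bool) (a : Fin r × Bool) :
    0 ≤ pairWeight ε z a := by
  have h : |ε * (boolSign a.2 * boolSign (z a.1))| ≤ 1 := by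
    rw [abs_mul, abs_mul, abs_boolSign, abs_boolSign]
    simpa using hε
  have := (abs_le.1 h).1
  exact div_nonneg (by linarith) (by positivity)

theorem sum_pairWeight {r : ℕ} (hr : 0 < r) (ε : ℝ) (z : Fin r → Bool) :
    ∑ a, pairWeight ε z a = 1 := by
  have hr' : (r : ℝ) ≠ 0 := by exact_mod_cast hr.ne'
  have : ∀ j, ∑ b, pairWeight ε z (j, b) = 1 / r := by
    intro j
    simp only [pairWeight]
    rw [sum_boolSign_mul fun s => (1 + ε * (s * boolSign (z j))) / (2 * r)]
    field_simp
    ring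
  rw [Fintype.sum_prod_type, Finset.sum_congr rfl fun j _ => this j]
  simp [hr']

theorem sum_pairWeight_mul {r : ℕ} (hr : 0 < r) (ε : ℝ) (z z' : Fin r → Bool) :
    2 * r * ∑ a, pairWeight ε z a * pairWeight ε z' a
      = 1 + ε ^ 2 / r * ∑ j, boolSign (z j) * boolSign (z' j) := by
  have hr' : (r : ℝ) ≠ 0 := by exact_mod_cast hr.ne'
  have : ∀ j, ∑ b, pairWeight ε z (j, b) * pairWeight ε z' (j, b)
      = (1 / r + ε ^ 2 / r * (boolSign (z j) * boolSign (z' j))) / (2 * r) := by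
    intro j
    simp only [pairWeight]
    rw [sum_boolSign_mul fun s => (1 + ε * (s * boolSign (z j))) / (2 * r) *
      ((1 + ε * (s * boolSign (z' j))) / (2 * r))]
    field_simp
    ring
  rw [Fintype.sum_prod_type, Finset.sum_congr rfl fun j _ => this j, ← Finset.sum_div,
    Finset.sum_add_distrib, Finset.mul_sum]
  simp only [Finset.sum_const, Finset.card_univ, Fintype.card_fin, nsmul_eq_mul]
  field_simp

/-- The mean, over two independent vectors of uniform signs, of the `M`-th power of the correlation
of two perturbations. -/
noncomputable def pairMoment (r M : ℕ) (ε : ℝ) : ℝ :=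
  (1 / 2 ^ r) ^ 2 * ∑ z : Fin r → Bool, ∑ z' : Fin r → Bool,
    (1 + ε ^ 2 / r * ∑ j, boolSign (z j) * boolSign (z' j)) ^ M

theorem abs_sum_boolSign_le {r : ℕ} (z z' : Fin r → Bool) :
    |∑ j, boolSign (z j) * boolSign (z' j)| ≤ r := by
  refine (Finset.abs_sum_le_sum_abs _ _).trans (le_of_eq ?_)
  simp [abs_mul, abs_boolSign]

/-- The first bound uses that the correlation is at most `1 + ε²`, the second one that a sum of `r`
independent signs is sub-Gaussian. -/
theorem pairMoment_le_exp_mul {r : ℕ} (hr : 0 < r) (M : ℕ) {ε : ℝ} (hε : |ε| ≤ 1) :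
    pairMoment r M ε ≤ Real.exp (M * ε ^ 2) ∧
      pairMoment r M ε ≤ Real.exp (M ^ 2 * ε ^ 4 / (2 * r)) := by
  have hr' : (0 : ℝ) < r := by exact_mod_cast hr
  have hε2 : ε ^ 2 ≤ 1 := by rw [← sq_abs]; exact pow_le_one₀ (abs_nonneg _) hε
  have hpow : ∀ z z' : Fin r → Bool, (1 + ε ^ 2 / r * ∑ j, boolSign (z j) * boolSign (z' j)) ^ M
      ≤ Real.exp (M * (ε ^ 2 / r * ∑ j, boolSign (z j) * boolSign (z' j))) := by
    intro z z'
    rw [Real.exp_nat_mul]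
    have h1 := (abs_le.1 (abs_sum_boolSign_le z z')).1
    have h2 : ε ^ 2 / r * (-r) ≤ ε ^ 2 / r * ∑ j, boolSign (z j) * boolSign (z' j) := by gcongr
    have h3 : ε ^ 2 / r * (-r) = -ε ^ 2 := by field_simp
    refine pow_le_pow_left₀ (by linarith) ?_ M
    rw [add_comm]
    exact Real.add_one_le_exp _
  have hcard : ∀ c : ℝ, (1 / 2 ^ r) ^ 2 * ∑ z : Fin r → Bool, ∑ z' : Fin r → Bool, c = c := by
    intro c
    simp only [Finset.sum_const, Finset.card_univ, Fintype.card_pi_const, Fintype.card_bool,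
      nsmul_eq_mul]
    push_cast
    field_simp
  constructor
  · rw [← hcard (Real.exp (M * ε ^ 2)), pairMoment]
    gcongr with z _ z' _
    refine (hpow z z').trans (Real.exp_le_exp.2 ?_)
    gcongr
    calc ε ^ 2 / r * ∑ j, boolSign (z j) * boolSign (z' j) ≤ ε ^ 2 / r * r := by
          gcongr
          exact (abs_le.1 (abs_sum_boolSign_le z z')).2
      _ = ε ^ 2 := by field_simp
  · set s : ℝ := M * (ε ^ 2 / r) with hs
    have hz : ∀ z : Fin r → Bool, ∑ z' : Fin r → Bool,
        Real.exp (M * (ε ^ 2 / r * ∑ j, boolSign (z j) * boolSign (z' j)))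
          = (2 * Real.cosh s) ^ r := by
      intro z
      have h1 : ∀ z' : Fin r → Bool,
          Real.exp (M * (ε ^ 2 / r * ∑ j, boolSign (z j) * boolSign (z' j)))
            = ∏ j, Real.exp (s * (boolSign (z j) * boolSign (z' j))) := by
        intro z'
        rw [← Real.exp_sum, ← Finset.mul_sum, hs, mul_assoc]
      rw [Finset.sum_congr rfl fun z' _ => h1 z',
        ← Fintype.prod_sum fun (j : Fin r) (b : Bool) =>
          Real.exp (s * (boolSign (z j) * boolSign b))]
      have h2 : ∀ j, ∑ b, Real.exp (s * (boolSign (z j) * boolSign b)) = 2 * Real.cosh s := by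
        intro j
        rw [sum_boolSign_mul fun t => Real.exp (s * (boolSign (z j) * t)), Real.cosh_eq]
        cases z j <;> simp [boolSign] <;> ring
      rw [Finset.prod_congr rfl fun j _ => h2 j]
      simp
    calc pairMoment r M ε ≤ (1 / 2 ^ r) ^ 2 * ∑ z : Fin r → Bool, (2 * Real.cosh s) ^ r := by
          rw [pairMoment]
          gcongr with z _
          rw [← hz z]
          exact Finset.sum_le_sum fun z' _ => hpow z z'
      _ = Real.cosh s ^ r := by
          simp only [Finset.sum_const, Finset.card_univ, Fintype.card_pi_const, Fintype.card_bool,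
            nsmul_eq_mul]
          push_cast
          rw [mul_pow]
          field_simp
      _ ≤ Real.exp (s ^ 2 / 2) ^ r := by
          gcongr
          exact Real.cosh_le_exp_half_sq s
      _ = Real.exp (M ^ 2 * ε ^ 4 / (2 * r)) := by
          rw [← Real.exp_nat_mul, hs]
          congr 1
          field_simp

/-- Lower bound for testing from the perturbed uniform distributions: with `m` samples, a test with
errors at most `δ` forces `1 + g² / δ` to be at most the second moment of the likelihood ratio. -/
theorem one_add_sq_div_le_pairMoment {m r : ℕ} (hr : 0 < r) {ε δ g : ℝ} (hε0 : 0 ≤ ε) (hε1 : ε ≤ 1)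
    (hδ : 0 < δ) (hg : 0 ≤ g) (hgδ : 2 * δ + g ≤ 1)
    (φ φ' : (Fin m → Fin r × Bool) → (Fin m → Fin r × Bool) → ℝ≥0∞)
    (hφ : ∀ x y, φ x y + φ' x y = 1)
    (h₀ : ∀ p : Fin r × Bool → ℝ≥0, ∑ i, p i = 1 →
        ∑ x, ∑ y, φ x y * ((∏ j, (p (x j) : ℝ≥0∞)) * ∏ j, (p (y j) : ℝ≥0∞))
          ≤ ENNReal.ofReal δ)
    (h₁ : ∀ p q : Fin r × Bool → ℝ≥0, ∑ i, p i = 1 → ∑ i, q i = 1 →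
        (∃ B : Finset (Fin r × Bool), ε ≤ ∑ i ∈ B, (p i : ℝ) - ∑ i ∈ B, (q i : ℝ)) →
        ∑ x, ∑ y, φ' x y * ((∏ j, (p (x j) : ℝ≥0∞)) * ∏ j, (q (y j) : ℝ≥0∞))
          ≤ ENNReal.ofReal δ) :
    1 + g ^ 2 / δ ≤ pairMoment r (2 * m) ε := by
  have hr' : (r : ℝ) ≠ 0 := by exact_mod_cast hr.ne'
  have ha1 : |ε| ≤ 1 := by rwa [abs_of_nonneg hε0]
  have ha2 : |-ε| ≤ 1 := by rwa [abs_neg]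
  set P : (Fin r → Bool) → Fin r × Bool → ℝ≥0 := fun z a =>
    ⟨pairWeight ε z a, pairWeight_nonneg ha1 z a⟩ with hP
  set Q : (Fin r → Bool) → Fin r × Bool → ℝ≥0 := fun z a =>
    ⟨pairWeight (-ε) z a, pairWeight_nonneg ha2 z a⟩ with hQ
  have hPr : ∀ z a, (P z a : ℝ) = pairWeight ε z a := fun _ _ => rfl
  have hQr : ∀ z a, (Q z a : ℝ) = pairWeight (-ε) z a := fun _ _ => rfl
  have hPs : ∀ z, ∑ a, P z a = 1 := fun z => by
    rw [← NNReal.coe_inj, NNReal.coe_sum]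
    simpa [hPr] using sum_pairWeight hr ε z
  have hQs : ∀ z, ∑ a, Q z a = 1 := fun z => by
    rw [← NNReal.coe_inj, NNReal.coe_sum]
    simpa [hQr] using sum_pairWeight hr (-ε) z
  have hTV : ∀ z, ∃ B : Finset (Fin r × Bool),
      ε ≤ ∑ i ∈ B, (P z i : ℝ) - ∑ i ∈ B, (Q z i : ℝ) := by
    intro z
    refine ⟨Finset.univ.filter fun a => a.2 = z a.1, ?_⟩
    rw [← Finset.sum_sub_distrib, Finset.sum_filter, Fintype.sum_prod_type]
    have : ∀ j, ∑ b, (if b = z j then (P z (j, b) : ℝ) - Q z (j, b) else 0) = ε / r := by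
      intro j
      rw [Finset.sum_ite_eq' Finset.univ (z j) fun b => (P z (j, b) : ℝ) - Q z (j, b),
        if_pos (Finset.mem_univ _), hPr, hQr, pairWeight, pairWeight, boolSign_mul_self]
      field_simp
      ring
    rw [Finset.sum_congr rfl fun j _ => this j]
    simp
    field_simp
    exact le_rfl
  -- the two mixtures, as functions on pairs of words
  set u : ℝ≥0 := (2 * r : ℝ≥0)⁻¹ with hu
  set W : (Fin r → Bool) → (Fin m → Fin r × Bool) × (Fin m → Fin r × Bool) → ℝ≥0 :=
    fun z w => (∏ j, P z (w.1 j)) * ∏ j, Q z (w.2 j) with hW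
  set F₁ : (Fin m → Fin r × Bool) × (Fin m → Fin r × Bool) → ℝ≥0 :=
    fun w => (1 / 2 ^ r) * ∑ z, W z w with hF₁
  have hsumW : ∀ z, ∑ w, W z w = 1 := by
    intro z
    simp only [hW, Fintype.sum_prod_type, ← Finset.mul_sum]
    rw [← Fintype.sum_pow, hQs, ← Finset.sum_mul, ← Fintype.sum_pow, hPs]
    simp
  have hZ : ((1 / 2 ^ r : ℝ≥0)) * ∑ z : Fin r → Bool, (1 : ℝ≥0) = 1 := by
    simp
  have hu2 : (2 * r : ℝ≥0) * u = 1 := mul_inv_cancel₀ (by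
    have : (r : ℝ≥0) ≠ 0 := by exact_mod_cast hr.ne'
    positivity)
  refine one_add_sq_div_le_of_errors (fun w => ((u ^ (2 * m) : ℝ≥0) : ℝ≥0∞))
    (fun w => (F₁ w : ℝ≥0∞))
    (fun w => (((2 * r) ^ (2 * m) * F₁ w ^ 2 : ℝ≥0) : ℝ≥0∞)) (fun w => φ w.1 w.2)
    (fun w => φ' w.1 w.2) (fun w => hφ _ _) ?_ ?_ ?_ _ g δ δ ?_ hδ hδ.le hg (by linarith) ?_ ?_ ?_
  · rw [tsum_fintype, Finset.sum_const, nsmul_eq_mul, Finset.card_univ]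
    have : ((Fintype.card ((Fin m → Fin r × Bool) × (Fin m → Fin r × Bool)) : ℝ≥0)) * u ^ (2 * m)
        = 1 := by
      rw [Fintype.card_prod, Fintype.card_fun, Fintype.card_prod, Fintype.card_fin,
        Fintype.card_fin, Fintype.card_bool]
      push_cast
      rw [← pow_add, ← two_mul, ← mul_pow, mul_comm (r : ℝ≥0), hu2, one_pow]
    exact le_of_eq (by exact_mod_cast this)
  · rw [tsum_fintype]
    have : ∑ w, F₁ w = 1 := by
      simp only [hF₁]
      rw [← Finset.mul_sum, Finset.sum_comm, Finset.sum_congr rfl fun z _ => hsumW z, hZ]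
    exact_mod_cast this
  · intro w
    have : F₁ w ^ 2 = (2 * r) ^ (2 * m) * F₁ w ^ 2 * u ^ (2 * m) := by
      rw [mul_right_comm, ← mul_pow, hu2, one_pow, one_mul]
    exact le_of_eq (by exact_mod_cast this)
  · refine mul_nonneg (by positivity) (Finset.sum_nonneg fun z _ =>
      Finset.sum_nonneg fun z' _ => ?_)
    exact (even_two_mul m).pow_nonneg _
  · rw [tsum_fintype, ← ENNReal.ofNNReal_finsetSum]
    refine le_of_eq ?_
    rw [← ENNReal.ofReal_coe_nnreal]
    congr 1
    have hcorr : ∀ z z', ∑ w, (W z w : ℝ) * W z' w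
        = (∑ a, pairWeight ε z a * pairWeight ε z' a) ^ m
          * (∑ a, pairWeight (-ε) z a * pairWeight (-ε) z' a) ^ m := by
      intro z z'
      rw [Fintype.sum_pow, Fintype.sum_pow, Fintype.sum_prod_type, Finset.sum_mul_sum]
      refine Finset.sum_congr rfl fun x _ => Finset.sum_congr rfl fun y _ => ?_
      simp only [hW, NNReal.coe_mul, NNReal.coe_prod, hPr, hQr, Finset.prod_mul_distrib]
      ring
    have hsq : ∀ w, (F₁ w : ℝ) ^ 2 = (1 / 2 ^ r) ^ 2 * ∑ z, ∑ z', (W z w : ℝ) * W z' w := by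
      intro w
      simp only [hF₁, NNReal.coe_mul, NNReal.coe_sum]
      rw [mul_pow, sq (∑ z, _), Finset.sum_mul_sum]
      simp
    push_cast
    simp only [hsq]
    rw [← Finset.mul_sum, ← Finset.mul_sum, Finset.sum_comm]
    simp only [Finset.sum_comm (s := (Finset.univ :
      Finset ((Fin m → Fin r × Bool) × (Fin m → Fin r × Bool))))]
    rw [pairMoment, mul_left_comm, Finset.mul_sum]
    congr 1
    refine Finset.sum_congr rfl fun z _ => ?_
    rw [Finset.mul_sum]
    refine Finset.sum_congr rfl fun z' _ => ?_
    rw [hcorr, two_mul m, pow_add, pow_add, mul_mul_mul_comm, ← mul_pow, ← mul_pow,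
      sum_pairWeight_mul hr, sum_pairWeight_mul hr, neg_sq]
  · rw [tsum_fintype, Fintype.sum_prod_type]
    refine le_of_eq_of_le ?_ (h₀ (fun _ => u) ?_)
    · refine Finset.sum_congr rfl fun x _ => Finset.sum_congr rfl fun y _ => ?_
      simp only [Finset.prod_const, Finset.card_univ, Fintype.card_fin, ENNReal.coe_pow]
      rw [← pow_add, two_mul]
    · rw [Finset.sum_const, nsmul_eq_mul, Finset.card_univ, Fintype.card_prod, Fintype.card_fin,
        Fintype.card_bool, ← hu2]
      push_cast
      ring
  · rw [tsum_fintype, Fintype.sum_prod_type]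
    calc ∑ x, ∑ y, φ' x y * (F₁ (x, y) : ℝ≥0∞)
        = ((1 / 2 ^ r : ℝ≥0) : ℝ≥0∞) * ∑ z, ∑ x, ∑ y, φ' x y *
            ((∏ j, (P z (x j) : ℝ≥0∞)) * ∏ j, (Q z (y j) : ℝ≥0∞)) := by
          have h : ∀ x y, φ' x y * (F₁ (x, y) : ℝ≥0∞) = ∑ z, ((1 / 2 ^ r : ℝ≥0) : ℝ≥0∞) *
              (φ' x y * ((∏ j, (P z (x j) : ℝ≥0∞)) * ∏ j, (Q z (y j) : ℝ≥0∞))) := by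
            intro x y
            simp only [hF₁, hW, ENNReal.coe_mul, ENNReal.ofNNReal_finsetSum,
              ENNReal.ofNNReal_finsetProd, Finset.mul_sum]
            exact Finset.sum_congr rfl fun z _ => mul_left_comm _ _ _
          simp only [h, Finset.mul_sum]
          rw [Finset.sum_comm (s := (Finset.univ : Finset (Fin r → Bool)))]
          exact Finset.sum_congr rfl fun x _ => Finset.sum_comm
      _ ≤ ((1 / 2 ^ r : ℝ≥0) : ℝ≥0∞) * ∑ z : Fin r → Bool, ENNReal.ofReal δ := by
          gcongr with z _
          exact h₁ _ _ (hPs z) (hQs z) (hTV z)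
      _ = ENNReal.ofReal δ := by
          have : ((1 / 2 ^ r : ℝ≥0) : ℝ≥0∞) * ∑ z : Fin r → Bool, (1 : ℝ≥0∞) = 1 := by
            exact_mod_cast congrArg ((↑) : ℝ≥0 → ℝ≥0∞) hZ
          calc _ = ((1 / 2 ^ r : ℝ≥0) : ℝ≥0∞) * (∑ z : Fin r → Bool, (1 : ℝ≥0∞))
                * ENNReal.ofReal δ := by
                rw [mul_assoc, Finset.sum_mul]
                simp
            _ = _ := by rw [this, one_mul]

/-! ### Tests on Poissonized samples -/

theorem tsum_words {ι : Type*} [Fintype ι] (F : (Σ N : ℕ, (Fin N → ι)) → ℝ≥0∞) :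
    ∑' v, F v = ∑' N : ℕ, ∑ x : Fin N → ι, F ⟨N, x⟩ := by
  rw [ENNReal.tsum_sigma']
  exact tsum_congr fun N => tsum_fintype _

/-- Sums over pairs of words of functions that factor over the letters. -/
theorem tsum_prod_words {ι : Type*} [DecidableEq ι] [Fintype ι] (r : ι → ℕ → ℕ → ℝ≥0∞) :
    ∑' ω : (Σ N : ℕ, (Fin N → ι)) × (Σ N : ℕ, (Fin N → ι)),
        (ω.1.1.factorial : ℝ≥0∞)⁻¹ * ((ω.2.1.factorial : ℝ≥0∞)⁻¹ *
          ∏ i, r i (letterCount ω.1.2 i) (letterCount ω.2.2 i))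
      = ∏ i, ∑' a : ℕ, (a.factorial : ℝ≥0∞)⁻¹ * ∑' b : ℕ, (b.factorial : ℝ≥0∞)⁻¹ * r i a b := by
  rw [ENNReal.tsum_prod', tsum_words]
  have h1 : ∀ (N : ℕ) (x : Fin N → ι), ∑' v : Σ N : ℕ, (Fin N → ι),
      (N.factorial : ℝ≥0∞)⁻¹ * ((v.1.factorial : ℝ≥0∞)⁻¹ *
          ∏ i, r i (letterCount x i) (letterCount v.2 i))
      = (N.factorial : ℝ≥0∞)⁻¹ *
        ∏ i, ∑' b : ℕ, (b.factorial : ℝ≥0∞)⁻¹ * r i (letterCount x i) b := by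
    intro N x
    rw [ENNReal.tsum_mul_left, tsum_words, tsum_sum_letterCount fun c =>
      ∏ i, r i (letterCount x i) (c i), ← tsum_prod_pi]
    simp only [Finset.prod_mul_distrib]
  simp only [h1]
  rw [tsum_sum_letterCount fun c => ∏ i, ∑' b : ℕ, (b.factorial : ℝ≥0∞)⁻¹ * r i (c i) b,
    ← tsum_prod_pi]
  simp only [Finset.prod_mul_distrib]

theorem sum_wordWeight {ι : Type*} [Fintype ι] (a : ι → ℝ≥0) (N : ℕ) :
    ∑ x : Fin N → ι, wordWeight a x = poissonMeasure (∑ i, a i) {N} := by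
  simp only [wordWeight]
  rw [← Finset.mul_sum, ← Finset.mul_sum, ← Fintype.sum_pow (fun i => (a i : ℝ≥0∞)) N,
    poissonMeasure_singleton_eq]
  push_cast
  ring

theorem tsum_wordWeight {ι : Type*} [Fintype ι] (a : ι → ℝ≥0) :
    ∑' v : Σ N : ℕ, (Fin N → ι), wordWeight a v.2 = 1 := by
  rw [tsum_words]
  simp only [sum_wordWeight]
  have := lintegral_countable' (μ := poissonMeasure (∑ i, a i)) fun _ => 1
  simpa using this.symm

theorem tsum_wordWeight_short_le {ι : Type*} [Fintype ι] (a : ι → ℝ≥0) (m : ℕ) :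
    ∑' v : Σ N : ℕ, (Fin N → ι), (if m ≤ v.1 then 0 else 1) * wordWeight a v.2
      ≤ ENNReal.ofReal (2 ^ m * Real.exp (-((∑ i, (a i : ℝ)) / 2))) := by
  rw [tsum_words]
  have h0 : ∀ N, ∑ x : Fin N → ι, (if m ≤ N then (0 : ℝ≥0∞) else 1) * wordWeight a x
      = (if m ≤ N then 0 else 1) * poissonMeasure (∑ i, a i) {N} := fun N => by
    rw [← Finset.mul_sum, sum_wordWeight]
  simp only [h0]
  have h := poissonMeasure_le_two_pow (∑ i, a i) m
  rw [NNReal.coe_sum] at h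
  refine le_trans ?_ h
  rw [← lintegral_indicator_one (Set.to_countable _).measurableSet, lintegral_countable']
  refine ENNReal.tsum_le_tsum fun N => ?_
  gcongr
  split_ifs with h1
  · exact zero_le
  · rw [Set.indicator_of_mem (show N ∈ {x | x ≤ m} from (not_le.1 h1).le)]
    simp

/-- The first `m` letters of a Poissonized sample of size at least `m` are an iid sample from the
normalized intensity. -/
theorem tsum_wordWeight_prefix_le {ι : Type*} [Fintype ι] (a : ι → ℝ≥0) (ha : ∑ i, a i ≠ 0)
    (m : ℕ) (G : (Fin m → ι) → ℝ≥0∞) :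
    ∑' v : Σ N : ℕ, (Fin N → ι),
        (if h : m ≤ v.1 then G fun j => v.2 (Fin.castLE h j) else 0) * wordWeight a v.2
      ≤ ∑ x, G x * ∏ j, ((a (x j) / ∑ i, a i : ℝ≥0) : ℝ≥0∞) := by
  set A := ∑ i, a i with hA
  set S := ∑ x, G x * ∏ j, ((a (x j) / A : ℝ≥0) : ℝ≥0∞) with hS
  rw [tsum_words]
  have h1 : ∀ N : ℕ, ∑ x : Fin N → ι,
      (if h : m ≤ N then G fun j => x (Fin.castLE h j) else 0) * wordWeight a x
        ≤ S * poissonMeasure A {N} := by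
    intro N
    by_cases h : m ≤ N
    · obtain ⟨l, rfl⟩ := Nat.exists_eq_add_of_le h
      have h2 : ∀ x : Fin m → ι, G x * ∏ j, (a (x j) : ℝ≥0∞)
          = (A : ℝ≥0∞) ^ m * (G x * ∏ j, ((a (x j) / A : ℝ≥0) : ℝ≥0∞)) := by
        intro x
        have : ∀ j, (a (x j) : ℝ≥0∞) = (A : ℝ≥0∞) * ((a (x j) / A : ℝ≥0) : ℝ≥0∞) := fun j => by
          rw [← ENNReal.coe_mul, mul_div_cancel₀ _ ha]
        rw [Finset.prod_congr rfl fun j _ => this j, Finset.prod_mul_distrib]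
        simp only [Finset.prod_const, Finset.card_univ, Fintype.card_fin]
        ring
      refine le_of_eq ?_
      rw [← (Fin.appendEquiv m l).sum_comp, Fintype.sum_prod_type]
      have h3 : ∀ (u : Fin m → ι) (v : Fin l → ι),
          (if h : m ≤ m + l then G fun j => Fin.appendEquiv m l (u, v) (Fin.castLE h j) else 0)
            * wordWeight a (Fin.appendEquiv m l (u, v))
          = ENNReal.ofReal (Real.exp (-∑ i, (a i : ℝ))) * (((m + l).factorial : ℝ≥0∞)⁻¹ *
            ((G u * ∏ j, (a (u j) : ℝ≥0∞)) * ∏ j, (a (v j) : ℝ≥0∞))) := by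
        intro u v
        rw [dif_pos h]
        have e1 : (fun j => Fin.appendEquiv m l (u, v) (Fin.castLE h j)) = u := by
          funext j
          have : Fin.castLE h j = Fin.castAdd l j := rfl
          rw [this]
          simp [Fin.appendEquiv]
        have e2 : ∏ j, (a (Fin.appendEquiv m l (u, v) j) : ℝ≥0∞)
            = (∏ j, (a (u j) : ℝ≥0∞)) * ∏ j, (a (v j) : ℝ≥0∞) := by
          rw [Fin.prod_univ_add]
          simp [Fin.appendEquiv]
        rw [e1, wordWeight, e2]
        ring
      simp only [h3, ← Finset.mul_sum]
      rw [← Fintype.sum_pow (fun i => (a i : ℝ≥0∞)) l, ← Finset.sum_mul,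
        Finset.sum_congr rfl fun x _ => h2 x,
        ← Finset.mul_sum, ← hS, poissonMeasure_singleton_eq, hA]
      push_cast
      ring
    · simp [h]
  refine (ENNReal.tsum_le_tsum h1).trans ?_
  rw [ENNReal.tsum_mul_left]
  have := lintegral_countable' (μ := poissonMeasure A) fun _ => 1
  simp only [lintegral_const, measure_univ, mul_one, one_mul] at this
  rw [← this, mul_one]

/-- The test `φ` applied to the first `m` letters of two words; it accepts nothing if one of them is
shorter. -/
noncomputable def prefixTest {ι : Type*} {m : ℕ} (φ : (Fin m → ι) → (Fin m → ι) → ℝ≥0∞)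
    (v w : Σ N : ℕ, (Fin N → ι)) : ℝ≥0∞ :=
  if h : m ≤ v.1 then if h' : m ≤ w.1 then
    φ (fun j => v.2 (Fin.castLE h j)) fun j => w.2 (Fin.castLE h' j) else 0 else 0

theorem tsum_prefixTest_le {ι : Type*} [Fintype ι] (a b : ι → ℝ≥0) (ha : ∑ i, a i ≠ 0)
    (hb : ∑ i, b i ≠ 0) {m : ℕ} (φ : (Fin m → ι) → (Fin m → ι) → ℝ≥0∞) :
    ∑' ω : (Σ N : ℕ, (Fin N → ι)) × (Σ N : ℕ, (Fin N → ι)),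
        prefixTest φ ω.1 ω.2 * (wordWeight a ω.1.2 * wordWeight b ω.2.2)
      ≤ ∑ x, ∑ y, φ x y * ((∏ j, ((a (x j) / ∑ i, a i : ℝ≥0) : ℝ≥0∞)) *
          ∏ j, ((b (y j) / ∑ i, b i : ℝ≥0) : ℝ≥0∞)) := by
  set G : (Fin m → ι) → ℝ≥0∞ := fun x =>
    ∑ y, φ x y * ∏ j, ((b (y j) / ∑ i, b i : ℝ≥0) : ℝ≥0∞) with hG
  calc _ = ∑' v : Σ N : ℕ, (Fin N → ι), ∑' w : Σ N : ℕ, (Fin N → ι),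
          prefixTest φ v w * (wordWeight a v.2 * wordWeight b w.2) := ENNReal.tsum_prod'
    _ ≤ ∑' v : Σ N : ℕ, (Fin N → ι),
          (if h : m ≤ v.1 then G fun j => v.2 (Fin.castLE h j) else 0) * wordWeight a v.2 := by
        refine ENNReal.tsum_le_tsum fun v => ?_
        by_cases h : m ≤ v.1
        · simp only [prefixTest, dif_pos h]
          have h1 := tsum_wordWeight_prefix_le b hb m (φ fun j => v.2 (Fin.castLE h j))
          rw [mul_comm]
          refine le_trans (le_of_eq ?_) (mul_le_mul_right h1 (wordWeight a v.2))
          rw [← ENNReal.tsum_mul_left]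
          exact tsum_congr fun w => by ring
        · simp [prefixTest, h]
    _ ≤ ∑ x, G x * ∏ j, ((a (x j) / ∑ i, a i : ℝ≥0) : ℝ≥0∞) := tsum_wordWeight_prefix_le a ha m G
    _ = _ := by
        refine Finset.sum_congr rfl fun x _ => ?_
        rw [hG, Finset.sum_mul]
        exact Finset.sum_congr rfl fun y _ => by ring

/-- The error of `prefixTest` of the second kind: besides the error of the original test, one of the
two samples may be too short. -/
theorem tsum_one_sub_prefixTest_le {ι : Type*} [Fintype ι] (a b : ι → ℝ≥0) (ha : ∑ i, a i ≠ 0)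
    (hb : ∑ i, b i ≠ 0) {m : ℕ} (φ φ' : (Fin m → ι) → (Fin m → ι) → ℝ≥0∞)
    (hφ : ∀ x y, φ x y + φ' x y = 1) :
    ∑' ω : (Σ N : ℕ, (Fin N → ι)) × (Σ N : ℕ, (Fin N → ι)),
        (1 - prefixTest φ ω.1 ω.2) * (wordWeight a ω.1.2 * wordWeight b ω.2.2)
      ≤ ∑ x, ∑ y, φ' x y * ((∏ j, ((a (x j) / ∑ i, a i : ℝ≥0) : ℝ≥0∞)) *
          ∏ j, ((b (y j) / ∑ i, b i : ℝ≥0) : ℝ≥0∞))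
        + (ENNReal.ofReal (2 ^ m * Real.exp (-((∑ i, (a i : ℝ)) / 2)))
          + ENNReal.ofReal (2 ^ m * Real.exp (-((∑ i, (b i : ℝ)) / 2)))) := by
  have hpt : ∀ v w : Σ N : ℕ, (Fin N → ι), 1 - prefixTest φ v w
      ≤ prefixTest φ' v w + ((if m ≤ v.1 then 0 else 1) + if m ≤ w.1 then 0 else 1) := by
    intro v w
    by_cases h : m ≤ v.1
    · by_cases h' : m ≤ w.1
      · simp only [prefixTest, dif_pos h, dif_pos h', if_pos h, if_pos h', add_zero]
        rw [tsub_le_iff_left, hφ]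
      · simp [prefixTest, h, h']
    · by_cases h' : m ≤ w.1 <;> simp [prefixTest, h, h']
  calc _ ≤ ∑' ω : (Σ N : ℕ, (Fin N → ι)) × (Σ N : ℕ, (Fin N → ι)),
        (prefixTest φ' ω.1 ω.2 * (wordWeight a ω.1.2 * wordWeight b ω.2.2)
          + (((if m ≤ ω.1.1 then 0 else 1) * wordWeight a ω.1.2) * wordWeight b ω.2.2
            + wordWeight a ω.1.2 * ((if m ≤ ω.2.1 then 0 else 1) * wordWeight b ω.2.2))) := by
        refine ENNReal.tsum_le_tsum fun ω => ?_
        refine (mul_le_mul_left (hpt ω.1 ω.2) _).trans (le_of_eq (by ring))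
    _ = ∑' ω : (Σ N : ℕ, (Fin N → ι)) × (Σ N : ℕ, (Fin N → ι)),
          prefixTest φ' ω.1 ω.2 * (wordWeight a ω.1.2 * wordWeight b ω.2.2)
        + ((∑' v : Σ N : ℕ, (Fin N → ι), (if m ≤ v.1 then 0 else 1) * wordWeight a v.2)
          + ∑' v : Σ N : ℕ, (Fin N → ι), (if m ≤ v.1 then 0 else 1) * wordWeight b v.2) := by
        rw [ENNReal.tsum_add, ENNReal.tsum_add, ENNReal.tsum_prod' (f := fun ω :
            (Σ N : ℕ, (Fin N → ι)) × (Σ N : ℕ, (Fin N → ι)) =>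
            (((if m ≤ ω.1.1 then 0 else 1) * wordWeight a ω.1.2) * wordWeight b ω.2.2)),
          ENNReal.tsum_prod' (f := fun ω :
            (Σ N : ℕ, (Fin N → ι)) × (Σ N : ℕ, (Fin N → ι)) =>
            wordWeight a ω.1.2 * ((if m ≤ ω.2.1 then 0 else 1) * wordWeight b ω.2.2))]
        have t1 : ∀ v : Σ N : ℕ, (Fin N → ι), ∑' w : Σ N : ℕ, (Fin N → ι),
            ((if m ≤ v.1 then (0 : ℝ≥0∞) else 1) * wordWeight a v.2) * wordWeight b w.2
              = (if m ≤ v.1 then 0 else 1) * wordWeight a v.2 := fun v => by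
          rw [ENNReal.tsum_mul_left, tsum_wordWeight, mul_one]
        have t2 : ∑' v : Σ N : ℕ, (Fin N → ι), ∑' w : Σ N : ℕ, (Fin N → ι),
            wordWeight a v.2 * ((if m ≤ w.1 then (0 : ℝ≥0∞) else 1) * wordWeight b w.2)
              = ∑' w : Σ N : ℕ, (Fin N → ι), (if m ≤ w.1 then 0 else 1) * wordWeight b w.2 := by
          simp_rw [ENNReal.tsum_mul_left]
          rw [ENNReal.tsum_mul_right, tsum_wordWeight, one_mul]
        rw [t2, tsum_congr t1]
    _ ≤ _ := by
        gcongr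
        · exact tsum_prefixTest_le a b ha hb φ'
        · exact tsum_wordWeight_short_le a m
        · exact tsum_wordWeight_short_le b m

/-! ### Mixtures of Poissonized pairs -/

/-- Intensities on the alphabet `Option (Fin K)`: a dummy letter of intensity `D`, and the letter
`i` of intensity `lam (s i)`, where `s i` is its state. -/
def mixRate {τ : Type*} {K : ℕ} (D : ℝ≥0) (lam : τ → ℝ≥0) (s : Fin K → τ) : Option (Fin K) → ℝ≥0
  | none => D
  | some i => lam (s i)

theorem sum_mixRate {τ : Type*} {K : ℕ} (D : ℝ≥0) (lam : τ → ℝ≥0) (s : Fin K → τ) :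
    ∑ o, mixRate D lam s o = D + ∑ i, lam (s i) := by
  rw [Fintype.sum_option]
  rfl

/-- The density of a pair of Poissonized samples whose letters have independent random states with
weights `w`, and intensities `lam` and `mu` depending on these states. -/
noncomputable def mixWeight {τ : Type*} [Fintype τ] {K : ℕ} (w lam mu : τ → ℝ≥0) (D : ℝ≥0)
    (ω : (Σ N : ℕ, (Fin N → Option (Fin K))) × (Σ N : ℕ, (Fin N → Option (Fin K)))) : ℝ≥0∞ :=
  ∑ s : Fin K → τ, (∏ i, (w (s i) : ℝ≥0∞)) *
    (wordWeight (mixRate D lam s) ω.1.2 * wordWeight (mixRate D mu s) ω.2.2)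

/-- `a!` times the probability of `a` under the Poisson distribution with mean `r`. -/
noncomputable def poissonTerm (r : ℝ≥0) (a : ℕ) : ℝ≥0∞ :=
  ENNReal.ofReal (Real.exp (-r)) * (r : ℝ≥0∞) ^ a

theorem tsum_poissonTerm (r : ℝ≥0) :
    ∑' a : ℕ, (a.factorial : ℝ≥0∞)⁻¹ * poissonTerm r a = 1 := by
  have h := lintegral_countable' (μ := poissonMeasure r) fun _ => 1
  simp only [lintegral_const, measure_univ, mul_one, one_mul] at h
  rw [h]
  refine tsum_congr fun a => ?_
  rw [poissonMeasure_singleton_eq, poissonTerm]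
  ring

/-- The factor of `mixWeight` that belongs to a letter with `a` and `b` occurrences in the two
samples, without the factorials. -/
noncomputable def mixCell {τ : Type*} [Fintype τ] (w lam mu : τ → ℝ≥0) (a b : ℕ) : ℝ≥0∞ :=
  ∑ t, (w t : ℝ≥0∞) * (poissonTerm (lam t) a * poissonTerm (mu t) b)

/-- The sum of `F a b / (a! * b!)` over all `a` and `b`. -/
noncomputable def factorialSum (F : ℕ → ℕ → ℝ≥0∞) : ℝ≥0∞ :=
  ∑' a : ℕ, (a.factorial : ℝ≥0∞)⁻¹ * ∑' b : ℕ, (b.factorial : ℝ≥0∞)⁻¹ * F a b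

theorem factorialSum_mono {F G : ℕ → ℕ → ℝ≥0∞} (h : ∀ a b, F a b ≤ G a b) :
    factorialSum F ≤ factorialSum G := by
  unfold factorialSum
  gcongr
  exact h _ _

theorem factorialSum_add (F G : ℕ → ℕ → ℝ≥0∞) :
    factorialSum (fun a b => F a b + G a b) = factorialSum F + factorialSum G := by
  simp only [factorialSum, mul_add, ENNReal.tsum_add]

theorem factorialSum_mul (F G : ℕ → ℝ≥0∞) :
    factorialSum (fun a b => F a * G b) = (∑' a : ℕ, (a.factorial : ℝ≥0∞)⁻¹ * F a) *
      ∑' b : ℕ, (b.factorial : ℝ≥0∞)⁻¹ * G b := by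
  unfold factorialSum
  rw [← ENNReal.tsum_mul_right]
  refine tsum_congr fun a => ?_
  rw [mul_assoc, ← ENNReal.tsum_mul_left (a := F a)]
  congr 1
  exact tsum_congr fun b => by ring

theorem factorialSum_const_mul (c : ℝ≥0∞) (F : ℕ → ℕ → ℝ≥0∞) :
    factorialSum (fun a b => c * F a b) = c * factorialSum F := by
  unfold factorialSum
  rw [← ENNReal.tsum_mul_left]
  refine tsum_congr fun a => ?_
  rw [mul_left_comm c, ← ENNReal.tsum_mul_left (a := c)]
  congr 1
  exact tsum_congr fun b => by ring

theorem factorialSum_const (c : ℝ≥0∞) :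
    factorialSum (fun _ _ => c) = c * ENNReal.ofReal (Real.exp 2) := by
  have h := factorialSum_mul (fun _ => c) fun _ => 1
  simp only [mul_one] at h
  have h1 := tsum_inv_factorial_mul_pow 1
  simp only [ENNReal.coe_one, one_pow, mul_one, NNReal.coe_one] at h1
  rw [h, ENNReal.tsum_mul_right, h1, show (2 : ℝ) = 1 + 1 by norm_num, Real.exp_add,
    ENNReal.ofReal_mul (Real.exp_pos 1).le]
  ring

theorem factorialSum_mixCell {τ : Type*} [Fintype τ] (w lam mu : τ → ℝ≥0) (hw : ∑ t, w t = 1) :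
    factorialSum (mixCell w lam mu) = 1 := by
  have h : ∀ S : Finset τ, factorialSum (fun a b =>
      ∑ t ∈ S, (w t : ℝ≥0∞) * (poissonTerm (lam t) a * poissonTerm (mu t) b))
        = ∑ t ∈ S, (w t : ℝ≥0∞) := by
    classical
    intro S
    induction S using Finset.induction_on with
    | empty => simp [factorialSum]
    | insert t S ht ih =>
      simp only [Finset.sum_insert ht]
      rw [factorialSum_add, ih, factorialSum_const_mul, factorialSum_mul, tsum_poissonTerm,
        tsum_poissonTerm, mul_one, mul_one]
  have h1 := h Finset.univ
  rw [← ENNReal.ofNNReal_finsetSum, hw, ENNReal.coe_one] at h1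
  exact h1

/-- A function of two words that is a product of factors of the letter counts: `F` for the dummy
letter and `G` for all others. -/
noncomputable def cellProduct {K : ℕ} (F G : ℕ → ℕ → ℝ≥0∞)
    (ω : (Σ N : ℕ, (Fin N → Option (Fin K))) × (Σ N : ℕ, (Fin N → Option (Fin K)))) : ℝ≥0∞ :=
  (ω.1.1.factorial : ℝ≥0∞)⁻¹ * ((ω.2.1.factorial : ℝ≥0∞)⁻¹ *
    (F (letterCount ω.1.2 none) (letterCount ω.2.2 none) *
      ∏ i, G (letterCount ω.1.2 (some i)) (letterCount ω.2.2 (some i))))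

theorem tsum_cellProduct {K : ℕ} (F G : ℕ → ℕ → ℝ≥0∞) :
    ∑' ω, cellProduct (K := K) F G ω = factorialSum F * factorialSum G ^ K := by
  let r : Option (Fin K) → ℕ → ℕ → ℝ≥0∞ := fun o => o.elim F fun _ => G
  have h := tsum_prod_words r
  simp only [Fintype.prod_option] at h
  refine h.trans ?_
  simp [r, factorialSum]

/-- Averaging over independent states leaves the letters independent. -/
theorem mixWeight_eq {τ : Type*} [Fintype τ] {K : ℕ} (w lam mu : τ → ℝ≥0) (D : ℝ≥0)
    (ω : (Σ N : ℕ, (Fin N → Option (Fin K))) × (Σ N : ℕ, (Fin N → Option (Fin K)))) :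
    mixWeight w lam mu D ω
      = cellProduct (fun a b => poissonTerm D a * poissonTerm D b) (mixCell w lam mu) ω := by
  classical
  simp only [mixWeight, cellProduct, mixCell, Finset.prod_univ_sum, Finset.mul_sum,
    Fintype.piFinset_univ]
  refine Finset.sum_congr rfl fun s _ => ?_
  rw [wordWeight_eq, wordWeight_eq, Fintype.prod_option, Fintype.prod_option]
  simp only [Finset.prod_mul_distrib, mixRate, poissonTerm]
  ring

theorem tsum_mixWeight {τ : Type*} [Fintype τ] {K : ℕ} (w lam mu : τ → ℝ≥0) (D : ℝ≥0)
    (hw : ∑ t, w t = 1) : ∑' ω, mixWeight (K := K) w lam mu D ω = 1 := by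
  simp only [mixWeight_eq]
  rw [tsum_cellProduct, factorialSum_mul, tsum_poissonTerm, factorialSum_mixCell w lam mu hw]
  simp

/-- Expectations under a mixture are averages over the states. -/
theorem tsum_mul_mixWeight {τ : Type*} [Fintype τ] {K : ℕ} (w lam mu : τ → ℝ≥0) (D : ℝ≥0)
    (F : (Σ N : ℕ, (Fin N → Option (Fin K))) × (Σ N : ℕ, (Fin N → Option (Fin K))) → ℝ≥0∞) :
    ∑' ω, F ω * mixWeight w lam mu D ω = ∑ s : Fin K → τ, (∏ i, (w (s i) : ℝ≥0∞)) *
      ∑' ω, F ω * (wordWeight (mixRate D lam s) ω.1.2 * wordWeight (mixRate D mu s) ω.2.2) := by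
  simp only [mixWeight, Finset.mul_sum]
  rw [Summable.tsum_finsetSum fun _ _ => ENNReal.summable]
  refine Finset.sum_congr rfl fun s _ => ?_
  rw [← ENNReal.tsum_mul_left]
  exact tsum_congr fun ω => by ring

/-- A bound for the density ratio of the cells bounds the second moment of the likelihood ratio of
two mixtures. The hypothesis `h` bounds `(g₁ - g₀)² / g₀` for the cells `g₀` and `g₁`, written
without subtraction. -/
theorem exists_sq_mixWeight_le {τ : Type*} [Fintype τ] {K : ℕ} (w lam₀ mu₀ lam₁ mu₁ : τ → ℝ≥0)
    (D : ℝ≥0) (hw : ∑ t, w t = 1) (hpos : ∀ a b, mixCell w lam₀ mu₀ a b ≠ 0)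
    (χ : ℝ) (hχ : 0 ≤ χ)
    (h : ∀ a b, mixCell w lam₁ mu₁ a b ^ 2 / mixCell w lam₀ mu₀ a b + mixCell w lam₀ mu₀ a b
      ≤ 2 * mixCell w lam₁ mu₁ a b + ENNReal.ofReal χ) :
    ∃ ρ : (Σ N : ℕ, (Fin N → Option (Fin K))) × (Σ N : ℕ, (Fin N → Option (Fin K))) → ℝ≥0∞,
      (∀ ω, mixWeight w lam₁ mu₁ D ω ^ 2 ≤ ρ ω * mixWeight w lam₀ mu₀ D ω) ∧
      ∑' ω, ρ ω ≤ ENNReal.ofReal (Real.exp (K * (χ * Real.exp 2))) := by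
  refine ⟨cellProduct (fun a b => poissonTerm D a * poissonTerm D b) fun a b =>
    mixCell w lam₁ mu₁ a b ^ 2 / mixCell w lam₀ mu₀ a b, fun ω => ?_, ?_⟩
  · have htop : ∀ a b, mixCell w lam₀ mu₀ a b ≠ ∞ := fun a b =>
      ENNReal.sum_ne_top.2 fun t _ => ENNReal.mul_ne_top ENNReal.coe_ne_top
        (ENNReal.mul_ne_top (ENNReal.mul_ne_top ENNReal.ofReal_ne_top
          (ENNReal.pow_ne_top ENNReal.coe_ne_top)) (ENNReal.mul_ne_top ENNReal.ofReal_ne_top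
          (ENNReal.pow_ne_top ENNReal.coe_ne_top)))
    rw [mixWeight_eq, mixWeight_eq]
    unfold cellProduct
    simp only [mul_pow, ← Finset.prod_pow]
    rw [Finset.prod_congr rfl fun i _ => (ENNReal.div_mul_cancel
      (hpos (letterCount ω.1.2 (some i)) (letterCount ω.2.2 (some i))) (htop _ _)).symm,
      Finset.prod_mul_distrib]
    refine le_of_eq ?_
    ring
  · rw [tsum_cellProduct, factorialSum_mul, tsum_poissonTerm, one_mul, one_mul]
    have h2 := factorialSum_mono h
    rw [factorialSum_add, factorialSum_add, factorialSum_const_mul, factorialSum_const,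
      factorialSum_mixCell w _ _ hw, factorialSum_mixCell w _ _ hw,
      ← ENNReal.ofReal_mul hχ, mul_one,
      show 2 + ENNReal.ofReal (χ * Real.exp 2) = 1 + ENNReal.ofReal (χ * Real.exp 2) + 1 by
        rw [← one_add_one_eq_two]; ring] at h2
    have h3 := ENNReal.le_of_add_le_add_right ENNReal.one_ne_top h2
    calc _ ≤ (1 + ENNReal.ofReal (χ * Real.exp 2)) ^ K := by gcongr
      _ = ENNReal.ofReal ((1 + χ * Real.exp 2) ^ K) := by
        rw [ENNReal.ofReal_pow (by positivity), ENNReal.ofReal_add zero_le_one (by positivity),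
          ENNReal.ofReal_one]
      _ ≤ _ := by
        refine ENNReal.ofReal_le_ofReal ?_
        rw [Real.exp_nat_mul]
        gcongr
        linarith [Real.add_one_le_exp (χ * Real.exp 2)]

/-! ### A prior with a few heavy letters -/

/-- Weights of the states of a letter: `none` for a heavy letter, with weight `θ`, and `some b` for
a light letter with label `b`. -/
noncomputable def stateWeight (θ : ℝ≥0) : Option Bool → ℝ≥0
  | none => θ
  | some _ => (1 - θ) / 2

/-- Intensities under the null hypothesis, the same in both samples: `1` for heavy letters and `β`
for light ones. -/
def nullRate (β : ℝ≥0) : Option Bool → ℝ≥0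
  | none => 1
  | some _ => β

/-- Intensities under the alternative: `1` for heavy letters, while the intensity of a light letter
is `2 * β` in the sample that is selected by the label, and `0` in the other one. -/
def altRate (β : ℝ≥0) (c : Bool) : Option Bool → ℝ≥0
  | none => 1
  | some b => if b = c then 2 * β else 0

theorem sum_stateWeight {θ : ℝ≥0} (hθ : θ ≤ 1) : ∑ t, stateWeight θ t = 1 := by
  simp only [Fintype.sum_option, Fintype.sum_bool, stateWeight]
  rw [add_halves, add_tsub_cancel_of_le hθ]

theorem coe_stateWeight_some {θ : ℝ≥0} (hθ : θ ≤ 1) (b : Bool) :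
    (stateWeight θ (some b) : ℝ) = (1 - θ) / 2 := by
  simp [stateWeight, NNReal.coe_sub hθ]

theorem mixCell_eq_ofReal {τ : Type*} [Fintype τ] (w lam mu : τ → ℝ≥0) (a b : ℕ) :
    mixCell w lam mu a b = ENNReal.ofReal (∑ t, w t * ((Real.exp (-lam t) * lam t ^ a) *
      (Real.exp (-mu t) * mu t ^ b))) := by
  rw [mixCell, ENNReal.ofReal_sum_of_nonneg fun t _ => by positivity]
  refine Finset.sum_congr rfl fun t _ => ?_
  rw [poissonTerm, poissonTerm, ENNReal.ofReal_mul (by positivity),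
    ENNReal.ofReal_mul (by positivity),
    ENNReal.ofReal_mul (Real.exp_pos _).le, ENNReal.ofReal_mul (Real.exp_pos _).le,
    ENNReal.ofReal_pow (by positivity), ENNReal.ofReal_pow (by positivity)]
  simp only [ENNReal.ofReal_coe_nnreal]

/-- The moments of order at most one of the light intensities agree under both hypotheses, so that
the difference of the cells starts with terms of order `β²`. -/
theorem abs_half_sub_pow_le {β : ℝ} (h0 : 0 ≤ β) (h1 : β ≤ 1 / 2) (a b : ℕ) :
    |((2 * β) ^ a * 0 ^ b + 0 ^ a * (2 * β) ^ b) / 2 - β ^ (a + b)| ≤ (2 * β) ^ 2 := by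
  have h2 : ∀ n, (2 * β) ^ (n + 2) ≤ (2 * β) ^ 2 := fun n =>
    pow_le_pow_of_le_one (by positivity) (by linarith) (by omega)
  have h3 : ∀ n, β ^ (n + 2) ≤ (2 * β) ^ 2 := fun n =>
    (pow_le_pow_left₀ h0 (by linarith) _).trans (h2 n)
  have h4 : ∀ n, 0 ≤ β ^ (n + 2) := fun n => by positivity
  have h5 : ∀ n, 0 ≤ (2 * β) ^ (n + 2) := fun n => by positivity
  have h6 : 0 ≤ (2 * β) ^ 2 := by positivity
  match a, b with
  | 0, 0 => norm_num; positivity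
  | 0, 1 => norm_num; positivity
  | 1, 0 => norm_num; positivity
  | 0, n + 2 =>
    have := h2 n; have := h3 n; have := h4 n; have := h5 n
    rw [zero_pow (n := n + 2) (by omega), zero_add, pow_zero, pow_zero, abs_le]
    constructor <;> linarith
  | n + 2, 0 =>
    have := h2 n; have := h3 n; have := h4 n; have := h5 n
    rw [zero_pow (n := n + 2) (by omega), add_zero, pow_zero, pow_zero, abs_le]
    constructor <;> linarith
  | n + 1, l + 1 =>
    have := h3 (n + l); have := h4 (n + l)
    rw [zero_pow (by omega), zero_pow (by omega), show n + 1 + (l + 1) = n + l + 2 by ring, abs_le]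
    constructor <;> linarith

/-- The heavy letters keep the null density away from zero, which bounds the likelihood ratio. -/
theorem mixCell_sq_div_add_le {θ β : ℝ≥0} (hθ0 : 0 < θ) (hθ : θ ≤ 1) (hβ : (β : ℝ) ≤ 1 / 2)
    (a b : ℕ) :
    mixCell (stateWeight θ) (nullRate β) (nullRate β) a b ≠ 0 ∧
    mixCell (stateWeight θ) (altRate β true) (altRate β false) a b ^ 2 /
        mixCell (stateWeight θ) (nullRate β) (nullRate β) a b +
        mixCell (stateWeight θ) (nullRate β) (nullRate β) a b
      ≤ 2 * mixCell (stateWeight θ) (altRate β true) (altRate β false) a b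
        + ENNReal.ofReal (16 * β ^ 4 * Real.exp 2 / θ) := by
  have hθ' : (θ : ℝ) ≤ 1 := hθ
  have hθ0' : (0 : ℝ) < θ := hθ0
  have hβ0 : (0 : ℝ) ≤ β := β.2
  set E := Real.exp (-(2 * (β : ℝ))) with hE
  have hE0 : 0 < E := Real.exp_pos _
  have hE1 : E ≤ 1 := Real.exp_le_one_iff.2 (by linarith)
  have hee : Real.exp (-1) * Real.exp (-1) = Real.exp (-2) := by rw [← Real.exp_add]; norm_num
  have hEE : Real.exp (-(β : ℝ)) * Real.exp (-(β : ℝ)) = E := by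
    rw [← Real.exp_add, hE]; congr 1; ring
  have e0 : mixCell (stateWeight θ) (nullRate β) (nullRate β) a b
      = ENNReal.ofReal (θ * Real.exp (-2) + (1 - θ) * E * β ^ (a + b)) := by
    rw [mixCell_eq_ofReal]
    congr 1
    simp only [Fintype.sum_option, Fintype.sum_bool, coe_stateWeight_some hθ, nullRate]
    rw [← hEE, ← hee, pow_add]
    simp only [stateWeight, NNReal.coe_one, one_pow]
    ring
  have e1 : mixCell (stateWeight θ) (altRate β true) (altRate β false) a b
      = ENNReal.ofReal (θ * Real.exp (-2) + (1 - θ) * E *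
        (((2 * β) ^ a * 0 ^ b + 0 ^ a * (2 * β) ^ b) / 2)) := by
    rw [mixCell_eq_ofReal]
    congr 1
    simp only [Fintype.sum_option, Fintype.sum_bool, coe_stateWeight_some hθ, altRate]
    rw [← hee]
    simp only [stateWeight, NNReal.coe_one, one_pow, if_true, Bool.false_eq_true, if_false,
      Bool.true_eq_false, NNReal.coe_zero, neg_zero, Real.exp_zero, NNReal.coe_mul,
      NNReal.coe_ofNat, ← hE]
    ring
  have hx := abs_half_sub_pow_le hβ0 hβ a b
  rw [e0, e1]
  set x := ((2 * (β : ℝ)) ^ a * 0 ^ b + 0 ^ a * (2 * β) ^ b) / 2 with hxdef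
  set y := (β : ℝ) ^ (a + b) with hydef
  have hx0 : 0 ≤ x := by positivity
  have hy0 : 0 ≤ y := by positivity
  have hc0 : 0 ≤ (1 - θ) * E := mul_nonneg (by linarith) hE0.le
  have hc1 : (1 - θ) * E ≤ 1 := mul_le_one₀ (by linarith) hE0.le hE1
  set c := (1 - (θ : ℝ)) * E with hc
  have hd : 0 < θ * Real.exp (-2) := by positivity
  set d := θ * Real.exp (-2) with hddef
  have hG0 : 0 < d + c * y := by positivity
  have hG1 : 0 < d + c * x := by positivity
  refine ⟨(ENNReal.ofReal_pos.2 hG0).ne', ?_⟩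
  rw [← ENNReal.ofReal_pow hG1.le, ← ENNReal.ofReal_div_of_pos hG0,
    ← ENNReal.ofReal_add (by positivity) hG0.le, ← ENNReal.ofReal_ofNat 2,
    ← ENNReal.ofReal_mul zero_le_two, ← ENNReal.ofReal_add (by positivity) (by positivity)]
  refine ENNReal.ofReal_le_ofReal ?_
  have h1 : (d + c * x) ^ 2 / (d + c * y) + (d + c * y)
      = 2 * (d + c * x) + (c * (x - y)) ^ 2 / (d + c * y) := by
    field_simp
    ring
  have h2 : (c * (x - y)) ^ 2 ≤ 16 * β ^ 4 := by
    have : |c * (x - y)| ≤ (2 * β) ^ 2 := by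
      rw [abs_mul, abs_of_nonneg hc0]
      calc c * |x - y| ≤ 1 * (2 * β) ^ 2 := by gcongr
        _ = _ := one_mul _
    calc (c * (x - y)) ^ 2 = |c * (x - y)| ^ 2 := (sq_abs _).symm
      _ ≤ ((2 * β) ^ 2) ^ 2 := by gcongr
      _ = _ := by ring
  have h3 : 16 * β ^ 4 / d = 16 * β ^ 4 * Real.exp 2 / θ := by
    rw [hddef, Real.exp_neg]
    field_simp
  rw [h1, ← h3]
  gcongr
  linarith [mul_nonneg hc0 hy0]

theorem sum_prod_comp {τ : Type*} [Fintype τ] (K : ℕ) (w u : τ → ℝ) :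
    ∑ s : Fin K → τ, (∏ i, w (s i)) * ∏ i, u (s i) = (∑ t, w t * u t) ^ K := by
  simp only [← Finset.prod_mul_distrib]
  exact (Fintype.sum_pow (fun t => w t * u t) K).symm

theorem sum_prod_mul_sum {τ : Type*} [Fintype τ] (K : ℕ) (w u : τ → ℝ) (hw : ∑ t, w t = 1) :
    ∑ s : Fin K → τ, (∏ i, w (s i)) * ∑ i, u (s i) = K * ∑ t, w t * u t := by
  classical
  simp only [Finset.mul_sum]
  rw [Finset.sum_comm]
  have h : ∀ i : Fin K, ∑ s : Fin K → τ, (∏ j, w (s j)) * u (s i) = ∑ t, w t * u t := by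
    intro i
    have h1 : ∀ s : Fin K → τ, (∏ j, w (s j)) * u (s i)
        = ∏ j, (w (s j) * if j = i then u (s j) else 1) := fun s => by
      rw [Finset.prod_mul_distrib, Finset.prod_ite_eq' Finset.univ i fun j => u (s j)]
      simp
    simp only [h1]
    have h2 := Finset.prod_univ_sum (fun _ : Fin K => (Finset.univ : Finset τ))
      fun j t => w t * if j = i then u t else 1
    rw [Fintype.piFinset_univ] at h2
    rw [← h2, Finset.prod_eq_single i]
    · simp
    · intro j _ hj
      simp [hj, hw]
    · simp
  simp [h, Finset.mul_sum]

/-- Indicator of heavy letters. -/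
def heavyInd : Option Bool → ℝ
  | none => 1
  | some _ => 0

/-- Indicator of light letters with label `true`. -/
def plusInd : Option Bool → ℝ
  | none => 0
  | some b => if b then 1 else 0

theorem sum_heavyInd (θ : ℝ≥0) : ∑ t, (stateWeight θ t : ℝ) * heavyInd t = θ := by
  simp [Fintype.sum_option, heavyInd, stateWeight]

/-- It is exponentially unlikely that fewer than an eighth of the letters are light with label
`true`. -/
theorem plusInd_tilt_le {θ : ℝ≥0} (hθ : (θ : ℝ) ≤ 1 / 32) :
    Real.exp (1 / 8) * ∑ t, (stateWeight θ t : ℝ) * Real.exp (-plusInd t) ≤ 7 / 8 := by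
  have hθ1 : θ ≤ 1 := by
    rw [← NNReal.coe_le_coe, NNReal.coe_one]
    linarith
  simp only [Fintype.sum_option, Fintype.sum_bool, coe_stateWeight_some hθ1, plusInd]
  simp only [stateWeight, neg_zero, Real.exp_zero, if_true, Bool.false_eq_true, if_false]
  have h1 : Real.exp (-1) ≤ 3 / 8 := by
    rw [Real.exp_neg, inv_le_comm₀ (Real.exp_pos _) (by norm_num)]
    linarith [Real.exp_one_gt_d9]
  have h2 : Real.exp (1 / 8) ≤ 8 / 7 := by
    have h := Real.add_one_le_exp (-(1 / 8) : ℝ)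
    rw [Real.exp_neg] at h
    have h3 := Real.exp_pos (1 / 8)
    rw [le_inv_comm₀ (by norm_num) h3] at h
    norm_num at h ⊢
    exact h
  have h0 : (0 : ℝ) ≤ θ := θ.2
  have h3 := Real.exp_pos (-1)
  obtain ⟨u, hu⟩ : ∃ u, u = (1 - (θ : ℝ)) / 2 := ⟨_, rfl⟩
  have hu0 : 0 ≤ u := by linarith
  rw [← hu]
  calc _ ≤ 8 / 7 * ((θ : ℝ) * 1 + (u * (3 / 8) + u * 1)) := by
        gcongr
    _ ≤ 7 / 8 := by linarith

/-- The total intensity of one sample is rarely small under the alternative. -/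
theorem altRate_tilt_le {θ β : ℝ≥0} (hθ : (θ : ℝ) ≤ 1 / 32) (hβ : (β : ℝ) ≤ 1 / 2) (c : Bool) :
    ∑ t, (stateWeight θ t : ℝ) * Real.exp (-(altRate β c t / 2)) ≤ Real.exp (-(β / 8)) := by
  have hθ1 : θ ≤ 1 := by
    rw [← NNReal.coe_le_coe, NNReal.coe_one]
    linarith
  have h0 : (0 : ℝ) ≤ θ := θ.2
  have hβ0 : (0 : ℝ) ≤ β := β.2
  have h1 : Real.exp (-(1 / 2)) ≤ 1 := Real.exp_le_one_iff.2 (by norm_num)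
  have h2 : Real.exp (-(β : ℝ)) ≤ 1 - β / 2 := by
    have h := Real.quadratic_le_exp_of_nonneg hβ0
    rw [Real.exp_neg, inv_le_comm₀ (Real.exp_pos _) (by linarith)]
    refine le_trans ?_ h
    rw [inv_le_iff_one_le_mul₀ (by linarith)]
    nlinarith [mul_nonneg hβ0 hβ0]
  have h3 : ∑ t, (stateWeight θ t : ℝ) * Real.exp (-(altRate β c t / 2))
      = θ * Real.exp (-(1 / 2)) + (1 - θ) / 2 * (Real.exp (-β) + 1) := by
    simp only [Fintype.sum_option, Fintype.sum_bool, coe_stateWeight_some hθ1, altRate]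
    cases c <;> simp [stateWeight] <;> ring
  rw [h3]
  calc _ ≤ (θ : ℝ) * 1 + (1 - θ) / 2 * ((1 - β / 2) + 1) := by
        gcongr
        linarith
    _ = 1 - (1 - θ) / 4 * β := by ring
    _ ≤ -(β / 8) + 1 := by nlinarith
    _ ≤ _ := Real.add_one_le_exp _

theorem altRate_true_eq (β : ℝ≥0) (t : Option Bool) :
    (altRate β true t : ℝ) = heavyInd t + 2 * β * plusInd t := by
  match t with
  | none => simp [altRate, heavyInd, plusInd]
  | some true => simp [altRate, heavyInd, plusInd]
  | some false => simp [altRate, heavyInd, plusInd]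

theorem coe_sum_mixRate {τ : Type*} {K : ℕ} (D : ℝ≥0) (lam : τ → ℝ≥0) (s : Fin K → τ) :
    ∑ o, (mixRate D lam s o : ℝ) = D + ∑ i, (lam (s i) : ℝ) := by
  rw [← NNReal.coe_sum, sum_mixRate]
  push_cast
  rfl

theorem tsum_pair_wordWeight {ι : Type*} [Fintype ι] (a b : ι → ℝ≥0) :
    ∑' ω : (Σ N : ℕ, (Fin N → ι)) × (Σ N : ℕ, (Fin N → ι)),
      wordWeight a ω.1.2 * wordWeight b ω.2.2 = 1 := by
  rw [ENNReal.tsum_prod' (f := fun ω : (Σ N : ℕ, (Fin N → ι)) × (Σ N : ℕ, (Fin N → ι)) =>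
    wordWeight a ω.1.2 * wordWeight b ω.2.2)]
  simp_rw [ENNReal.tsum_mul_left, tsum_wordWeight, mul_one]
  exact tsum_wordWeight a

/-- If the heavy letters are not too heavy and there are enough light letters with label `true`,
then the normalized intensities are at distance at least `ε`. -/
theorem le_sum_sub_sum_altRate {K : ℕ} {ε : ℝ} (hε : 0 ≤ ε) (hε1 : ε ≤ 1) (D β : ℝ≥0) (hD : 0 < D)
    (hDβ : ε * (2 * D) ≤ 2 * β * (K / 8) * (1 - ε)) (s : Fin K → Option Bool)
    (hh : ∑ i, heavyInd (s i) ≤ D) (hl : (K : ℝ) / 8 ≤ ∑ i, plusInd (s i)) :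
    ∃ B : Finset (Option (Fin K)),
      ε ≤ ∑ o ∈ B,
          ((mixRate D (altRate β true) s o / ∑ o, mixRate D (altRate β true) s o : ℝ≥0) : ℝ)
        - ∑ o ∈ B,
          ((mixRate D (altRate β false) s o / ∑ o, mixRate D (altRate β false) s o : ℝ≥0) : ℝ) := by
  classical
  refine ⟨(Finset.univ.filter fun i => s i = some true).map Function.Embedding.some, ?_⟩
  have h1 : ∀ i ∈ Finset.univ.filter fun i => s i = some true,
      ((mixRate D (altRate β false) s (some i) / ∑ o, mixRate D (altRate β false) s o : ℝ≥0) : ℝ)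
        = 0 := by
    intro i hi
    simp [mixRate, (Finset.mem_filter.1 hi).2, altRate]
  have h2 : ∀ i ∈ Finset.univ.filter fun i => s i = some true,
      ((mixRate D (altRate β true) s (some i) / ∑ o, mixRate D (altRate β true) s o : ℝ≥0) : ℝ)
        = 2 * β / (D + ∑ i, heavyInd (s i) + 2 * β * ∑ i, plusInd (s i)) := by
    intro i hi
    rw [NNReal.coe_div, NNReal.coe_sum, coe_sum_mixRate]
    simp only [altRate_true_eq, Finset.sum_add_distrib, ← Finset.mul_sum, mixRate,
      (Finset.mem_filter.1 hi).2]
    simp only [heavyInd, plusInd, if_true, zero_add, mul_one, add_assoc]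
  have h3 : ∑ i, plusInd (s i) = ((Finset.univ.filter fun i => s i = some true).card : ℝ) := by
    rw [Finset.card_filter]
    push_cast
    refine Finset.sum_congr rfl fun i _ => ?_
    match s i with
    | none => simp [plusInd]
    | some true => simp [plusInd]
    | some false => simp [plusInd]
  rw [Finset.sum_map, Finset.sum_map]
  simp only [Function.Embedding.some_apply]
  rw [Finset.sum_congr rfl h1, Finset.sum_congr rfl h2, Finset.sum_const_zero, sub_zero,
    Finset.sum_const, nsmul_eq_mul, ← h3]
  have hh0 : 0 ≤ ∑ i, heavyInd (s i) := Finset.sum_nonneg fun i _ => by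
    match s i with
    | none => simp [heavyInd]
    | some _ => simp [heavyInd]
  set h := ∑ i, heavyInd (s i)
  set l := ∑ i, plusInd (s i)
  have hD' : (0 : ℝ) < D := hD
  have hβ : (0 : ℝ) ≤ β := β.2
  have hK : (0 : ℝ) ≤ K := K.cast_nonneg
  have hl0 : 0 ≤ l := le_trans (by positivity) hl
  rw [← mul_div_assoc, le_div_iff₀ (by positivity)]
  have h4 : 2 * β * (K / 8) * (1 - ε) ≤ 2 * β * l * (1 - ε) := by
    have : 0 ≤ 1 - ε := by linarith
    gcongr
  have h5 : ε * (D + h) ≤ ε * (2 * D) := by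
    gcongr
    linarith
  linarith

/-- The error of the second kind for given states: the test errs, or a sample is too short, or the
heavy letters are too heavy, or there are too few light letters with label `true`. The last two
events are bounded as in the inequalities of Markov and Chernoff. -/
theorem tsum_one_sub_prefixTest_mixRate_le {K m : ℕ} {ε δ : ℝ} (hδ : 0 < δ) (hε : 0 ≤ ε)
    (hε1 : ε ≤ 1) (D β : ℝ≥0) (hD : 0 < D) (hDβ : ε * (2 * D) ≤ 2 * β * (K / 8) * (1 - ε))
    (φ φ' : (Fin m → Option (Fin K)) → (Fin m → Option (Fin K)) → ℝ≥0∞)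
    (hφ : ∀ x y, φ x y + φ' x y = 1)
    (h₁ : ∀ p q : Option (Fin K) → ℝ≥0, ∑ i, p i = 1 → ∑ i, q i = 1 →
      (∃ B : Finset (Option (Fin K)), ε ≤ ∑ i ∈ B, (p i : ℝ) - ∑ i ∈ B, (q i : ℝ)) →
      ∑ x, ∑ y, φ' x y * ((∏ j, (p (x j) : ℝ≥0∞)) * ∏ j, (q (y j) : ℝ≥0∞)) ≤ ENNReal.ofReal δ)
    (s : Fin K → Option Bool) :
    ∑' ω : (Σ N : ℕ, (Fin N → Option (Fin K))) × (Σ N : ℕ, (Fin N → Option (Fin K))),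
        (1 - prefixTest φ ω.1 ω.2) * (wordWeight (mixRate D (altRate β true) s) ω.1.2 *
          wordWeight (mixRate D (altRate β false) s) ω.2.2)
      ≤ ENNReal.ofReal (δ
        + 2 ^ m * (Real.exp (-(D / 2)) * ∏ i, Real.exp (-(altRate β true (s i) / 2)))
        + 2 ^ m * (Real.exp (-(D / 2)) * ∏ i, Real.exp (-(altRate β false (s i) / 2)))
        + (∑ i, heavyInd (s i)) / D + Real.exp (K / 8) * ∏ i, Real.exp (-plusInd (s i))) := by
  have hD' : (0 : ℝ) < D := hD
  have hh0 : 0 ≤ ∑ i, heavyInd (s i) := Finset.sum_nonneg fun i _ => by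
    match s i with
    | none => simp [heavyInd]
    | some _ => simp [heavyInd]
  have hT : ∀ c : Bool, 0 ≤ 2 ^ m * (Real.exp (-((D : ℝ) / 2)) *
      ∏ i, Real.exp (-((altRate β c (s i) : ℝ) / 2))) := fun c => by positivity
  have hT1 := hT true
  have hT2 := hT false
  have hexp : Real.exp (K / 8) * ∏ i, Real.exp (-plusInd (s i))
      = Real.exp (K / 8 - ∑ i, plusInd (s i)) := by
    rw [← Real.exp_sum, ← Real.exp_add, Finset.sum_neg_distrib, sub_eq_add_neg]
  have hA : ∀ c : Bool, 2 ^ m * Real.exp (-((∑ o, (mixRate D (altRate β c) s o : ℝ)) / 2))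
      = 2 ^ m * (Real.exp (-(D / 2)) * ∏ i, Real.exp (-(altRate β c (s i) / 2))) := by
    intro c
    rw [coe_sum_mixRate, ← Real.exp_sum, ← Real.exp_add, Finset.sum_neg_distrib, ← Finset.sum_div]
    congr 2
    ring
  have htriv : ∀ x : ℝ, 1 ≤ x →
      ∑' ω : (Σ N : ℕ, (Fin N → Option (Fin K))) × (Σ N : ℕ, (Fin N → Option (Fin K))),
        (1 - prefixTest φ ω.1 ω.2) * (wordWeight (mixRate D (altRate β true) s) ω.1.2 *
          wordWeight (mixRate D (altRate β false) s) ω.2.2) ≤ ENNReal.ofReal x := by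
    intro x hx
    calc _ ≤ ∑' ω : (Σ N : ℕ, (Fin N → Option (Fin K))) × (Σ N : ℕ, (Fin N → Option (Fin K))),
          wordWeight (mixRate D (altRate β true) s) ω.1.2 *
          wordWeight (mixRate D (altRate β false) s) ω.2.2 := by
          refine ENNReal.tsum_le_tsum fun ω => ?_
          exact mul_le_of_le_one_left zero_le tsub_le_self
      _ = ENNReal.ofReal 1 := by rw [tsum_pair_wordWeight, ENNReal.ofReal_one]
      _ ≤ _ := ENNReal.ofReal_le_ofReal hx
  rw [hexp]
  have hexp0 := Real.exp_pos (K / 8 - ∑ i, plusInd (s i))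
  have hq0 : 0 ≤ (∑ i, heavyInd (s i)) / D := by positivity
  by_cases hh : ∑ i, heavyInd (s i) ≤ D
  · by_cases hl : (K : ℝ) / 8 ≤ ∑ i, plusInd (s i)
    · have hne : ∀ c, ∑ o, mixRate D (altRate β c) s o ≠ 0 := fun c => by
        rw [sum_mixRate]
        exact (add_pos_of_pos_of_nonneg hD zero_le).ne'
      have hone : ∀ c, ∑ o, mixRate D (altRate β c) s o / ∑ o, mixRate D (altRate β c) s o = 1 :=
        fun c => by rw [← Finset.sum_div, div_self (hne c)]
      refine (tsum_one_sub_prefixTest_le _ _ (hne true) (hne false) φ φ' hφ).trans ?_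
      refine (add_le_add_left (h₁ _ _ (hone true) (hone false)
        (le_sum_sub_sum_altRate hε hε1 D β hD hDβ s hh hl)) _).trans ?_
      rw [hA, hA, ← ENNReal.ofReal_add hT1 hT2, ← ENNReal.ofReal_add hδ.le (by linarith)]
      exact ENNReal.ofReal_le_ofReal (by linarith)
    · refine htriv _ ?_
      have : 1 ≤ Real.exp (K / 8 - ∑ i, plusInd (s i)) := Real.one_le_exp (by linarith)
      linarith
  · refine htriv _ ?_
    have : 1 ≤ (∑ i, heavyInd (s i)) / (D : ℝ) := by
      rw [one_le_div hD']
      linarith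
    linarith

theorem sum_prod_stateWeight {K : ℕ} {θ : ℝ≥0} (hθ : θ ≤ 1) :
    ∑ s : Fin K → Option Bool, ∏ i, (stateWeight θ (s i) : ℝ) = 1 := by
  have hwR : ∑ t, (stateWeight θ t : ℝ) = 1 := by exact_mod_cast sum_stateWeight hθ
  have := sum_prod_comp K (fun t => (stateWeight θ t : ℝ)) fun _ => 1
  simpa [hwR] using this

/-- The average over the states of the bound for the error of the second kind. -/
theorem sum_state_error_le {K m : ℕ} (hm : 1 ≤ m) (hK : 64 * m ≤ K) {ε δ κ : ℝ} (hε : 0 < ε)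
    (hε1 : ε < 1) (hκ : 0 < κ) {β θ D : ℝ≥0} (hβ : (β : ℝ) = 32 * m * ε / K)
    (hθ : (θ : ℝ) = κ * (1 - ε) * (32 * m) / K) (hD : (D : ℝ) = 4 * m * (1 - ε))
    (hβ2 : (β : ℝ) ≤ 1 / 2) (hθ32 : (θ : ℝ) ≤ 1 / 32) :
    ∑ s : Fin K → Option Bool, (∏ i, (stateWeight θ (s i) : ℝ)) *
      (δ + 2 ^ m * (Real.exp (-(D / 2)) * ∏ i, Real.exp (-(altRate β true (s i) / 2)))
        + 2 ^ m * (Real.exp (-(D / 2)) * ∏ i, Real.exp (-(altRate β false (s i) / 2)))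
        + (∑ i, heavyInd (s i)) / D + Real.exp (K / 8) * ∏ i, Real.exp (-plusInd (s i)))
      ≤ δ + 8 * κ + 3 * (7 / 8) ^ m := by
  have hm' : (1 : ℝ) ≤ m := by exact_mod_cast hm
  have hK' : 64 * (m : ℝ) ≤ K := by exact_mod_cast hK
  have hK0 : (0 : ℝ) < K := by linarith
  have hη : 0 < 1 - ε := by linarith
  have hη0 := hη.ne'
  have hθ1 : θ ≤ 1 := by
    rw [← NNReal.coe_le_coe, NNReal.coe_one]
    linarith
  have hwR : ∑ t, (stateWeight θ t : ℝ) = 1 := by exact_mod_cast sum_stateWeight hθ1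
  have hW1 := sum_prod_stateWeight (K := K) hθ1
  have hsplit : ∀ s : Fin K → Option Bool, (∏ i, (stateWeight θ (s i) : ℝ)) *
      (δ + 2 ^ m * (Real.exp (-(D / 2)) * ∏ i, Real.exp (-(altRate β true (s i) / 2)))
        + 2 ^ m * (Real.exp (-(D / 2)) * ∏ i, Real.exp (-(altRate β false (s i) / 2)))
        + (∑ i, heavyInd (s i)) / D + Real.exp (K / 8) * ∏ i, Real.exp (-plusInd (s i)))
      = (∏ i, (stateWeight θ (s i) : ℝ)) * δ
        + 2 ^ m * Real.exp (-(D / 2)) * ((∏ i, (stateWeight θ (s i) : ℝ)) *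
          ∏ i, Real.exp (-(altRate β true (s i) / 2)))
        + 2 ^ m * Real.exp (-(D / 2)) * ((∏ i, (stateWeight θ (s i) : ℝ)) *
          ∏ i, Real.exp (-(altRate β false (s i) / 2)))
        + ((∏ i, (stateWeight θ (s i) : ℝ)) * ∑ i, heavyInd (s i)) / D
        + Real.exp (K / 8) * ((∏ i, (stateWeight θ (s i) : ℝ)) *
          ∏ i, Real.exp (-plusInd (s i))) := fun s => by ring
  simp only [hsplit, Finset.sum_add_distrib, ← Finset.mul_sum, ← Finset.sum_mul, ← Finset.sum_div]
  rw [hW1,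
    sum_prod_comp K (fun t => (stateWeight θ t : ℝ)) fun t => Real.exp (-(altRate β true t / 2)),
    sum_prod_comp K (fun t => (stateWeight θ t : ℝ)) fun t => Real.exp (-(altRate β false t / 2)),
    sum_prod_comp K (fun t => (stateWeight θ t : ℝ)) fun t => Real.exp (-plusInd t),
    sum_prod_mul_sum K (fun t => (stateWeight θ t : ℝ)) heavyInd hwR, sum_heavyInd]
  -- short samples
  have hshort : ∀ c, 2 ^ m * Real.exp (-(D / 2)) *
      (∑ t, (stateWeight θ t : ℝ) * Real.exp (-(altRate β c t / 2))) ^ K ≤ (7 / 8) ^ m := by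
    intro c
    have hs0 : 0 ≤ ∑ t, (stateWeight θ t : ℝ) * Real.exp (-(altRate β c t / 2)) :=
      Finset.sum_nonneg fun t _ => by positivity
    have h2 : Real.exp (-2) ≤ 7 / 16 := by
      rw [Real.exp_neg, inv_le_comm₀ (Real.exp_pos _) (by norm_num)]
      linarith [Real.add_one_le_exp (2 : ℝ)]
    calc _ ≤ 2 ^ m * Real.exp (-(D / 2)) * Real.exp (-(β / 8)) ^ K := by
          gcongr
          exact altRate_tilt_le hθ32 hβ2 c
      _ = 2 ^ m * Real.exp (-(2 * m * (1 - ε)) - 4 * m * ε) := by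
          rw [← Real.exp_nat_mul, mul_assoc, ← Real.exp_add, hβ, hD]
          congr 2
          field_simp
          ring
      _ ≤ 2 ^ m * Real.exp (m * (-2)) := by
          gcongr
          nlinarith
      _ = (2 * Real.exp (-2)) ^ m := by rw [Real.exp_nat_mul, mul_pow]
      _ ≤ (7 / 8) ^ m := by
          gcongr
          linarith
  have hfew : Real.exp (K / 8) * (∑ t, (stateWeight θ t : ℝ) * Real.exp (-plusInd t)) ^ K
      ≤ (7 / 8) ^ m := by
    have hs0 : 0 ≤ ∑ t, (stateWeight θ t : ℝ) * Real.exp (-plusInd t) :=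
      Finset.sum_nonneg fun t _ => by positivity
    calc _ = (Real.exp (1 / 8) * ∑ t, (stateWeight θ t : ℝ) * Real.exp (-plusInd t)) ^ K := by
          rw [mul_pow, ← Real.exp_nat_mul]
          congr 2
          ring
      _ ≤ (7 / 8) ^ K := by
          gcongr
          exact plusInd_tilt_le hθ32
      _ ≤ (7 / 8) ^ m := pow_le_pow_of_le_one (by norm_num) (by norm_num) (by omega)
  have hheavy : (K : ℝ) * θ / D = 8 * κ := by
    rw [hθ, hD]
    field_simp
    norm_num
  have e1 := hshort true
  have e2 := hshort false
  rw [hheavy]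
  linarith

theorem tsum_mul_mixWeight_le {τ : Type*} [Fintype τ] {K : ℕ} (w lam mu : τ → ℝ≥0) (D : ℝ≥0)
    (F : (Σ N : ℕ, (Fin N → Option (Fin K))) × (Σ N : ℕ, (Fin N → Option (Fin K))) → ℝ≥0∞)
    (T : (Fin K → τ) → ℝ) (hT0 : ∀ s, 0 ≤ T s)
    (hT : ∀ s, ∑' ω, F ω *
        (wordWeight (mixRate D lam s) ω.1.2 * wordWeight (mixRate D mu s) ω.2.2)
      ≤ ENNReal.ofReal (T s)) :
    ∑' ω, F ω * mixWeight w lam mu D ω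
      ≤ ENNReal.ofReal (∑ s : Fin K → τ, (∏ i, (w (s i) : ℝ)) * T s) := by
  rw [tsum_mul_mixWeight, ENNReal.ofReal_sum_of_nonneg fun s _ =>
    mul_nonneg (by positivity) (hT0 s)]
  refine Finset.sum_le_sum fun s _ => ?_
  rw [ENNReal.ofReal_mul (by positivity), ENNReal.ofReal_prod_of_nonneg fun i _ => by positivity]
  simp only [ENNReal.ofReal_coe_nnreal]
  exact mul_le_mul_right (hT s) _

/-- The lower bound from the prior with heavy letters: a two-sample test with `m` samples for
distance `ε` cannot have an error much below `exp (- m ^ 3 * ε ^ 4 / ((1 - ε) * K ^ 2))`. The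
samples are Poissonized with mean size of order `m`, and long enough for the test. The common mass
`1 - ε` of the two distributions sits on the dummy letter and on heavy letters, of which there are
about `32 * κ * (1 - ε) * m`. A heavy letter can show any pair of small counts, so that a pattern of
repeated light letters is weak evidence. -/
theorem one_add_sq_div_le_exp_of_heavy {K m : ℕ} (hm : 1 ≤ m) (hK : 64 * m ≤ K) {ε δ κ g : ℝ}
    (hε : 0 < ε) (hε1 : ε < 1) (hδ : 0 < δ) (hκ : 0 < κ) (hκ1 : κ ≤ 1 / 16) (hg : 0 ≤ g)
    (hsum : 2 * δ + 8 * κ + 3 * (7 / 8) ^ m + g ≤ 1)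
    (φ φ' : (Fin m → Option (Fin K)) → (Fin m → Option (Fin K)) → ℝ≥0∞)
    (hφ : ∀ x y, φ x y + φ' x y = 1)
    (h₀ : ∀ p : Option (Fin K) → ℝ≥0, ∑ i, p i = 1 →
      ∑ x, ∑ y, φ x y * ((∏ j, (p (x j) : ℝ≥0∞)) * ∏ j, (p (y j) : ℝ≥0∞)) ≤ ENNReal.ofReal δ)
    (h₁ : ∀ p q : Option (Fin K) → ℝ≥0, ∑ i, p i = 1 → ∑ i, q i = 1 →
      (∃ B : Finset (Option (Fin K)), ε ≤ ∑ i ∈ B, (p i : ℝ) - ∑ i ∈ B, (q i : ℝ)) →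
      ∑ x, ∑ y, φ' x y * ((∏ j, (p (x j) : ℝ≥0∞)) * ∏ j, (q (y j) : ℝ≥0∞))
        ≤ ENNReal.ofReal δ) :
    1 + g ^ 2 / δ ≤ Real.exp (16 * Real.exp 4 * (32 * m) ^ 3 * ε ^ 4 / (κ * (1 - ε) * K ^ 2)) := by
  have hm' : (1 : ℝ) ≤ m := by exact_mod_cast hm
  have hK' : 64 * (m : ℝ) ≤ K := by exact_mod_cast hK
  have hK0 : (0 : ℝ) < K := by linarith
  have hη : 0 < 1 - ε := by linarith
  obtain ⟨β, hβ⟩ : ∃ β : ℝ≥0, (β : ℝ) = 32 * m * ε / K := ⟨⟨_, by positivity⟩, rfl⟩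
  obtain ⟨θ, hθ⟩ : ∃ θ : ℝ≥0, (θ : ℝ) = κ * (1 - ε) * (32 * m) / K := ⟨⟨_, by positivity⟩, rfl⟩
  obtain ⟨D, hD⟩ : ∃ D : ℝ≥0, (D : ℝ) = 4 * m * (1 - ε) := ⟨⟨_, by positivity⟩, rfl⟩
  have hβ2 : (β : ℝ) ≤ 1 / 2 := by
    rw [hβ, div_le_iff₀ hK0]
    nlinarith
  have hθ0 : 0 < θ := by
    rw [← NNReal.coe_pos, hθ]
    positivity
  have hθ32 : (θ : ℝ) ≤ 1 / 32 := by
    rw [hθ, div_le_iff₀ hK0]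
    have : κ * (1 - ε) ≤ 1 / 16 * 1 := by gcongr; linarith
    nlinarith
  have hθ1 : θ ≤ 1 := by
    rw [← NNReal.coe_le_coe, NNReal.coe_one]
    linarith
  have hD0 : 0 < D := by
    rw [← NNReal.coe_pos, hD]
    positivity
  have hDβ : ε * (2 * D) ≤ 2 * β * (K / 8) * (1 - ε) := by
    rw [hD, hβ]
    field_simp
    linarith
  have hw := sum_stateWeight hθ1
  have hcell := mixCell_sq_div_add_le hθ0 hθ1 hβ2
  obtain ⟨ρ, hρ, hV⟩ := exists_sq_mixWeight_le (K := K) (stateWeight θ) (nullRate β) (nullRate β)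
    (altRate β true) (altRate β false) D hw (fun a b => (hcell a b).1)
    (16 * β ^ 4 * Real.exp 2 / θ) (by positivity) fun a b => (hcell a b).2
  have hexp : (K : ℝ) * (16 * β ^ 4 * Real.exp 2 / θ * Real.exp 2)
      = 16 * Real.exp 4 * (32 * m) ^ 3 * ε ^ 4 / (κ * (1 - ε) * K ^ 2) := by
    rw [show (4 : ℝ) = 2 + 2 by norm_num, Real.exp_add, hβ, hθ]
    field_simp
  rw [hexp] at hV
  have hle : ∀ ω : (Σ N : ℕ, (Fin N → Option (Fin K))) × (Σ N : ℕ, (Fin N → Option (Fin K))),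
      prefixTest φ ω.1 ω.2 ≤ 1 := by
    intro ω
    unfold prefixTest
    split_ifs
    · exact le_self_add.trans_eq (hφ _ _)
    · exact zero_le
    · exact zero_le
  have hW1 := sum_prod_stateWeight (K := K) hθ1
  refine one_add_sq_div_le_of_errors (mixWeight (stateWeight θ) (nullRate β) (nullRate β) D)
    (mixWeight (stateWeight θ) (altRate β true) (altRate β false) D) ρ
    (fun ω => prefixTest φ ω.1 ω.2) (fun ω => 1 - prefixTest φ ω.1 ω.2)
    (fun ω => add_tsub_cancel_of_le (hle ω)) (tsum_mixWeight _ _ _ D hw).le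
    (tsum_mixWeight _ _ _ D hw) hρ _ g δ (δ + 8 * κ + 3 * (7 / 8) ^ m) (Real.exp_pos _).le hδ
    (by positivity) hg (by linarith) hV ?_ ?_
  · -- under the null hypothesis both samples have the same intensities, whatever the states are
    refine (tsum_mul_mixWeight_le (stateWeight θ) (nullRate β) (nullRate β) D _ (fun _ => δ)
      (fun _ => hδ.le) fun s => ?_).trans ?_
    · have hne : ∑ o, mixRate D (nullRate β) s o ≠ 0 := by
        rw [sum_mixRate]
        exact (add_pos_of_pos_of_nonneg hD0 zero_le).ne'
      have hone : ∑ o, mixRate D (nullRate β) s o / ∑ o, mixRate D (nullRate β) s o = 1 := by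
        rw [← Finset.sum_div, div_self hne]
      exact (tsum_prefixTest_le _ _ hne hne φ).trans
        (h₀ (fun o => mixRate D (nullRate β) s o / ∑ o, mixRate D (nullRate β) s o) hone)
    · rw [← Finset.sum_mul, hW1, one_mul]
  · have hh0 : ∀ s : Fin K → Option Bool, 0 ≤ ∑ i, heavyInd (s i) := fun s =>
      Finset.sum_nonneg fun i _ => by
        match s i with
        | none => simp [heavyInd]
        | some _ => simp [heavyInd]
    refine (tsum_mul_mixWeight_le (stateWeight θ) (altRate β true) (altRate β false) D _ _
      (fun s => ?_) (tsum_one_sub_prefixTest_mixRate_le hδ hε.le hε1.le D β hD0 hDβ φ φ' hφ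
        h₁)).trans (ENNReal.ofReal_le_ofReal
          (sum_state_error_le hm hK hε hε1 hκ hβ hθ hD hβ2 hθ32))
    have := hh0 s
    positivity

/-! ### Lower bounds for the sample size -/

/-- A bound for `1 + g² / δ` turned into one for `log (1 / δ)`, with a factor that does not depend
on `δ`, by Bernoulli's inequality `(1 / δ) ^ g² ≤ 1 + g² * (1 / δ - 1)`. -/
theorem sq_mul_log_le_of_one_add_sq_div_le {g δ A : ℝ} (hg : 0 ≤ g) (hg1 : g ≤ 1) (hδ : 0 < δ)
    (h : 1 + g ^ 2 / δ ≤ Real.exp A) : g ^ 2 * Real.log (1 / δ) ≤ A := by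
  have h1 := rpow_one_add_le_one_add_mul_self (s := 1 / δ - 1) (p := g ^ 2)
    (by linarith [one_div_pos.2 hδ]) (by positivity) (pow_le_one₀ hg hg1)
  rw [add_sub_cancel] at h1
  have h2 : (1 / δ) ^ (g ^ 2) ≤ Real.exp A := by
    refine h1.trans (le_trans ?_ h)
    rw [mul_sub, mul_one_div]
    linarith [sq_nonneg g]
  rw [← Real.log_rpow (by positivity), Real.log_le_iff_le_exp (by positivity)]
  exact h2

/-- The two lower bounds from perturbations of the uniform distribution on pairs of letters. -/
theorem sample_size_lower_bounds {k m : ℕ} (hk : 2 ≤ k) {ε δ G : ℝ} (hε : 0 ≤ ε) (hε1 : ε ≤ 1)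
    (hδ : 0 < δ) (hG : 0 < G) (hδG : 2 * δ + G ≤ 1)
    (h : ∃ ψ : (Fin m → Fin k) × (Fin m → Fin k) → Fin 2,
      Measurable ψ ∧ TestsWithError ψ (twoSampleHyp m ε (classD k)) δ) :
    G ^ 2 * Real.log (1 / δ) ≤ 2 * m * ε ^ 2 ∧
      G ^ 2 * Real.log (1 / δ) ≤ 6 * m ^ 2 * ε ^ 4 / k := by
  have hr : 0 < k / 2 := Nat.div_pos hk two_pos
  obtain ⟨e⟩ := Function.Embedding.nonempty_of_card_le (α := Fin (k / 2) × Bool) (β := Fin k)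
    (by simp only [Fintype.card_prod, Fintype.card_fin, Fintype.card_bool]; omega)
  obtain ⟨φ, φ', hφ, h₀, h₁⟩ := exists_test_of_embedding h e
  have hb := one_add_sq_div_le_pairMoment hr hε hε1 hδ hG.le hδG φ φ' hφ h₀ h₁
  obtain ⟨h2, h3⟩ := pairMoment_le_exp_mul hr (2 * m) (ε := ε) (by rwa [abs_of_nonneg hε])
  have hG1 : G ≤ 1 := by linarith
  refine ⟨(sq_mul_log_le_of_one_add_sq_div_le hG.le hG1 hδ (hb.trans h2)).trans_eq
      (by push_cast; ring),
    (sq_mul_log_le_of_one_add_sq_div_le hG.le hG1 hδ (hb.trans h3)).trans ?_⟩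
  have hk3 : (k : ℝ) ≤ 3 * (k / 2 : ℕ) := by
    have : k ≤ 3 * (k / 2) := by omega
    exact_mod_cast this
  have hr' : (0 : ℝ) < (k / 2 : ℕ) := by exact_mod_cast hr
  have hk' : (0 : ℝ) < k := by
    have : 0 < k := by omega
    exact_mod_cast this
  push_cast
  rw [div_le_div_iff₀ (by positivity) hk']
  calc (2 * (m : ℝ)) ^ 2 * ε ^ 4 * k ≤ (2 * m) ^ 2 * ε ^ 4 * (3 * (k / 2 : ℕ)) := by gcongr
    _ = _ := by ring

theorem sample_size_lower_bound_of_heavy {k m : ℕ} (hm : 1 ≤ m) (hk : 64 * m < k) {ε δ G : ℝ}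
    (hε : 0 < ε) (hε1 : ε < 1) (hδ : 0 < δ) (hG : 0 < G) (hδG : 2 * δ + G ≤ 1)
    (hm0 : 3 * (7 / 8) ^ m ≤ G / 4)
    (h : ∃ ψ : (Fin m → Fin k) × (Fin m → Fin k) → Fin 2,
      Measurable ψ ∧ TestsWithError ψ (twoSampleHyp m ε (classD k)) δ) :
    Real.log (1 / δ) * (1 - ε) ≤ 2 ^ 32 * Real.exp 4 / G ^ 3 * (m ^ 3 * ε ^ 4 / k ^ 2) := by
  obtain ⟨K, rfl⟩ : ∃ K, k = K + 1 := ⟨k - 1, by omega⟩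
  have hG1 : G ≤ 1 := by linarith
  obtain ⟨e⟩ := Function.Embedding.nonempty_of_card_le (α := Option (Fin K)) (β := Fin (K + 1))
    (by simp)
  obtain ⟨φ, φ', hφ, h₀, h₁⟩ := exists_test_of_embedding h e
  have hb := one_add_sq_div_le_exp_of_heavy hm (by omega) hε hε1 hδ (κ := G / 32) (by positivity)
    (by linarith) (g := G / 2) (by positivity) (by linarith) φ φ' hφ h₀ h₁
  have hL := sq_mul_log_le_of_one_add_sq_div_le (by positivity) (by linarith) hδ hb
  have hη : 0 < 1 - ε := by linarith
  have hK1 : (1 : ℝ) ≤ K := by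
    have : 1 ≤ K := by omega
    exact_mod_cast this
  have hη0 := hη.ne'
  calc Real.log (1 / δ) * (1 - ε)
      = ((G / 2) ^ 2 * Real.log (1 / δ)) * (4 * (1 - ε) / G ^ 2) := by
        field_simp
        norm_num
    _ ≤ 16 * Real.exp 4 * (32 * m) ^ 3 * ε ^ 4 / (G / 32 * (1 - ε) * K ^ 2)
        * (4 * (1 - ε) / G ^ 2) := by gcongr
    _ = 2 ^ 26 * Real.exp 4 / G ^ 3 * (m ^ 3 * ε ^ 4 / K ^ 2) := by
        field_simp
        norm_num
    _ ≤ 2 ^ 26 * Real.exp 4 / G ^ 3 * (m ^ 3 * ε ^ 4 / (((K + 1 : ℕ) : ℝ) / 2) ^ 2) := by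
        gcongr
        push_cast
        linarith
    _ = 2 ^ 28 * Real.exp 4 / G ^ 3 * (m ^ 3 * ε ^ 4 / ((K + 1 : ℕ) : ℝ) ^ 2) := by
        field_simp
    _ ≤ _ := by
        gcongr
        · norm_num
        · norm_num

/-- The three lower bounds for the sample size `m` of a two-sample test, with a constant that
depends on `δ₀` only. -/
theorem exists_sample_size_lower_bounds {δ₀ : ℝ} (hδ₀ : δ₀ < 1 / 2) :
    ∃ C : ℝ, 0 < C ∧ ∀ (k m : ℕ) (ε δ : ℝ), 2 ≤ k → 0 < ε → ε ≤ 1 → 0 < δ → δ ≤ δ₀ →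
      (∃ ψ : (Fin m → Fin k) × (Fin m → Fin k) → Fin 2,
        Measurable ψ ∧ TestsWithError ψ (twoSampleHyp m ε (classD k)) δ) →
      Real.log (1 / δ) ≤ C * (m * ε ^ 2) ∧
      Real.log (1 / δ) ≤ C * (m ^ 2 * ε ^ 4 / k) ∧
      Real.log (1 / δ) * (1 - ε) ≤ C * (m ^ 3 * ε ^ 4 / k ^ 2) := by
  obtain ⟨G, hGdef⟩ : ∃ G, G = 1 - 2 * δ₀ := ⟨_, rfl⟩
  have hG : 0 < G := by linarith
  obtain ⟨m₀, hm₀⟩ : ∃ m₀ : ℕ, (7 / 8 : ℝ) ^ m₀ < G / 12 :=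
    exists_pow_lt_of_lt_one (by positivity) (by norm_num)
  refine ⟨390 / G ^ 2 + 72 * m₀ ^ 2 / G ^ 4 + 2 ^ 32 * Real.exp 4 / G ^ 3, by positivity, ?_⟩
  intro k m ε δ hk hε hε1 hδ hδδ₀ h
  set C := 390 / G ^ 2 + 72 * (m₀ : ℝ) ^ 2 / G ^ 4 + 2 ^ 32 * Real.exp 4 / G ^ 3 with hC
  have c1 : 0 ≤ 390 / G ^ 2 := by positivity
  have c2 : 0 ≤ 72 * (m₀ : ℝ) ^ 2 / G ^ 4 := by positivity
  have c3 : 0 ≤ 2 ^ 32 * Real.exp 4 / G ^ 3 := by positivity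
  have hδG : 2 * δ + G ≤ 1 := by linarith
  obtain ⟨h1, h2⟩ := sample_size_lower_bounds hk hε.le hε1 hδ hG hδG h
  have hk0 : (0 : ℝ) < k := by
    have : 0 < k := by omega
    exact_mod_cast this
  have hL : 1 / 2 ≤ Real.log (1 / δ) := by
    have : Real.log 2 ≤ Real.log (1 / δ) := by
      refine Real.log_le_log two_pos ?_
      rw [le_div_iff₀ hδ]
      linarith
    linarith [Real.log_two_gt_d9]
  set L := Real.log (1 / δ) with hLdef
  have h1' : L ≤ 2 / G ^ 2 * (m * ε ^ 2) := by
    rw [div_mul_eq_mul_div, le_div_iff₀ (by positivity)]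
    linarith
  have h2' : L ≤ 6 / G ^ 2 * (m ^ 2 * ε ^ 4 / k) := by
    rw [div_mul_eq_mul_div, le_div_iff₀ (by positivity)]
    have : 6 * (m ^ 2 * ε ^ 4 / k) = 6 * m ^ 2 * ε ^ 4 / k := by ring
    linarith
  have hm : 1 ≤ m := by
    by_contra hm
    have : m = 0 := by omega
    subst this
    norm_num at h1'
    linarith
  have hm' : (1 : ℝ) ≤ m := by exact_mod_cast hm
  have d1 : 2 / G ^ 2 ≤ 390 / G ^ 2 := by gcongr; norm_num
  have d2 : 6 / G ^ 2 ≤ 390 / G ^ 2 := by gcongr; norm_num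
  refine ⟨h1'.trans ?_, h2'.trans ?_, ?_⟩
  · gcongr
    linarith
  · gcongr
    linarith
  · rcases eq_or_lt_of_le hε1 with rfl | hε1
    · rw [sub_self, mul_zero]
      positivity
    have hLη : L * (1 - ε) ≤ L * 1 := by
      gcongr
      linarith
    -- the third bound follows from the second one as long as `k` is at most a multiple of `m`
    have hcase : ∀ c : ℝ, 0 ≤ c → k ≤ c * m →
        L * (1 - ε) ≤ 6 / G ^ 2 * c * (m ^ 3 * ε ^ 4 / k ^ 2) := by
      intro c hc hck
      calc L * (1 - ε) ≤ L := by linarith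
        _ ≤ 6 / G ^ 2 * (m ^ 2 * ε ^ 4 / k) := h2'
        _ = 6 / G ^ 2 * (m ^ 2 * ε ^ 4 * k / k ^ 2) := by field_simp
        _ ≤ 6 / G ^ 2 * (m ^ 2 * ε ^ 4 * (c * m) / k ^ 2) := by gcongr
        _ = _ := by ring
    by_cases hkm : k ≤ 64 * m
    · refine (hcase 64 (by norm_num) (by exact_mod_cast hkm)).trans ?_
      gcongr
      calc 6 / G ^ 2 * 64 = 384 / G ^ 2 := by ring
        _ ≤ 390 / G ^ 2 := by gcongr; norm_num
        _ ≤ C := by linarith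
    · by_cases hmm : m₀ ≤ m
      · have hmG : 3 * (7 / 8 : ℝ) ^ m ≤ G / 4 := by
          have : (7 / 8 : ℝ) ^ m ≤ (7 / 8) ^ m₀ :=
            pow_le_pow_of_le_one (by norm_num) (by norm_num) hmm
          linarith
        refine (sample_size_lower_bound_of_heavy hm (by omega) hε hε1 hδ hG hδG hmG h).trans ?_
        gcongr
        linarith
      · have hmm' : (m : ℝ) ≤ m₀ := by exact_mod_cast (not_le.1 hmm).le
        have hkm₀ : (k : ℝ) ≤ 12 * m₀ ^ 2 / G ^ 2 * m := by
          have e1 : 1 / 2 ≤ 6 / G ^ 2 * (m₀ ^ 2 * 1 ^ 4 / k) :=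
            hL.trans (h2'.trans (by gcongr))
          have e2 : (k : ℝ) ≤ 12 * m₀ ^ 2 / G ^ 2 := by
            rw [one_pow, mul_one, div_mul_div_comm, div_le_div_iff₀ two_pos (by positivity)] at e1
            rw [le_div_iff₀ (by positivity)]
            linarith
          exact e2.trans (le_mul_of_one_le_right (by positivity) hm')
        refine (hcase _ (by positivity) hkm₀).trans ?_
        gcongr
        calc 6 / G ^ 2 * (12 * m₀ ^ 2 / G ^ 2) = 72 * m₀ ^ 2 / G ^ 4 := by
              field_simp
              ring
          _ ≤ C := by linarith

/-! ### From tests to separating sets -/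

/-- A test for a given distance is also a test for any larger distance. -/
theorem TestsWithError.mono {k m : ℕ} {ε ε' δ : ℝ} (hε : ε ≤ ε')
    {ψ : (Fin m → Fin k) × (Fin m → Fin k) → Fin 2}
    (hψ : TestsWithError ψ (twoSampleHyp m ε (classD k)) δ) :
    TestsWithError ψ (twoSampleHyp m ε' (classD k)) δ := by
  intro i R hR
  match i with
  | 0 => exact hψ 0 R hR
  | 1 =>
    obtain ⟨P, -, Q, -, hPQ, rfl⟩ : ∃ P ∈ classD k, ∃ Q ∈ classD k, ε' ≤ tvDist P Q ∧
      R = twoSampleLaw m P Q := hR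
    exact hψ.alternative_error P Q (hε.trans hPQ)

/-- The infimum in the definition of the sample complexity is attained. -/
theorem exists_test_of_nTS_le {k m : ℕ} {ε δ : ℝ} (h : nTS ε δ (classD k) ≤ m) :
    ∃ ψ : (Fin m → Fin k) × (Fin m → Fin k) → Fin 2,
      Measurable ψ ∧ TestsWithError ψ (twoSampleHyp m ε (classD k)) δ := by
  have hmem := csInf_mem (s := {N : ℕ∞ | ∀ n : ℕ, N ≤ n →
    ∃ ψ : (Fin n → Fin k) × (Fin n → Fin k) → Fin 2,
      Measurable ψ ∧ TestsWithError ψ (twoSampleHyp n ε (classD k)) δ})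
    ⟨⊤, fun n hn => absurd (top_le_iff.1 hn) (ENat.natCast_ne_top n)⟩
  exact hmem m h

theorem two_le_of_halfL1_pos {k : ℕ} {p q : ProbabilityMeasure (Fin k)} (h : 0 < halfL1 p q) :
    2 ≤ k := by
  by_contra hk
  have hp := sum_coe_singleton p
  have hq := sum_coe_singleton q
  unfold halfL1 at h
  match k, p, q with
  | 0, p, q => simp at h
  | 1, p, q =>
    rw [Fin.sum_univ_one] at hp hq h
    rw [hp, hq] at h
    simp at h
  | n + 2, _, _ => omega

theorem sq_mul_min_mono {ε ε' a b : ℝ} (hε : 0 < ε) (h : ε ≤ ε') (ha : 0 ≤ a) (hb : 0 ≤ b) :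
    ε ^ 2 * min a (min b (1 / ε)) ≤ ε' ^ 2 * min a (min b (1 / ε')) := by
  have hε' : 0 < ε' := hε.trans_le h
  have h1 : ∀ x : ℝ, 0 < x → x ^ 2 * (1 / x) = x := fun x hx => by field_simp
  rw [mul_min_of_nonneg _ _ (sq_nonneg ε), mul_min_of_nonneg _ _ (sq_nonneg ε),
    mul_min_of_nonneg _ _ (sq_nonneg ε'), mul_min_of_nonneg _ _ (sq_nonneg ε'), h1 ε hε, h1 ε' hε']
  gcongr

theorem mainTheorem5 (δ₀ : ℝ) (hδ₀ : δ₀ < 1 / 2) :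
    ∃ c : ℝ, 0 < c ∧
      ∀ (k : ℕ) (p q : ProbabilityMeasure (Fin k)) (ε δ : ℝ) (n : ℕ),
        p ∈ classD k → q ∈ classD k →
        0 < ε → ε ≤ tvDist p q →
        0 < δ → δ ≤ δ₀ →
        (nTS ε δ (classD k) : ℝ≥0∞) / ENNReal.ofReal c ≤ (n : ℝ≥0∞) →
        1 - δ ≤ (dataLaw n p q).real
          {ω | c * ε ^ 2 * min ((n : ℝ) / k) (min (Real.sqrt ((n : ℝ) / k)) (1 / ε)) ≤
            sep p q (sHalfHat n ω)} := by
  obtain ⟨C, hC, hlow⟩ := exists_sample_size_lower_bounds hδ₀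
  obtain ⟨c, hcdef⟩ : ∃ c : ℝ, c = min (1 / 2 ^ 13) (1 / 2 ^ 60 / C) := ⟨_, rfl⟩
  have hc : 0 < c := by rw [hcdef]; positivity
  have hc13 : c ≤ 1 / 2 ^ 13 := by rw [hcdef]; exact min_le_left _ _
  have hc1 : c ≤ 1 := hc13.trans (by norm_num)
  have hcC : C * c ≤ 1 / 2 ^ 60 := by
    have : c ≤ 1 / 2 ^ 60 / C := by rw [hcdef]; exact min_le_right _ _
    rwa [le_div_iff₀ hC, mul_comm] at this
  refine ⟨c, hc, ?_⟩
  intro k p q ε δ n _ _ hε hεpq hδ hδδ₀ hn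
  -- a test based on `m` samples exists
  obtain ⟨m, hm⟩ : ∃ m : ℕ, m = ⌊c * n⌋₊ := ⟨_, rfl⟩
  have hmn : (m : ℝ) ≤ c * n := by rw [hm]; exact Nat.floor_le (by positivity)
  have hle : nTS ε δ (classD k) ≤ m := by
    rw [ENNReal.div_le_iff (ENNReal.ofReal_pos.2 hc).ne' ENNReal.ofReal_ne_top,
      ← ENNReal.ofReal_natCast n, ← ENNReal.ofReal_mul n.cast_nonneg] at hn
    obtain ⟨N, hN⟩ : ∃ N : ℕ, nTS ε δ (classD k) = N := by
      refine ENat.ne_top_iff_exists.1 ?_ |>.imp fun N h => h.symm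
      intro htop
      rw [htop] at hn
      exact ENNReal.ofReal_ne_top (top_le_iff.1 hn)
    rw [hN] at hn ⊢
    rw [ENat.toENNReal_coe, ← ENNReal.ofReal_natCast N,
      ENNReal.ofReal_le_ofReal_iff (by positivity)] at hn
    rw [hm]
    exact_mod_cast Nat.le_floor (by linarith)
  -- the distance of `p` and `q` may take the place of `ε`
  have hεe : ε ≤ halfL1 p q := hεpq.trans (tvDist_le_halfL1 p q)
  have he : 0 < halfL1 p q := hε.trans_le hεe
  have he1 := halfL1_le_one p q
  obtain ⟨ψ, hψm, hψ⟩ := exists_test_of_nTS_le hle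
  obtain ⟨h1, h2, h3⟩ := hlow k m (halfL1 p q) δ (two_le_of_halfL1_pos he) he he1 hδ hδδ₀
    ⟨ψ, hψm, hψ.mono hεe⟩
  have hL : 0 < Real.log (1 / δ) := Real.log_pos (by rw [lt_div_iff₀ hδ]; linarith)
  have hn0 : 0 < n := by
    rcases Nat.eq_zero_or_pos n with rfl | h
    · have hm0 : m = 0 := by simpa using hm
      rw [hm0] at h1
      norm_num at h1
      norm_num at hL
      linarith
    · exact h
  have hn' : (0 : ℝ) < n := by exact_mod_cast hn0
  have hm2 : (m : ℝ) ^ 2 ≤ c * n ^ 2 := by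
    calc (m : ℝ) ^ 2 ≤ (c * n) ^ 2 := by gcongr
      _ = c * (c * n ^ 2) := by ring
      _ ≤ c * (1 * n ^ 2) := by gcongr
      _ = _ := by ring
  have hm3 : (m : ℝ) ^ 3 ≤ c * n ^ 3 := by
    calc (m : ℝ) ^ 3 = m ^ 2 * m := by ring
      _ ≤ (c * n ^ 2) * (c * n) := by gcongr
      _ = c * (c * n ^ 3) := by ring
      _ ≤ c * (1 * n ^ 3) := by gcongr
      _ = _ := by ring
  have key := one_sub_exp_le_dataLaw hn0 p q he (Real.log (1 / δ)) hL.le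
    (h1.trans ?_) (h2.trans ?_) (h3.trans ?_)
  · have hexp : Real.exp (-Real.log (1 / δ)) = δ := by
      rw [one_div, Real.log_inv, neg_neg, Real.exp_log hδ]
    rw [hexp] at key
    have : IsProbabilityMeasure (dataLaw n p q) := by
      unfold dataLaw poissonizedLaw coinLaw
      infer_instance
    refine key.trans (measureReal_mono fun ω hω => ?_)
    have hmono := sq_mul_min_mono (a := (n : ℝ) / k) (b := Real.sqrt ((n : ℝ) / k)) hε hεe
      (by positivity) (by positivity)
    change _ ≤ sep p q (sHalfHat n ω)
    refine le_trans ?_ hω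
    rw [mul_assoc]
    exact mul_le_mul hc13 hmono (by positivity) (by positivity)
  · calc C * (m * halfL1 p q ^ 2) ≤ C * (c * n * halfL1 p q ^ 2) := by gcongr
      _ = C * c * (n * halfL1 p q ^ 2) := by ring
      _ ≤ _ := by gcongr
  · calc C * (m ^ 2 * halfL1 p q ^ 4 / k) ≤ C * (c * n ^ 2 * halfL1 p q ^ 4 / k) := by gcongr
      _ = C * c * (n * halfL1 p q ^ 4 * (n / k)) := by ring
      _ ≤ _ := by gcongr
  · calc C * (m ^ 3 * halfL1 p q ^ 4 / k ^ 2) ≤ C * (c * n ^ 3 * halfL1 p q ^ 4 / k ^ 2) := by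
          gcongr
      _ = C * c * (n * halfL1 p q ^ 4 * (n / k) ^ 2) := by ring
      _ ≤ _ := by gcongr
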